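/- **Model.** For every $k\in\mathbb N$ (an index along which all limits are taken, usually suppressed) let $a\ge 1$ groups be given, with dimensions $d_i\ge1$, sample sizes $n_i\ge 6$, expectations $\mu_i\in\mathbb R^{d_i}$ and positive definite covariance matrices $\Sigma_i\in\mathbb R^{d_i\times d_i}$, $i=1,\dots,a$, all of which may depend on $k$. Put $N=\sum_i n_i$, $D=\sum_i d_i$, $n_{\min}=\min_i n_i$, $\mu=(\mu_1^\top,\dots,\mu_a^\top)^\top$. The observations $X_{i,j}\sim\mathcal N_{d_i}(\mu_i,\Sigma_i)$, $j\le n_i$, $i\le a$, are independent. Let $T\in\mathbb R^{D\times D}$ be a nonzero symmetric idempotent matrix, $V_N=\bigoplus_{i=1}^a\frac N{n_i}\Sigma_i$, $\overline X$ the pooled vector of the group means, and $Q_N=N\,\overline X^\top T\overline X$. Let $\lambda_1\ge\dots\ge\lambda_D$ be the eigenvalues of $TV_NT$, $\beta_s=\lambda_s/\sqrt{\sum_\ell\lambda_\ell^2}$ for $s\le D$ and $\beta_s=0$ for $s>D$, and $$\widetilde W_N=\frac{Q_N-\operatorname{tr}(TV_N)}{\sqrt{2\operatorname{tr}((TV_N)^2)}},\qquad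 f_P=\frac{\operatorname{tr}^3((TV_N)^2)}{\operatorname{tr}^2((TV_N)^3)} .$$ **Frameworks.** One of the following holds: (i) $a$ is fixed and $\min(\max_i d_i,n_1,\dots,n_a)\to\infty$; (ii) every $d_i$ is fixed and $\min(a,n_1,\dots,n_a)\to\infty$; (iii) $\min(a,\max_i d_i,n_1,\dots,n_a)\to\infty$. No further relation between $a$ and the sample sizes is assumed. **Estimators.** Let $\pi_{j,i}$ ($j\in\mathbb N$, $i\le a$) be independent uniform random permutations of $\{1,\dots,n_i\}$; for $m\in\{2,4,6\}$ let $\sigma(u,m)=(\sigma_1(u,m),\dots,\sigma_m(u,m))$, $u\in\mathbb N$, be independent uniform ordered samples without replacement from $\{1,\dots,n_{\min}\}$; the observations, the permutations and the subsamples are independent of each other. Let $Z^{j}_{(\ell,\ell')}\in\mathbb R^D$ have blocks $\sqrt{N/n_i}\,\bigl(X_{i,\pi_{j,i}(\ell)}-X_{i,\pi_{j,i}(\ell')}\bigr)$, $i\le a$, put $\Lambda^j(\ell_1,\ell_2,\ell_3,\ell_4)=(Z^{j}_{(\ell_1,\ell_2)})^\top T Z^{j}_{(\ell_3,\ell_4)}$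 and $$h_1^j(\ell)=\Lambda^j(\ell_1,\ell_2,\ell_1,\ell_2),\quad h_2^j(\ell)=\Lambda^j(\ell_1,\ell_2,\ell_3,\ell_4)^2,\quad h_3^j(\ell)=\Lambda^j(\ell_1,\ell_2,\ell_3,\ell_4)\Lambda^j(\ell_3,\ell_4,\ell_5,\ell_6)\Lambda^j(\ell_5,\ell_6,\ell_1,\ell_2).$$ With all sums over tuples of pairwise distinct indices in $\{1,\dots,n_{\min}\}$, $$B_1(\Upsilon)=\frac1{2\Upsilon}\sum_{j=1}^{\Upsilon}\sum_{\ell_1<\ell_2}\frac{h_1^j(\ell)}{\binom{n_{\min}}2},\quad B_2(\Upsilon)=\frac1{4\Upsilon}\sum_{j=1}^{\Upsilon}\sum_{\ell_1<\ell_2,\ \ell_3<\ell_4}\frac{h_2^j(\ell)}{6\binom{n_{\min}}4},\quad B_3(\Upsilon)=\frac1{8\Upsilon}\sum_{j=1}^{\Upsilon}\sum_{\ell_1,\dots,\ell_6}\frac{h_3^j(\ell)}{n_{\min}!/(n_{\min}-6)!},$$ $$B_r^\star(\Upsilon_1,\Upsilon_2)=\frac1{2^r\Upsilon_1\Upsilon_2}\sum_{j=1}^{\Upsilon_1}\sum_{u=1}^{\Upsilon_2}h_r^j(\sigma(u,2r)),\qquad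 r=1,2,3.$$ The numbers $\Upsilon\ge1$, $\Upsilon_1\ge1$ are arbitrary and $\Upsilon_2\to\infty$; they may depend on $k$ and be chosen separately for $r=1,2,3$. Put $$W_N^B=\frac{Q_N-B_1}{\sqrt{2B_2}},\quad W_N^{B\star}=\frac{Q_N-B_1^\star}{\sqrt{2B_2^\star}},\quad \hat f_P^{B}=\frac{B_2^3}{B_3^2},\quad \hat f_P^{B\star}=\frac{(B_2^\star)^3}{(B_3^\star)^2}.$$ **Claim.** In each of the frameworks (i)–(iii): 1. Suppose $T\mu=0$ for all $k$, and $\beta_s\to b_s$ for all $s\in\mathbb N$, where $(b_s)_{s\ge1}$ is a decreasing sequence in $[0,1]$. Then $\widetilde W_N$, $W_N^B$ and $W_N^{B\star}$ all converge in distribution to $$\sum_{s=1}^{\infty}b_s\frac{C_s-1}{\sqrt2}+\sqrt{1-\sum_{s=1}^\infty b_s^2}\;Z,$$ where $C_1,C_2,\dots\sim\chi^2_1$ and $Z\sim\mathcal N(0,1)$ are independent (the first sum has $r=\#\{s:b_s\ne0\}\le\infty$ nonzero terms; the $Z$-term is absent if $\sum_s b_s^2=1$). 2. For $\hat f\in\{\hat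 f_P^B,\hat f_P^{B\star}\}$, whether or not $T\mu=0$: $\ \dfrac1{\hat f}-\dfrac1{f_P}\to0$ in probability. 3. For $f>0$ let $K_f=(\chi_f^2-f)/\sqrt{2f}$, and for $\hat f$ as in 2. let $K_{\hat f}$ be a random variable whose conditional law given $\hat f$ is that of $K_f$ at $f=\hat f$ (when $\hat f>0$ fails through a vanishing $B_2$ or $B_3$, use $\mathcal N(0,1)$, the limit law of $K_f$ as $f\to\infty$). Then $K_{\hat f}$ converges in distribution to $\mathcal N(0,1)$ if and only if $\beta_1\to0$, and to $(\chi_1^2-1)/\sqrt2$ if and only if $\beta_1\to1$. The same two equivalences hold if convergence in distribution of $K_{\hat f}$ is replaced by weak convergence in probability of the conditional law of $K_{\hat f}$ given $\hat f$. -/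

import Mathlib

open MeasureTheory ProbabilityTheory Filter Topology Matrix

noncomputable section

namespace SplitPlot

/-! ### The parameters of one experiment -/

/-- A split-plot design with `a` groups, group-dependent dimensions `d i`, sample sizes `n i`,
expectations `μ i`, positive definite covariance matrices `S i`, and a nonzero symmetric idempotent
hypothesis matrix `T` on the pooled space (indexed by pairs of a group and a coordinate).
Six observations per group are needed for the trace estimators to be defined. -/
structure Design where
  a : ℕ
  d : Fin a → ℕ
  n : Fin a → ℕ
  d_pos : ∀ i, 0 < d i
  six_le_n : ∀ i, 6 ≤ n i
  μ : ∀ i, EuclideanSpace ℝ (Fin (d i))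
  S : ∀ i, Matrix (Fin (d i)) (Fin (d i)) ℝ
  S_posDef : ∀ i, (S i).PosDef
  T : Matrix (Σ i, Fin (d i)) (Σ i, Fin (d i)) ℝ
  T_symm : T.IsSymm
  T_idem : T * T = T
  T_ne_zero : T ≠ 0

namespace Design

variable (E : Design)

/-- Index set of the pooled vectors; it has `D = ∑ i, d i` elements. -/
abbrev Ix : Type := Σ i : Fin E.a, Fin (E.d i)

/-- Total sample size `N`. -/
def N : ℕ := ∑ i, E.n i

/-- Smallest sample size. -/
def nMin : ℕ := ⨅ i, E.n i

/-- Largest dimension. -/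
def dMax : ℕ := ⨆ i, E.d i

lemma nMin_le (i : Fin E.a) : E.nMin ≤ E.n i :=
  ciInf_le (OrderBot.bddBelow _) i

/-- `V_N`, the direct sum of the matrices `(N / n i) • S i`. -/
def V : Matrix E.Ix E.Ix ℝ :=
  Matrix.blockDiagonal' fun i => ((E.N : ℝ) / (E.n i : ℝ)) • E.S i

/-- The null hypothesis `T μ = 0` for the pooled expectation vector. -/
def NullHypothesis : Prop := E.T *ᵥ (fun p : E.Ix => E.μ p.1 p.2) = 0

lemma isHermitian_TVT : (E.T * E.V * E.T).IsHermitian := by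
  have hT : E.Tᴴ = E.T := by
    rw [Matrix.conjTranspose_eq_transpose_of_trivial]; exact E.T_symm
  have hV : E.Vᴴ = E.V := by
    unfold V
    rw [Matrix.blockDiagonal'_conjTranspose]
    congr 1
    funext i
    rw [Matrix.conjTranspose_smul, (E.S_posDef i).isHermitian.eq]
    simp
  unfold Matrix.IsHermitian
  rw [Matrix.conjTranspose_mul, Matrix.conjTranspose_mul, hT, hV, Matrix.mul_assoc]

/-- Normalized eigenvalues `β_{s+1} = λ_{s+1} / √(∑ λ_l²)`, where `λ_1 ≥ λ_2 ≥ …` are the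
eigenvalues of `T V_N T` with multiplicity (zero beyond the dimension `D`). -/
def β (s : ℕ) : ℝ :=
  if h : s < Fintype.card E.Ix then
    E.isHermitian_TVT.eigenvalues₀ ⟨s, h⟩ / √(∑ l, E.isHermitian_TVT.eigenvalues₀ l ^ 2)
  else 0

/-- `f_P = tr³((T V_N)²) / tr²((T V_N)³)`. -/
def fP : ℝ := ((E.T * E.V) ^ 2).trace ^ 3 / ((E.T * E.V) ^ 3).trace ^ 2

end Design

/-- The three asymptotic frameworks for a sequence of designs. -/
def IsFramework (E : ℕ → Design) : Prop :=
  ((∃ a, ∀ k, (E k).a = a) ∧ Tendsto (fun k => min (E k).dMax (E k).nMin) atTop atTop) ∨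
  ((∃ δ : ℕ → ℕ, ∀ k i, (E k).d i = δ i) ∧
    Tendsto (fun k => min (E k).a (E k).nMin) atTop atTop) ∨
  Tendsto (fun k => min (E k).a (min (E k).dMax (E k).nMin)) atTop atTop

/-! ### Observations, random permutations and random subsamples -/

/-- Every set of permutations is measurable. -/
instance (n : ℕ) : MeasurableSpace (Equiv.Perm (Fin n)) := ⊤

instance (n : ℕ) : DiscreteMeasurableSpace (Equiv.Perm (Fin n)) := ⟨fun _ => trivial⟩

/-- Every set of `m`-tuples of distinct indices is measurable. -/
instance (m n : ℕ) : MeasurableSpace (Fin m ↪ Fin n) := ⊤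

instance (m n : ℕ) : DiscreteMeasurableSpace (Fin m ↪ Fin n) := ⟨fun _ => trivial⟩

/-- The random quantities of one experiment: observations `X i j`, permutations `π j i` of the
indices of group `i`, and subsamples `σ₂ u`, `σ₄ u`, `σ₆ u` of sizes `2`, `4`, `6` of the index set
`{1, …, n_min}` that is common to all groups. -/
structure Sample (E : Design) (Ω : Type*) where
  X : ∀ i, Fin (E.n i) → Ω → EuclideanSpace ℝ (Fin (E.d i))
  π : ℕ → ∀ i, Ω → Equiv.Perm (Fin (E.n i))
  σ₂ : ℕ → Ω → (Fin 2 ↪ Fin E.nMin)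
  σ₄ : ℕ → Ω → (Fin 4 ↪ Fin E.nMin)
  σ₆ : ℕ → Ω → (Fin 6 ↪ Fin E.nMin)

namespace Sample

variable {E : Design} {Ω : Type*}

/-- The distributional assumptions: independent normal observations; independent uniform
permutations; for each size, independent uniform subsamples (drawn without replacement);
observations, permutations and subsamples are independent of each other. -/
structure IsModel [MeasurableSpace Ω] (s : Sample E Ω) (P : Measure Ω) : Prop where
  law_X : ∀ i j, HasLaw (s.X i j) (multivariateGaussian (E.μ i) (E.S i)) P
  indep_X : iIndepFun (fun p : (Σ i, Fin (E.n i)) => s.X p.1 p.2) P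
  law_π : ∀ j i, HasLaw (s.π j i) (uniformOn Set.univ) P
  indep_π : iIndepFun (fun p : ℕ × Fin E.a => s.π p.1 p.2) P
  law_σ₂ : ∀ u, HasLaw (s.σ₂ u) (uniformOn Set.univ) P
  law_σ₄ : ∀ u, HasLaw (s.σ₄ u) (uniformOn Set.univ) P
  law_σ₆ : ∀ u, HasLaw (s.σ₆ u) (uniformOn Set.univ) P
  indep_σ₂ : iIndepFun s.σ₂ P
  indep_σ₄ : iIndepFun s.σ₄ P
  indep_σ₆ : iIndepFun s.σ₆ P
  indep_π_σ : IndepFun (fun ω j i => s.π j i ω)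
    (fun ω => ((fun u => s.σ₂ u ω), (fun u => s.σ₄ u ω), (fun u => s.σ₆ u ω))) P
  indep_X_πσ : IndepFun (fun ω i j => s.X i j ω)
    (fun ω => ((fun j i => s.π j i ω),
      (fun u => s.σ₂ u ω), (fun u => s.σ₄ u ω), (fun u => s.σ₆ u ω))) P

variable (s : Sample E Ω)

/-- The pooled vector of group means. -/
def Xbar (ω : Ω) : E.Ix → ℝ := fun p => (E.n p.1 : ℝ)⁻¹ * ∑ j, s.X p.1 j ω p.2

/-- The quadratic form `Q_N = N · X̄ᵀ T X̄`. -/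
def Q (ω : Ω) : ℝ := E.N * (s.Xbar ω ⬝ᵥ E.T *ᵥ s.Xbar ω)

/-- The quadratic form standardized with the true moments under the null hypothesis. -/
def Wtilde (ω : Ω) : ℝ :=
  (s.Q ω - (E.T * E.V).trace) / √(2 * ((E.T * E.V) ^ 2).trace)

/-- `Z^{π_j}_{(l₁,l₂)}`: block `i` is
`√(N / n_i) (X_{i, π_{j,i}(l₁)} - X_{i, π_{j,i}(l₂)})`. -/
def Z (j : ℕ) (l₁ l₂ : Fin E.nMin) (ω : Ω) : E.Ix → ℝ := fun p =>
  √((E.N : ℝ) / E.n p.1) *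
    (s.X p.1 (s.π j p.1 ω (Fin.castLE (E.nMin_le p.1) l₁)) ω p.2 -
      s.X p.1 (s.π j p.1 ω (Fin.castLE (E.nMin_le p.1) l₂)) ω p.2)

/-- The bilinear form `(Z^{π_j}_{(l₁,l₂)})ᵀ T Z^{π_j}_{(l₃,l₄)}`. -/
def Λ (j : ℕ) (l₁ l₂ l₃ l₄ : Fin E.nMin) (ω : Ω) : ℝ :=
  s.Z j l₁ l₂ ω ⬝ᵥ E.T *ᵥ s.Z j l₃ l₄ ω

/-- Kernel for `tr(T V_N)`, before division by `2`. -/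
def kernel₁ (j : ℕ) (l : Fin 2 ↪ Fin E.nMin) (ω : Ω) : ℝ :=
  s.Λ j (l 0) (l 1) (l 0) (l 1) ω

/-- Kernel for `tr((T V_N)²)`, before division by `4`. -/
def kernel₂ (j : ℕ) (l : Fin 4 ↪ Fin E.nMin) (ω : Ω) : ℝ :=
  s.Λ j (l 0) (l 1) (l 2) (l 3) ω ^ 2

/-- Kernel for `tr((T V_N)³)`, before division by `8`. -/
def kernel₃ (j : ℕ) (l : Fin 6 ↪ Fin E.nMin) (ω : Ω) : ℝ :=
  s.Λ j (l 0) (l 1) (l 2) (l 3) ω * s.Λ j (l 2) (l 3) (l 4) (l 5) ω *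
    s.Λ j (l 4) (l 5) (l 0) (l 1) ω

/-- `B₁(υ)`, an average over `υ` permutations and all index pairs. -/
def B₁ (υ : ℕ) (ω : Ω) : ℝ :=
  1 / (2 * υ) * ∑ j ∈ Finset.range υ,
    ∑ l : Fin 2 ↪ Fin E.nMin with l 0 < l 1, s.kernel₁ j l ω / (E.nMin.choose 2 : ℝ)

/-- `B₂(υ)`. -/
def B₂ (υ : ℕ) (ω : Ω) : ℝ :=
  1 / (4 * υ) * ∑ j ∈ Finset.range υ,
    ∑ l : Fin 4 ↪ Fin E.nMin with l 0 < l 1 ∧ l 2 < l 3,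
      s.kernel₂ j l ω / (6 * E.nMin.choose 4 : ℝ)

/-- `B₃(υ)`; note that `n_min! / (n_min - 6)!` is the descending factorial. -/
def B₃ (υ : ℕ) (ω : Ω) : ℝ :=
  1 / (8 * υ) * ∑ j ∈ Finset.range υ,
    ∑ l : Fin 6 ↪ Fin E.nMin, s.kernel₃ j l ω / (E.nMin.descFactorial 6 : ℝ)

/-- `B₁⋆(υ₁, υ₂)`, an average over `υ₁` permutations and `υ₂` random subsamples. -/
def B₁star (υ₁ υ₂ : ℕ) (ω : Ω) : ℝ :=
  1 / (2 * υ₁ * υ₂) * ∑ j ∈ Finset.range υ₁, ∑ u ∈ Finset.range υ₂, s.kernel₁ j (s.σ₂ u ω) ω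

/-- `B₂⋆(υ₁, υ₂)`. -/
def B₂star (υ₁ υ₂ : ℕ) (ω : Ω) : ℝ :=
  1 / (4 * υ₁ * υ₂) * ∑ j ∈ Finset.range υ₁, ∑ u ∈ Finset.range υ₂, s.kernel₂ j (s.σ₄ u ω) ω

/-- `B₃⋆(υ₁, υ₂)`. -/
def B₃star (υ₁ υ₂ : ℕ) (ω : Ω) : ℝ :=
  1 / (8 * υ₁ * υ₂) * ∑ j ∈ Finset.range υ₁, ∑ u ∈ Finset.range υ₂, s.kernel₃ j (s.σ₆ u ω) ω

/-- The statistic `W_N^B`; the numbers of permutations in `B₁` and `B₂` may differ. -/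
def WB (υ : Fin 3 → ℕ) (ω : Ω) : ℝ :=
  (s.Q ω - s.B₁ (υ 0) ω) / √(2 * s.B₂ (υ 1) ω)

/-- The statistic `W_N^{B⋆}`. -/
def WBstar (υ₁ υ₂ : Fin 3 → ℕ) (ω : Ω) : ℝ :=
  (s.Q ω - s.B₁star (υ₁ 0) (υ₂ 0) ω) / √(2 * s.B₂star (υ₁ 1) (υ₂ 1) ω)

/-- The estimator `B₂³ / B₃²` of `f_P`. -/
def fB (υ : Fin 3 → ℕ) (ω : Ω) : ℝ := s.B₂ (υ 1) ω ^ 3 / s.B₃ (υ 2) ω ^ 2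

/-- The estimator `(B₂⋆)³ / (B₃⋆)²` of `f_P`. -/
def fBstar (υ₁ υ₂ : Fin 3 → ℕ) (ω : Ω) : ℝ :=
  s.B₂star (υ₁ 1) (υ₂ 1) ω ^ 3 / s.B₃star (υ₁ 2) (υ₂ 2) ω ^ 2

end Sample

/-! ### Limit distributions and modes of convergence -/

/-- The `χ²` distribution with `f > 0` degrees of freedom (`f` real). -/
def chiSq (f : ℝ) : Measure ℝ := gammaMeasure (f / 2) (1 / 2)

instance : IsProbabilityMeasure (chiSq 1) :=
  isProbabilityMeasure_gammaMeasure (by norm_num) (by norm_num)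

/-- `Y` is distributed as `∑ₛ b_s (C_s - 1)/√2 + √(1 - ∑ₛ b_s²) · Z`, with independent `χ²₁`-variables
`C_s` and an independent standard normal `Z`; the series converges almost surely. -/
def IsLimitVariable {Ω' : Type*} [MeasurableSpace Ω'] (P' : Measure Ω') (b : ℕ → ℝ)
    (Y : Ω' → ℝ) : Prop :=
  ∃ (C : ℕ → Ω' → ℝ) (Z S : Ω' → ℝ),
    (∀ s, HasLaw (C s) (chiSq 1) P') ∧ HasLaw Z (gaussianReal 0 1) P' ∧
    iIndepFun C P' ∧ IndepFun (fun ω s => C s ω) Z P' ∧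
    (∀ᵐ ω ∂P', Tendsto (fun m => ∑ s ∈ Finset.range m, b s * ((C s ω - 1) / √2)) atTop
      (𝓝 (S ω))) ∧
    Y = fun ω => S ω + √(1 - ∑' s, b s ^ 2) * Z ω

/-- The law of `K_f = (χ²_f - f)/√(2 f)` for `f > 0`. An estimate `f = B₂³ / B₃²` can fail to be
positive only by a vanishing `B₂` or `B₃`; this is completed by the limit law as `f → ∞`. -/
def pearsonLaw (f : ℝ) : Measure ℝ :=
  if 0 < f then (chiSq f).map (fun x => (x - f) / √(2 * f)) else gaussianReal 0 1

instance (f : ℝ) : IsProbabilityMeasure (pearsonLaw f) := by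
  unfold pearsonLaw
  split_ifs with h
  · have : IsProbabilityMeasure (chiSq f) :=
      isProbabilityMeasure_gammaMeasure (by positivity) (by norm_num)
    exact Measure.isProbabilityMeasure_map (by fun_prop)
  · infer_instance

lemma measurable_pearsonLaw : Measurable pearsonLaw := by
  classical
  refine Measure.measurable_of_measurable_coe _ fun s hs => ?_
  let G : ℝ → ℝ := (Set.Ioi (0 : ℝ)).piecewise Real.Gamma (fun _ => 1)
  have hG : Measurable G := by
    refine ContinuousOn.measurable_piecewise (fun x hx => ?_) continuousOn_const measurableSet_Ioi
    refine (Real.differentiableAt_Gamma fun m => ?_).continuousAt.continuousWithinAt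
    have h1 : (0 : ℝ) < x := hx
    have h2 : (0 : ℝ) ≤ m := m.cast_nonneg
    linarith
  let h : ℝ × ℝ → ℝ := fun p => if 0 ≤ p.2 then
    (1 / 2 : ℝ) ^ (p.1 / 2) / G (p.1 / 2) * p.2 ^ (p.1 / 2 - 1) * Real.exp (-(1 / 2 * p.2)) else 0
  have hh : Measurable h := by
    refine Measurable.ite (measurableSet_le measurable_const measurable_snd) ?_ measurable_const
    fun_prop
  let A : Set (ℝ × ℝ) := {p | (p.2 - p.1) / √(2 * p.1) ∈ s}
  have hA : MeasurableSet A := by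
    have : Measurable fun p : ℝ × ℝ => (p.2 - p.1) / √(2 * p.1) := by fun_prop
    exact this hs
  have key : (fun f => pearsonLaw f s) = fun f => if 0 < f then
      ∫⁻ x, A.indicator (fun p => ENNReal.ofReal (h p)) (f, x) else gaussianReal 0 1 s := by
    funext f
    unfold pearsonLaw
    split_ifs with hf
    · have hm : Measurable fun x : ℝ => (x - f) / √(2 * f) := by fun_prop
      rw [Measure.map_apply hm hs, chiSq, gammaMeasure, withDensity_apply _ (hm hs),
        ← lintegral_indicator (hm hs)]
      refine lintegral_congr fun x => ?_
      have hf2 : f / 2 ∈ Set.Ioi (0 : ℝ) := by simpa using hf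
      have e : gammaPDF (f / 2) (1 / 2) x = ENNReal.ofReal (h (f, x)) := by
        simp only [gammaPDF, gammaPDFReal, h, G, Set.piecewise_eq_of_mem _ _ _ hf2]
      by_cases hx : (f, x) ∈ A
      · rw [Set.indicator_of_mem hx, Set.indicator_of_mem (show x ∈ _ from hx), e]
      · rw [Set.indicator_of_notMem hx, Set.indicator_of_notMem (show x ∉ _ from hx)]
    · rfl
  rw [key]
  refine Measurable.ite measurableSet_Ioi ?_ measurable_const
  exact Measurable.lintegral_prod_right' (f := A.indicator fun p => ENNReal.ofReal (h p))
    (Measurable.indicator (by fun_prop) hA)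

/-- The laws of `K_f` as a Markov kernel in `f`. -/
def pearsonKernel : Kernel ℝ ℝ := ⟨pearsonLaw, measurable_pearsonLaw⟩

instance : IsMarkovKernel pearsonKernel := ⟨fun f => by
  change IsProbabilityMeasure (pearsonLaw f); infer_instance⟩

/-- Convergence to zero in probability for random variables on varying probability spaces. -/
def TendstoZeroInProb {Ω : ℕ → Type*} [∀ k, MeasurableSpace (Ω k)] (P : ∀ k, Measure (Ω k))
    (Y : ∀ k, Ω k → ℝ) : Prop :=
  ∀ ε > 0, Tendsto (fun k => P k {ω | ε ≤ |Y k ω|}) atTop (𝓝 0)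

/-- The random law of `K_f` at `f = fhat k ω` converges weakly to `ν`, in probability. -/
def PearsonLawTendsto {Ω : ℕ → Type*} [∀ k, MeasurableSpace (Ω k)] (P : ∀ k, Measure (Ω k))
    (fhat : ∀ k, Ω k → ℝ) (ν : Measure ℝ) : Prop :=
  ∀ g : BoundedContinuousFunction ℝ ℝ,
    TendstoZeroInProb P fun k ω => ∫ x, g x ∂(pearsonLaw (fhat k ω)) - ∫ x, g x ∂ν

/-- `K k` is a version of `K_f` with random degrees of freedom `f = fhat k`: given `fhat k`, it is
distributed as `(χ²_f - f)/√(2 f)` with `f = fhat k`. -/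
def IsPearsonVariable {Ω : ℕ → Type*} [∀ k, MeasurableSpace (Ω k)] (P : ∀ k, Measure (Ω k))
    (fhat : ∀ k, Ω k → ℝ) (K : ∀ k, Ω k → ℝ) : Prop :=
  ∀ k, HasCondDistrib (K k) (fhat k) pearsonKernel (P k)

end SplitPlot

end

namespace SplitPlot

/-! ### Characteristic functions of the chi-squared and Pearson laws -/

/-! Let `U` hold orthonormal eigenvectors of `T V T`. The matrix `coord = Uᵀ T` satisfies `coordᵀ
coord = T` and `coord V coordᵀ = diag(λ)`. Take weighted sums of the centred observations whose
squared weights in group `i` add up to `v N / n i`. Their coordinates are `√(v λ_q) g_q` with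
independent standard normal `g_q`, and sums with orthogonal weights are independent
(`Sample.IsModel.identDistrib_pooled`). This is exact for every number of groups and all dimensions,
and the whole probabilistic part rests on it.

With `v = 1` it shows that under the null hypothesis `Wtilde` is distributed as `∑ β_s (g_s² -
1)/√2`, so its characteristic function is `∏ chiChar (t β_s)`. The `β_s` decrease and their squares
sum to one. Far out in the sequence they are uniformly small, and `chiChar u` equals `exp(-u²/2)` up
to `o(u²)`. The first factors converge to the chi-squared part, and the remaining ones produce a
normal factor with the missing variance (`tendsto_prod_weights`).

With `v = 2` it describes the trace estimators. For fixed permutations the kernel of degree `r`,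
divided by `2^r`, has mean `tr((T V)^r)` and a second moment of at most an absolute constant times
`tr((T V)²)^r`. After centring, kernels on disjoint index tuples are uncorrelated. Two injective
`m`-tuples meet with frequency at most `m² / nMin`, averaging over permutations does no harm by
convexity, and random subsampling costs a further `1/Υ₂`. Hence all errors vanish relative to powers
of `√tr((T V)²)` (`isConsistent_B`, `isConsistent_Bstar`). Studentization then changes `Wtilde` by a
term that tends to zero in probability, and `1/fhat` approaches `1/f_P`.

For the Pearson approximation put `c = 1/f`. The law of `K_f` is continuous in `c` on `[0, ∞)`, with
the normal law at `c = 0`, and the modulus of its characteristic function at `1` is strictly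
increasing in `c`. Convergence of these laws is thus the same as convergence of `c`
(`tendsto_integral_pearsonLaw_iff`). Finally `1/f_P = (∑ β_s³)²` lies between the sixth and the
second power of the largest weight, which is `β 0` here, so both tend to `0` together and both tend
to `1` together. -/

lemma mgf_chiSq {f : ℝ} (hf : 0 < f) {u : ℝ} (hu : u < 1 / 2) :
    mgf id (chiSq f) u = Real.exp (-(f / 2) * Real.log (1 - 2 * u)) := by
  have hf2 : 0 < f / 2 := by positivity
  have h0 : (0 : ℝ) < 1 / 2 - u := by linarith
  have h1 : ∀ x : ℝ, (gammaPDF (f / 2) (1 / 2) x).toReal * Real.exp (u * x) =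
      (Set.Ici (0 : ℝ)).indicator (fun x => (1 / 2 : ℝ) ^ (f / 2) / Real.Gamma (f / 2) *
        (x ^ (f / 2 - 1) * Real.exp (-((1 / 2 - u) * x)))) x := by
    intro x
    by_cases hx : 0 ≤ x
    · rw [Set.indicator_of_mem (by exact hx), gammaPDF_of_nonneg hx, ENNReal.toReal_ofReal]
      · rw [mul_assoc, mul_assoc, ← Real.exp_add]
        ring_nf
      · have := Real.Gamma_pos_of_pos hf2
        positivity
    · rw [Set.indicator_of_notMem (by exact hx), gammaPDF_of_neg (not_le.1 hx)]
      simp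
  have hm : Measurable (gammaPDF (f / 2) (1 / 2)) :=
    (measurable_gammaPDFReal _ _).ennreal_ofReal
  simp only [mgf, id]
  rw [chiSq, gammaMeasure, integral_withDensity_eq_integral_toReal_smul hm
    (ae_of_all _ fun x => ENNReal.ofReal_lt_top)]
  simp_rw [smul_eq_mul, h1]
  rw [integral_indicator measurableSet_Ici, integral_Ici_eq_integral_Ioi, integral_const_mul,
    Real.integral_rpow_mul_exp_neg_mul_Ioi hf2 h0]
  have hG := (Real.Gamma_pos_of_pos hf2).ne'
  have h2 : (1 / (1 / 2 - u)) = 2 * (1 - 2 * u)⁻¹ := by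
    have : (1 - 2 * u) ≠ 0 := by linarith
    field_simp
  have h3 : 0 < 1 - 2 * u := by linarith
  rw [h2, Real.mul_rpow (by norm_num) (by positivity), Real.inv_rpow h3.le,
    ← Real.rpow_neg h3.le, Real.rpow_def_of_pos h3, mul_comm (Real.log _), one_div,
    Real.inv_rpow (by norm_num)]
  have : (2 : ℝ) ^ (f / 2) ≠ 0 := by positivity
  field_simp

lemma integrableExpSet_chiSq {f : ℝ} (hf : 0 < f) :
    Set.Iio (1 / 2 : ℝ) ⊆ integrableExpSet id (chiSq f) := by
  intro u hu
  refine Integrable.of_integral_ne_zero ?_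
  have := mgf_chiSq hf hu
  rw [mgf] at this
  rw [this]
  exact (Real.exp_pos _).ne'

/-- Identity theorem: both sides are analytic on the half-plane `Re z < 1/2`, which is connected,
and they agree at real points near `0` by `mgf_chiSq`. -/
lemma complexMGF_chiSq {f : ℝ} (hf : 0 < f) {z : ℂ} (hz : z.re < 1 / 2) :
    complexMGF id (chiSq f) z = Complex.exp (-((f / 2 : ℝ) : ℂ) * Complex.log (1 - 2 * z)) := by
  have hU : {z : ℂ | z.re < 1 / 2} = Complex.reLm ⁻¹' (Set.Iio (1 / 2 : ℝ)) := rfl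
  have hopen : IsOpen {z : ℂ | z.re < 1 / 2} := isOpen_Iio.preimage Complex.continuous_re
  have hL : AnalyticOnNhd ℂ (complexMGF id (chiSq f)) {z : ℂ | z.re < 1 / 2} := by
    intro w hw
    exact analyticOnNhd_complexMGF w
      (interior_maximal (integrableExpSet_chiSq hf) isOpen_Iio hw)
  have hR : AnalyticOnNhd ℂ
      (fun z : ℂ => Complex.exp (-((f / 2 : ℝ) : ℂ) * Complex.log (1 - 2 * z)))
      {z : ℂ | z.re < 1 / 2} := by
    refine DifferentiableOn.analyticOnNhd (fun w hw => ?_) hopen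
    have hs : 1 - 2 * w ∈ Complex.slitPlane := by
      left
      have : w.re < 1 / 2 := hw
      simp
      linarith
    have h1 : DifferentiableAt ℂ (fun z : ℂ => 1 - 2 * z) w := by fun_prop
    exact ((h1.clog hs).const_mul _).cexp.differentiableWithinAt
  have hpre : IsPreconnected {z : ℂ | z.re < 1 / 2} := by
    rw [hU]
    exact ((convex_Iio _).linear_preimage Complex.reLm).isPreconnected
  refine AnalyticOnNhd.eqOn_of_preconnected_of_frequently_eq hL hR hpre (z₀ := ((0 : ℝ) : ℂ))
    (by simp) ?_ hz
  have hreal : ∀ᶠ x : ℝ in 𝓝[≠] (0 : ℝ), complexMGF id (chiSq f) x =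
      Complex.exp (-((f / 2 : ℝ) : ℂ) * Complex.log (1 - 2 * (x : ℂ))) := by
    filter_upwards [mem_nhdsWithin_of_mem_nhds (Iio_mem_nhds (show (0 : ℝ) < 1 / 2 by norm_num))]
      with x hx
    have hx' : x < 1 / 2 := hx
    rw [complexMGF_ofReal, mgf_chiSq hf hx']
    have h3 : 0 ≤ 1 - 2 * x := by linarith
    push_cast [Complex.ofReal_log h3]
    rfl
  have ht : Tendsto (fun x : ℝ => (x : ℂ)) (𝓝[≠] (0 : ℝ)) (𝓝[≠] ((0 : ℝ) : ℂ)) := by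
    refine tendsto_nhdsWithin_of_tendsto_nhds_of_eventually_within _
      ((Complex.continuous_ofReal.tendsto 0).mono_left nhdsWithin_le_nhds) ?_
    filter_upwards [self_mem_nhdsWithin] with x hx
    simpa using hx
  exact ht.frequently hreal.frequently

lemma charFun_chiSq {f : ℝ} (hf : 0 < f) (t : ℝ) :
    charFun (chiSq f) t =
      Complex.exp (-((f / 2 : ℝ) : ℂ) * Complex.log (1 - 2 * (t * Complex.I))) := by
  rw [← complexMGF_id_mul_I, complexMGF_chiSq hf (by simp)]

/-- The square of a standard normal variable has the `χ²₁` distribution. -/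
lemma gaussianReal_map_sq : (gaussianReal 0 1).map (fun x => x ^ 2) = chiSq 1 := by
  have : IsProbabilityMeasure ((gaussianReal 0 1).map fun x : ℝ => x ^ 2) :=
    Measure.isProbabilityMeasure_map (by fun_prop)
  refine Measure.ext_of_charFun ?_
  ext t
  rw [charFun_chiSq one_pos, charFun_apply_real, integral_map (by fun_prop) (by fun_prop),
    integral_gaussianReal_eq_integral_smul one_ne_zero]
  have h1 : ∀ x : ℝ, gaussianPDFReal 0 1 x • Complex.exp (t * (x ^ 2 : ℝ) * Complex.I) =
      ((√(2 * Real.pi))⁻¹ : ℝ) * Complex.exp (-(1 / 2 - t * Complex.I) * (x : ℂ) ^ 2) := by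
    intro x
    rw [gaussianPDFReal, Complex.real_smul, Complex.ofReal_mul, Complex.ofReal_exp, mul_assoc,
      ← Complex.exp_add]
    simp
    ring_nf
    simp
  simp_rw [h1]
  rw [integral_const_mul, integral_gaussian_complex (by simp)]
  set w : ℂ := 1 - 2 * (t * Complex.I) with hw
  have hw0 : w ≠ 0 := by
    intro h
    have := congrArg Complex.re h
    simp [hw] at this
  -- The real part of `w` is `1`, so `w` avoids the branch cut and `log w⁻¹ = -log w`.
  have hwa : w.arg ≠ Real.pi := by
    intro h
    rw [Complex.arg_eq_pi_iff] at h
    simp [hw] at h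
    linarith
  have h2 : (Real.pi : ℂ) / (1 / 2 - t * Complex.I) = ((2 * Real.pi : ℝ) : ℂ) * w⁻¹ := by
    have : (1 / 2 - t * Complex.I : ℂ) = w / 2 := by rw [hw]; ring
    rw [this]
    push_cast
    field_simp
  have hpi : 0 < 2 * Real.pi := by positivity
  rw [h2, Complex.cpow_def_of_ne_zero (mul_ne_zero (by exact_mod_cast hpi.ne') (inv_ne_zero hw0)),
    Complex.log_ofReal_mul hpi (inv_ne_zero hw0), Complex.log_inv _ hwa, add_mul, Complex.exp_add]
  have h3 : Complex.exp ((Real.log (2 * Real.pi) : ℂ) * (1 / 2)) = ((√(2 * Real.pi) : ℝ) : ℂ) := by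
    rw [Real.sqrt_eq_rpow, Real.rpow_def_of_pos hpi]
    push_cast
    rfl
  rw [h3, ← mul_assoc, ← Complex.ofReal_mul, inv_mul_cancel₀ (by positivity)]
  rw [Complex.ofReal_one, one_mul]
  congr 1
  push_cast
  ring

/-- Writing the exponent through `w = t √(2/f)` exposes `log(1 - iw) + iw`, which is of second order
in `w`; this is what survives the factor `f/2` as `f → ∞`. -/
lemma charFun_pearsonLaw {f : ℝ} (hf : 0 < f) (t : ℝ) :
    charFun (pearsonLaw f) t = Complex.exp (-((f / 2 : ℝ) : ℂ) *
      (Complex.log (1 + (-(t * √(2 / f) : ℝ) * Complex.I)) + (t * √(2 / f) : ℝ) * Complex.I)) := by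
  have hs : √(2 * f) ≠ 0 := by positivity
  have hs2 : √(2 * f) * √(2 * f) = 2 * f := Real.mul_self_sqrt (by positivity)
  have h1 : √(2 / f) = 2 / √(2 * f) := by
    rw [Real.sqrt_eq_iff_mul_self_eq (by positivity) (by positivity), div_mul_div_comm, hs2]
    field_simp
  rw [pearsonLaw, if_pos hf, charFun_apply_real, integral_map (by fun_prop) (by fun_prop)]
  have h2 : ∀ x : ℝ, Complex.exp (t * ((x - f) / √(2 * f) : ℝ) * Complex.I) =
      Complex.exp (-(t * f / √(2 * f) : ℝ) * Complex.I) *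
        Complex.exp ((t / √(2 * f) : ℝ) * x * Complex.I) := by
    intro x
    rw [← Complex.exp_add]
    congr 1
    push_cast
    ring
  simp_rw [h2]
  rw [integral_const_mul, ← charFun_apply_real, charFun_chiSq hf, ← Complex.exp_add, h1]
  have e1 : (1 - 2 * (((t / √(2 * f) : ℝ) : ℂ) * Complex.I)) =
      1 + (-((t * (2 / √(2 * f)) : ℝ) : ℂ) * Complex.I) := by
    push_cast
    ring
  rw [e1]
  congr 1
  push_cast
  ring

/-! ### Pearson laws as a continuous family -/

lemma tendsto_charFun_pearsonLaw_zero (t : ℝ) :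
    Tendsto (fun c : ℝ => charFun (pearsonLaw c⁻¹) t) (𝓝[>] 0)
      (𝓝 (charFun (gaussianReal 0 1) t)) := by
  have hg : charFun (gaussianReal 0 1) t = Complex.exp (-(t ^ 2 / 2 : ℝ)) := by
    rw [charFun_gaussianReal]
    push_cast
    simp
  have hev : ∀ᶠ c : ℝ in 𝓝[>] 0, 0 < c ∧ |t| * √(2 * c) < 1 := by
    refine eventually_mem_nhdsWithin.and (Eventually.filter_mono nhdsWithin_le_nhds ?_)
    have : Continuous fun c : ℝ => |t| * √(2 * c) := by fun_prop
    refine (this.tendsto 0).eventually (gt_mem_nhds ?_)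
    simp
  rw [hg]
  have hE : Tendsto (fun c : ℝ => -((c⁻¹ / 2 : ℝ) : ℂ) *
      (Complex.log (1 + (-(t * √(2 / c⁻¹) : ℝ) * Complex.I)) + (t * √(2 / c⁻¹) : ℝ) * Complex.I))
      (𝓝[>] 0) (𝓝 (-(t ^ 2 / 2 : ℝ))) := by
    rw [tendsto_iff_norm_sub_tendsto_zero]
    have hlim : Tendsto (fun c : ℝ => |t| ^ 3 * √(2 * c) * (1 - |t| * √(2 * c))⁻¹ / 3)
        (𝓝[>] 0) (𝓝 0) := by
      have : ContinuousAt (fun c : ℝ => |t| ^ 3 * √(2 * c) * (1 - |t| * √(2 * c))⁻¹ / 3) 0 := by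
        refine ContinuousAt.div_const (ContinuousAt.mul (by fun_prop)
          (ContinuousAt.inv₀ (by fun_prop) (by simp))) _
      have h := this.tendsto.mono_left (nhdsWithin_le_nhds (s := Set.Ioi 0))
      simpa using h
    refine squeeze_zero' (Eventually.of_forall fun c => norm_nonneg _) ?_ hlim
    filter_upwards [hev] with c ⟨hc, hc1⟩
    have hs : √(2 * c) * √(2 * c) = 2 * c := Real.mul_self_sqrt (by positivity)
    set w := t * √(2 * c) with hw
    set z : ℂ := -(w : ℂ) * Complex.I with hz
    have hzn : ‖z‖ = |t| * √(2 * c) := by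
      rw [hz, norm_mul, norm_neg, Complex.norm_I, mul_one, Complex.norm_real, hw, Real.norm_eq_abs,
        abs_mul, abs_of_nonneg (Real.sqrt_nonneg (2 * c))]
    -- The quadratic Taylor term gives exactly `-t²/2`. The cubic remainder, divided by `2c`, is of
    -- order `√c`.
    have hT := Complex.norm_log_sub_logTaylor_le 2 (z := z) (by rw [hzn]; exact hc1)
    have hT2 : Complex.logTaylor (2 + 1) z = z - z ^ 2 / 2 := by
      simp [Complex.logTaylor_succ, Complex.logTaylor_zero]
      ring
    have hz2 : z ^ 2 = -(2 * t ^ 2 * c : ℝ) := by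
      have : w ^ 2 = 2 * t ^ 2 * c := by
        rw [hw, mul_pow, sq (√_), hs]; ring
      rw [hz, mul_pow, Complex.I_sq, neg_sq, ← this]
      push_cast
      ring
    have hd : (2 / c⁻¹ : ℝ) = 2 * c := by rw [div_inv_eq_mul]
    rw [hd, ← hw]
    have e : -((c⁻¹ / 2 : ℝ) : ℂ) * (Complex.log (1 + (-(w : ℂ) * Complex.I)) + (w : ℂ) * Complex.I)
        - -((t ^ 2 / 2 : ℝ) : ℂ) =
        -((c⁻¹ / 2 : ℝ) : ℂ) * (Complex.log (1 + z) - Complex.logTaylor (2 + 1) z) := by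
      rw [hT2, hz2]
      have : (c : ℂ) ≠ 0 := by exact_mod_cast hc.ne'
      rw [hz]
      push_cast
      field_simp
      ring
    rw [e, norm_mul, norm_neg, Complex.norm_real, Real.norm_of_nonneg (by positivity)]
    refine (mul_le_mul_of_nonneg_left hT (by positivity)).trans (le_of_eq ?_)
    rw [hzn]
    have h3 : (|t| * √(2 * c)) ^ (2 + 1) = |t| ^ 3 * √(2 * c) * (2 * c) := by
      calc (|t| * √(2 * c)) ^ (2 + 1) = |t| ^ 3 * √(2 * c) * (√(2 * c) * √(2 * c)) := by ring
        _ = _ := by rw [hs]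
    rw [h3, show (((2 : ℕ) : ℝ) + 1) = 3 by norm_num]
    generalize (1 - |t| * √(2 * c))⁻¹ = q
    field_simp
  refine ((Complex.continuous_exp.tendsto _).comp hE).congr' ?_
  filter_upwards [hev] with c hc
  rw [Function.comp_apply, charFun_pearsonLaw (inv_pos.2 hc.1)]

lemma tendsto_charFun_pearsonLaw_pos {c : ℝ} (hc : 0 < c) (t : ℝ) :
    Tendsto (fun c : ℝ => charFun (pearsonLaw c⁻¹) t) (𝓝 c) (𝓝 (charFun (pearsonLaw c⁻¹) t)) := by
  have hE : ContinuousAt (fun c : ℝ => Complex.exp (-((c⁻¹ / 2 : ℝ) : ℂ) *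
      (Complex.log (1 + (-(t * √(2 / c⁻¹) : ℝ) * Complex.I)) + (t * √(2 / c⁻¹) : ℝ) * Complex.I)))
      c := by
    have hc0 := hc.ne'
    have h1 : ContinuousAt (fun c : ℝ => c⁻¹) c := continuousAt_inv₀ hc0
    have h2 : ContinuousAt (fun c : ℝ => 2 / c⁻¹) c :=
      continuousAt_const.div h1 (inv_ne_zero hc0)
    have h3 : ContinuousAt (fun c : ℝ => ((t * √(2 / c⁻¹) : ℝ) : ℂ)) c :=
      Complex.continuous_ofReal.continuousAt.comp (continuousAt_const.mul h2.sqrt)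
    refine ContinuousAt.cexp (ContinuousAt.mul ?_ (ContinuousAt.add (ContinuousAt.clog ?_ ?_) ?_))
    · exact (Complex.continuous_ofReal.continuousAt.comp (h1.div_const 2)).neg
    · exact continuousAt_const.add (h3.neg.mul continuousAt_const)
    · left
      simp
    · exact h3.mul continuousAt_const
  rw [charFun_pearsonLaw (inv_pos.2 hc)]
  refine hE.tendsto.congr' ?_
  filter_upwards [lt_mem_nhds hc] with d hd
  rw [charFun_pearsonLaw (inv_pos.2 hd)]

/-- Since `0⁻¹ = 0`, the completed value of `pearsonLaw` sits at `c = 0`. In the parameter `c = 1/f`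
it is the limit `f = ∞`. -/
lemma pearsonLaw_inv_zero : pearsonLaw (0 : ℝ)⁻¹ = gaussianReal 0 1 := by
  simp [pearsonLaw]

/-- The law of `K_f` depends continuously on `1 / f`, including `1 / f = 0`. -/
lemma tendsto_charFun_pearsonLaw {c : ℝ} (hc : 0 ≤ c) (t : ℝ) :
    Tendsto (fun c : ℝ => charFun (pearsonLaw c⁻¹) t) (𝓝[≥] c)
      (𝓝 (charFun (pearsonLaw c⁻¹) t)) ∧
    Tendsto (fun c : ℝ => charFun (pearsonLaw (max c 0)⁻¹) t) (𝓝 c)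
      (𝓝 (charFun (pearsonLaw (max c 0)⁻¹) t)) := by
  rcases hc.eq_or_lt with rfl | hc
  · have h : Tendsto (fun c : ℝ => charFun (pearsonLaw c⁻¹) t) (𝓝[≥] 0)
        (𝓝 (charFun (pearsonLaw (0 : ℝ)⁻¹) t)) := by
      rw [← Set.Ioi_union_left, nhdsWithin_union, nhdsWithin_singleton]
      refine Tendsto.sup ?_ (tendsto_pure_nhds _ _)
      rw [pearsonLaw_inv_zero]
      exact tendsto_charFun_pearsonLaw_zero t
    refine ⟨h, ?_⟩
    have hm : Tendsto (fun c : ℝ => max c 0) (𝓝 0) (𝓝[≥] 0) := by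
      refine tendsto_nhdsWithin_of_tendsto_nhds_of_eventually_within _ ?_
        (Eventually.of_forall fun c => le_max_right c 0)
      have : Continuous fun c : ℝ => max c 0 := by fun_prop
      simpa using this.tendsto 0
    rw [max_self]
    exact h.comp hm
  · refine ⟨(tendsto_charFun_pearsonLaw_pos hc t).mono_left nhdsWithin_le_nhds, ?_⟩
    rw [max_eq_left hc.le]
    refine (tendsto_charFun_pearsonLaw_pos hc t).congr' ?_
    filter_upwards [lt_mem_nhds hc] with d hd
    rw [max_eq_left hd.le]

/-- Clamping `c` at zero gives a family that is continuous on the whole line, so uniform continuity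
on a compact interval can later be used without a boundary case. -/
lemma continuous_charFun_pearsonLaw (t : ℝ) :
    Continuous fun c : ℝ => charFun (pearsonLaw (max c 0)⁻¹) t := by
  rw [continuous_iff_continuousAt]
  intro c
  rcases le_or_gt 0 c with hc | hc
  · exact (tendsto_charFun_pearsonLaw hc t).2
  · refine continuousAt_const (y := charFun (pearsonLaw (0 : ℝ)⁻¹) t) |>.congr ?_
    filter_upwards [gt_mem_nhds hc] with d hd
    rw [max_eq_right hd.le]

lemma continuous_integral_pearsonLaw (g : BoundedContinuousFunction ℝ ℝ) :
    Continuous fun c : ℝ => ∫ x, g x ∂(pearsonLaw (max c 0)⁻¹) := by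
  refine continuous_iff_seqContinuous.2 fun u c hu => ?_
  let L : ℝ → ProbabilityMeasure ℝ := fun c => ⟨pearsonLaw (max c 0)⁻¹, inferInstance⟩
  have h : Tendsto (fun n => L (u n)) atTop (𝓝 (L c)) :=
    ProbabilityMeasure.tendsto_of_tendsto_charFun fun t =>
      ((continuous_charFun_pearsonLaw t).tendsto c).comp hu
  exact ProbabilityMeasure.tendsto_iff_forall_integral_tendsto.1 h g

/-- Taking the modulus removes the phase, leaving only `|1 - i√(2c)| = √(1 + 2c)`. -/
lemma norm_charFun_pearsonLaw {c : ℝ} (hc : 0 < c) :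
    ‖charFun (pearsonLaw c⁻¹) 1‖ = Real.exp (-(Real.log (1 + 2 * c) / (4 * c))) := by
  rw [charFun_pearsonLaw (inv_pos.2 hc), Complex.norm_exp]
  congr 1
  have hd : (2 / c⁻¹ : ℝ) = 2 * c := by rw [div_inv_eq_mul]
  rw [hd, one_mul, ← Complex.ofReal_neg, Complex.re_ofReal_mul, Complex.add_re, Complex.log_re]
  have h1 : ‖(1 + ((-√(2 * c) : ℝ) : ℂ) * Complex.I : ℂ)‖ = √(1 + 2 * c) := by
    rw [Complex.norm_def, Complex.normSq_apply]
    congr 1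
    have := Real.mul_self_sqrt (show 0 ≤ 2 * c by positivity)
    simp [-Real.sqrt_mul, -Nat.ofNat_nonneg, -Real.sqrt_mul', this]
  rw [← Complex.ofReal_neg, h1, Real.log_sqrt (by positivity)]
  simp
  field_simp
  ring

/-- Up to a factor, `log(1 + 2c)/(4c)` is a secant slope of the logarithm from the point `1`. By
strict concavity it decreases in `c`, starting from its limit `1/2` at `c = 0`, the normal case. -/
lemma norm_charFun_pearsonLaw_strictMono {c d : ℝ} (hc : 0 ≤ c) (hcd : c < d) :
    ‖charFun (pearsonLaw c⁻¹) 1‖ < ‖charFun (pearsonLaw d⁻¹) 1‖ := by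
  have hd : 0 < d := hc.trans_lt hcd
  rw [norm_charFun_pearsonLaw hd]
  rcases hc.eq_or_lt with rfl | hc
  · rw [pearsonLaw_inv_zero, charFun_gaussianReal, Complex.norm_exp, Real.exp_lt_exp]
    have := Real.log_lt_sub_one_of_pos (show 0 < 1 + 2 * d by linarith) (by linarith)
    have h2 : Real.log (1 + 2 * d) / (4 * d) < 1 / 2 := by
      rw [div_lt_div_iff₀ (by positivity) (by norm_num)]
      linarith
    simpa using h2
  · rw [norm_charFun_pearsonLaw hc, Real.exp_lt_exp, neg_lt_neg_iff,
      div_lt_div_iff₀ (by positivity) (by positivity)]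
    -- `1 + 2c` is the convex combination of `1 + 2d` and `1` with weight `c/d` on the former.
    have h := strictConcaveOn_log_Ioi.2 (show (1 : ℝ) + 2 * d ∈ Set.Ioi 0 by
      simp; linarith) (show (1 : ℝ) ∈ Set.Ioi 0 by simp) (by linarith)
      (show 0 < c / d by positivity) (show 0 < 1 - c / d by
        rw [sub_pos, div_lt_one hd]; exact hcd) (by ring)
    simp only [smul_eq_mul, Real.log_one, mul_zero, add_zero, mul_one] at h
    have e : c / d * (1 + 2 * d) + (1 - c / d) = 1 + 2 * c := by field_simp; ring
    rw [e, div_mul_eq_mul_div, div_lt_iff₀ hd] at h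
    nlinarith

/-- The law of `K_f` determines `1 / f`, with a continuous inverse. -/
lemma tendsto_of_tendsto_pearsonLaw {c : ℕ → ℝ} (hc : ∀ k, 0 ≤ c k) {c₀ : ℝ} (hc₀ : 0 ≤ c₀)
    (h : ∀ g : BoundedContinuousFunction ℝ ℝ, Tendsto (fun k => ∫ x, g x ∂(pearsonLaw (c k)⁻¹))
      atTop (𝓝 (∫ x, g x ∂(pearsonLaw c₀⁻¹)))) : Tendsto c atTop (𝓝 c₀) := by
  let L : ℝ → ProbabilityMeasure ℝ := fun c => ⟨pearsonLaw c⁻¹, inferInstance⟩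
  have h1 : Tendsto (fun n => L (c n)) atTop (𝓝 (L c₀)) :=
    ProbabilityMeasure.tendsto_iff_forall_integral_tendsto.2 h
  have h2 := (ProbabilityMeasure.tendsto_iff_tendsto_charFun.1 h1 1).norm
  refine tendsto_order.2 ⟨fun a ha => ?_, fun a ha => ?_⟩
  · rcases lt_or_ge a 0 with ha0 | ha0
    · exact Eventually.of_forall fun k => ha0.trans_le (hc k)
    · filter_upwards [h2.eventually (lt_mem_nhds (norm_charFun_pearsonLaw_strictMono ha0 ha))]
        with k hk
      by_contra hle
      rcases (not_lt.1 hle).eq_or_lt with he | hlt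
      · rw [← he] at hk
        exact lt_irrefl _ hk
      · exact lt_asymm hk (norm_charFun_pearsonLaw_strictMono (hc k) hlt)
  · filter_upwards [h2.eventually (gt_mem_nhds (norm_charFun_pearsonLaw_strictMono hc₀ ha))]
      with k hk
    by_contra hle
    rcases (not_lt.1 hle).eq_or_lt with he | hlt
    · rw [he] at hk
      exact lt_irrefl _ hk
    · exact lt_asymm hk (norm_charFun_pearsonLaw_strictMono (hc₀.trans ha.le) hlt)

/-! ### Convergence to zero in probability on varying spaces -/

section InProb

variable {Ω : ℕ → Type*} [∀ k, MeasurableSpace (Ω k)] {P : ∀ k, Measure (Ω k)}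

/-- A deterministic implication, uniform in `k` and `ω`, is an inclusion of events. Monotonicity of
the measure suffices, and no measurability enters. -/
lemma TendstoZeroInProb.mono {Y Y' : ∀ k, Ω k → ℝ} (hY : TendstoZeroInProb P Y)
    (h : ∀ ε > 0, ∃ δ > 0, ∀ k ω, |Y k ω| < δ → |Y' k ω| < ε) : TendstoZeroInProb P Y' := by
  intro ε hε
  obtain ⟨δ, hδ, h⟩ := h ε hε
  refine tendsto_of_tendsto_of_tendsto_of_le_of_le tendsto_const_nhds (hY δ hδ)
    (fun k => zero_le) (fun k => measure_mono fun ω hω => ?_)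
  by_contra hlt
  exact (h k ω (not_le.1 hlt)).not_ge hω

lemma TendstoZeroInProb.max {Y Z : ∀ k, Ω k → ℝ} (hY : TendstoZeroInProb P Y)
    (hZ : TendstoZeroInProb P Z) : TendstoZeroInProb P fun k ω => max |Y k ω| |Z k ω| := by
  intro ε hε
  have h := (hY ε hε).add (hZ ε hε)
  rw [add_zero] at h
  refine tendsto_of_tendsto_of_tendsto_of_le_of_le tendsto_const_nhds h
    (fun k => zero_le) (fun k => (measure_mono fun ω hω => ?_).trans (measure_union_le _ _))
  have : ε ≤ |_| := hω
  rw [abs_of_nonneg (le_max_of_le_left (abs_nonneg _)), le_max_iff] at this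
  exact this

lemma TendstoZeroInProb.mono₂ {Y Z Y' : ∀ k, Ω k → ℝ} (hY : TendstoZeroInProb P Y)
    (hZ : TendstoZeroInProb P Z)
    (h : ∀ ε > 0, ∃ δ > 0, ∀ k ω, |Y k ω| < δ → |Z k ω| < δ → |Y' k ω| < ε) :
    TendstoZeroInProb P Y' := by
  refine (hY.max hZ).mono fun ε hε => ?_
  obtain ⟨δ, hδ, h⟩ := h ε hε
  refine ⟨δ, hδ, fun k ω hk => ?_⟩
  rw [abs_of_nonneg (le_max_of_le_left (abs_nonneg _)), max_lt_iff] at hk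
  exact h k ω hk.1 hk.2

lemma TendstoZeroInProb.add {Y Z : ∀ k, Ω k → ℝ} (hY : TendstoZeroInProb P Y)
    (hZ : TendstoZeroInProb P Z) : TendstoZeroInProb P fun k ω => Y k ω + Z k ω :=
  hY.mono₂ hZ fun ε hε => ⟨ε / 2, by positivity, fun k ω h1 h2 =>
    (abs_add_le _ _).trans_lt (by linarith)⟩

lemma TendstoZeroInProb.neg {Y : ∀ k, Ω k → ℝ} (hY : TendstoZeroInProb P Y) :
    TendstoZeroInProb P fun k ω => -Y k ω :=
  hY.mono fun ε hε => ⟨ε, hε, fun k ω h => by rwa [abs_neg]⟩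

lemma tendstoZeroInProb_const [∀ k, IsProbabilityMeasure (P k)] {y : ℕ → ℝ} :
    TendstoZeroInProb P (fun k _ => y k) ↔ Tendsto y atTop (𝓝 0) := by
  refine ⟨fun h => ?_, fun h ε hε => ?_⟩
  · rw [Metric.tendsto_atTop']
    intro ε hε
    -- For a constant the event is empty or the whole space, so a probability below one means that
    -- it is empty.
    obtain ⟨N, hN⟩ := eventually_atTop.1 ((h ε hε).eventually (gt_mem_nhds one_pos))
    refine ⟨N, fun k hk => ?_⟩
    have := hN k hk.le
    by_contra hle
    rw [Real.dist_eq, sub_zero, not_lt] at hle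
    simp [hle] at this
  · refine tendsto_const_nhds.congr' ?_
    filter_upwards [(h.abs.eventually (gt_mem_nhds (by simpa using hε)))] with k hk
    simp [not_le.2 hk]

/-- Bounded convergence: `|Y|` is at most `ε/2` plus `M` times the indicator of `ε/2 ≤ |Y|`. -/
lemma TendstoZeroInProb.tendsto_integral [∀ k, IsProbabilityMeasure (P k)] {Y : ∀ k, Ω k → ℝ}
    (hY : TendstoZeroInProb P Y) (hm : ∀ k, AEMeasurable (Y k) (P k)) {M : ℝ}
    (hM : ∀ k ω, |Y k ω| ≤ M) : Tendsto (fun k => ∫ ω, Y k ω ∂(P k)) atTop (𝓝 0) := by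
  have hM0 : 0 ≤ M := by
    obtain ⟨ω⟩ := nonempty_of_isProbabilityMeasure (P 0)
    exact (abs_nonneg _).trans (hM 0 ω)
  rw [Metric.tendsto_atTop']
  intro ε hε
  have h1 : Tendsto (fun k => (P k).real {ω | ε / 2 ≤ |Y k ω|}) atTop (𝓝 0) :=
    (ENNReal.tendsto_toReal ENNReal.zero_ne_top).comp (hY (ε / 2) (by positivity))
  have h2 : Tendsto (fun k => ε / 2 + M * (P k).real {ω | ε / 2 ≤ |Y k ω|}) atTop (𝓝 (ε / 2)) := by
    simpa using (h1.const_mul M).const_add (ε / 2)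
  obtain ⟨N, hN⟩ := eventually_atTop.1 (h2.eventually (gt_mem_nhds (half_lt_self hε)))
  refine ⟨N, fun k hk => ?_⟩
  have hY' : AEMeasurable (fun ω => |Y k ω|) (P k) := (hm k).norm
  have hS : NullMeasurableSet {ω | ε / 2 ≤ |Y k ω|} (P k) :=
    nullMeasurableSet_le aemeasurable_const hY'
  have hS1 : Integrable ({ω | ε / 2 ≤ |Y k ω|}.indicator fun _ => (1 : ℝ)) (P k) :=
    (integrable_const 1).indicator₀ hS
  rw [Real.dist_eq, sub_zero]
  refine (abs_integral_le_integral_abs.trans ?_).trans_lt (hN k hk.le)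
  have hb : ∀ ω, |Y k ω| ≤ ε / 2 + M * {ω | ε / 2 ≤ |Y k ω|}.indicator (fun _ => (1 : ℝ)) ω := by
    intro ω
    by_cases hω : ε / 2 ≤ |Y k ω|
    · rw [Set.indicator_of_mem (by exact hω)]
      linarith [hM k ω]
    · rw [Set.indicator_of_notMem (by exact hω)]
      linarith [not_le.1 hω]
  refine (integral_mono (Integrable.of_bound hY'.aestronglyMeasurable M (ae_of_all _ fun ω => by
    simpa using hM k ω)) ((integrable_const _).add (hS1.const_mul M)) hb).trans (le_of_eq ?_)
  rw [integral_add' (integrable_const _) (hS1.const_mul M), integral_const_mul,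
    integral_indicator₀ hS]
  simp

lemma measure_le_abs_le_integral_sq {Ω : Type*} [MeasurableSpace Ω] {P : Measure Ω}
    [IsProbabilityMeasure P] {Y : Ω → ℝ} (hi : Integrable (fun ω => Y ω ^ 2) P) {ε : ℝ}
    (hε : 0 < ε) : P {ω | ε ≤ |Y ω|} ≤ ENNReal.ofReal ((∫ ω, Y ω ^ 2 ∂P) / ε ^ 2) := by
  have h2 := mul_meas_ge_le_integral_of_nonneg (ae_of_all _ fun ω => sq_nonneg (Y ω)) hi (ε ^ 2)
  have h3 : {ω | ε ≤ |Y ω|} = {ω | ε ^ 2 ≤ Y ω ^ 2} := by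
    ext ω
    simp only [Set.mem_ofPred_eq]
    rw [sq_le_sq, abs_of_pos hε]
  rw [h3]
  refine (ENNReal.le_ofReal_iff_toReal_le (measure_ne_top _ _) ?_).2 ?_
  · exact div_nonneg (integral_nonneg fun ω => sq_nonneg _) (sq_nonneg _)
  · rw [le_div_iff₀ (by positivity), mul_comm]
    exact h2

lemma tendstoZeroInProb_of_tendsto_integral_sq [∀ k, IsProbabilityMeasure (P k)]
    {Y : ∀ k, Ω k → ℝ} (hi : ∀ᶠ k in atTop, Integrable (fun ω => Y k ω ^ 2) (P k))
    (h : Tendsto (fun k => ∫ ω, Y k ω ^ 2 ∂(P k)) atTop (𝓝 0)) : TendstoZeroInProb P Y := by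
  intro ε hε
  have h1 : Tendsto (fun k => ENNReal.ofReal ((∫ ω, Y k ω ^ 2 ∂(P k)) / ε ^ 2)) atTop (𝓝 0) := by
    have := ENNReal.tendsto_ofReal (h.div_const (ε ^ 2))
    simpa using this
  exact tendsto_of_tendsto_of_tendsto_of_le_of_le' tendsto_const_nhds h1
    (Eventually.of_forall fun k => zero_le)
    (hi.mono fun k hk => measure_le_abs_le_integral_sq hk hε)

/-- The product of a sequence with bounded second moments and a sequence tending to zero in
probability. -/
lemma TendstoZeroInProb.mul_of_integral_sq_le [∀ k, IsProbabilityMeasure (P k)]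
    {X Y : ∀ k, Ω k → ℝ} {C : ℝ} (hi : ∀ k, Integrable (fun ω => X k ω ^ 2) (P k))
    (hX : ∀ k, ∫ ω, X k ω ^ 2 ∂(P k) ≤ C) (hY : TendstoZeroInProb P Y) :
    TendstoZeroInProb P fun k ω => X k ω * Y k ω := by
  intro ε hε
  have hC : 0 ≤ C := (integral_nonneg fun ω => sq_nonneg (X 0 ω)).trans (hX 0)
  rw [ENNReal.tendsto_nhds_zero]
  intro η hη
  obtain ⟨r, hr, hrη⟩ := ENNReal.lt_iff_exists_nnreal_btwn.1 hη
  have hr0 : (0 : ℝ) < r := by exact_mod_cast hr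
  -- Truncation level for which Chebyshev's inequality gives a tail of at most `C/K² ≤ r/2`. The
  -- summand `1` keeps `K` positive when `C = 0`.
  set K := √(2 * (C + 1) / r) with hK
  have hK0 : 0 < K := Real.sqrt_pos.2 (by positivity)
  have hK2 : C / K ^ 2 ≤ r / 2 := by
    rw [hK, Real.sq_sqrt (by positivity), div_div_eq_mul_div, div_le_div_iff₀ (by positivity)
      two_pos]
    nlinarith
  have h2 := (ENNReal.tendsto_nhds_zero.1 (hY (ε / K) (by positivity)))
    (ENNReal.ofReal (r / 2)) (by simpa using hr0)
  filter_upwards [h2] with k hk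
  have h3 : {ω | ε ≤ |X k ω * Y k ω|} ⊆ {ω | K ≤ |X k ω|} ∪ {ω | ε / K ≤ |Y k ω|} := by
    intro ω hω
    by_contra hn
    simp only [Set.mem_union, Set.mem_ofPred_eq, not_or, not_le] at hn hω
    rw [abs_mul] at hω
    have := mul_lt_mul'' hn.1 hn.2 (abs_nonneg _) (abs_nonneg _)
    rw [mul_div_cancel₀ _ hK0.ne'] at this
    linarith
  calc P k {ω | ε ≤ |X k ω * Y k ω|} ≤ P k {ω | K ≤ |X k ω|} + P k {ω | ε / K ≤ |Y k ω|} :=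
        (measure_mono h3).trans (measure_union_le _ _)
    _ ≤ ENNReal.ofReal (r / 2) + ENNReal.ofReal (r / 2) :=
        add_le_add ((measure_le_abs_le_integral_sq (hi k) hK0).trans (ENNReal.ofReal_le_ofReal
          ((div_le_div_of_nonneg_right (hX k) (sq_nonneg _)).trans hK2))) hk
    _ = r := by
        rw [← ENNReal.ofReal_add (by positivity) (by positivity), add_halves,
          ENNReal.ofReal_coe_nnreal]
    _ ≤ η := hrη.le

/-! ### Pearson laws with estimated parameter -/

section Pearson

lemma TendstoZeroInProb.integral_pearsonLaw {c : ℕ → ℝ} (hc : ∀ k, c k ∈ Set.Icc (0 : ℝ) 1)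
    {f : ∀ k, Ω k → ℝ} (hf : ∀ k ω, 0 ≤ f k ω) (h : TendstoZeroInProb P fun k ω => 1 / f k ω - c k)
    (g : BoundedContinuousFunction ℝ ℝ) :
    TendstoZeroInProb P fun k ω =>
      ∫ x, g x ∂(pearsonLaw (f k ω)) - ∫ x, g x ∂(pearsonLaw (c k)⁻¹) := by
  -- `[-1, 2]` contains the `1`-neighbourhood of `[0, 1]`, hence both `c k` and any `1/f` within
  -- distance `1` of it.
  have hu := isCompact_Icc (a := (-1 : ℝ)) (b := 2) |>.uniformContinuousOn_of_continuous
    (continuous_integral_pearsonLaw g).continuousOn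
  rw [Metric.uniformContinuousOn_iff] at hu
  refine h.mono fun ε hε => ?_
  obtain ⟨δ, hδ, hu⟩ := hu ε hε
  refine ⟨min δ 1, by positivity, fun k ω hk => ?_⟩
  rw [lt_min_iff] at hk
  obtain ⟨h1, h2⟩ := abs_lt.1 hk.2
  have := hu (1 / f k ω) ⟨by linarith [(hc k).1], by linarith [(hc k).2]⟩ (c k)
    ⟨by linarith [(hc k).1], by linarith [(hc k).2]⟩ (by rw [Real.dist_eq]; exact hk.1)
  rwa [max_eq_left (hc k).1, max_eq_left (one_div_nonneg.2 (hf k ω)), one_div, inv_inv,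
    Real.dist_eq] at this

lemma tendsto_integral_pearsonLaw_iff {c : ℕ → ℝ} (hc : ∀ k, c k ∈ Set.Icc (0 : ℝ) 1) {c₀ : ℝ}
    (hc₀ : 0 ≤ c₀) :
    (∀ g : BoundedContinuousFunction ℝ ℝ, Tendsto (fun k => ∫ x, g x ∂(pearsonLaw (c k)⁻¹))
      atTop (𝓝 (∫ x, g x ∂(pearsonLaw c₀⁻¹)))) ↔ Tendsto c atTop (𝓝 c₀) := by
  refine ⟨fun h => tendsto_of_tendsto_pearsonLaw (fun k => (hc k).1) hc₀ h, fun h g => ?_⟩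
  have := ((continuous_integral_pearsonLaw g).tendsto c₀).comp h
  rw [max_eq_left hc₀] at this
  refine this.congr fun k => ?_
  rw [Function.comp_apply, max_eq_left (hc k).1]

lemma aemeasurable_integral_pearsonLaw {f : ∀ k, Ω k → ℝ} (hf : ∀ k, AEMeasurable (f k) (P k))
    (g : BoundedContinuousFunction ℝ ℝ) (k : ℕ) :
    AEMeasurable (fun ω => ∫ x, g x ∂(pearsonLaw (f k ω))) (P k) :=
  ((StronglyMeasurable.integral_kernel_prod_right' (κ := pearsonKernel)
    (f := fun p : ℝ × ℝ => g p.2)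
    (g.continuous.comp continuous_snd).stronglyMeasurable).measurable).comp_aemeasurable (hf k)

variable [∀ k, IsProbabilityMeasure (P k)]

/-- The random law may be replaced by the deterministic law with parameter `c k`, and for
deterministic quantities convergence in probability is ordinary convergence. -/
lemma pearsonLawTendsto_iff {c : ℕ → ℝ} (hc : ∀ k, c k ∈ Set.Icc (0 : ℝ) 1) {c₀ : ℝ}
    (hc₀ : 0 ≤ c₀) {f : ∀ k, Ω k → ℝ} (hf : ∀ k ω, 0 ≤ f k ω)
    (h : TendstoZeroInProb P fun k ω => 1 / f k ω - c k) :
    PearsonLawTendsto P f (pearsonLaw c₀⁻¹) ↔ Tendsto c atTop (𝓝 c₀) := by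
  rw [← tendsto_integral_pearsonLaw_iff hc hc₀]
  refine forall_congr' fun g => ?_
  have hg := h.integral_pearsonLaw hc hf g
  rw [← tendsto_sub_nhds_zero_iff, ← tendstoZeroInProb_const (P := P)]
  refine ⟨fun h1 => ?_, fun h1 => ?_⟩
  · have := h1.add hg.neg
    simpa using this
  · have := h1.add hg
    simpa using this

lemma IsPearsonVariable.integral_comp {f K : ∀ k, Ω k → ℝ} (hK : IsPearsonVariable P f K) (k : ℕ)
    (g : BoundedContinuousFunction ℝ ℝ) :
    ∫ x, g x ∂((P k).map (K k)) = ∫ ω, ∫ x, g x ∂(pearsonLaw (f k ω)) ∂(P k) := by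
  have h := hK k
  have hf := h.aemeasurable_fst
  have hKm := h.aemeasurable_snd
  have : IsProbabilityMeasure ((P k).map (f k)) := Measure.isProbabilityMeasure_map hf
  have h1 : ∫ x, g x ∂((P k).map (K k)) =
      ∫ p, g p.2 ∂((P k).map fun ω => (f k ω, K k ω)) := by
    rw [integral_map hKm (by fun_prop), integral_map (hf.prodMk hKm) (by fun_prop)]
  have hint : Integrable (fun p : ℝ × ℝ => g p.2) ((P k).map (f k) ⊗ₘ pearsonKernel) :=
    Integrable.of_bound (by fun_prop) ‖g‖ (ae_of_all _ fun p => g.norm_coe_le_norm _)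
  rw [h1, h.map_eq, Measure.integral_compProd hint]
  change ∫ y, ∫ x, g x ∂(pearsonLaw y) ∂((P k).map (f k)) = _
  rw [integral_map hf]
  exact (StronglyMeasurable.integral_kernel_prod_right' (κ := pearsonKernel)
    (f := fun p : ℝ × ℝ => g p.2)
    (g.continuous.comp continuous_snd).stronglyMeasurable).aestronglyMeasurable

lemma abs_integral_pearsonLaw_le (g : BoundedContinuousFunction ℝ ℝ) (f : ℝ) :
    |∫ x, g x ∂(pearsonLaw f)| ≤ ‖g‖ := by
  have := norm_integral_le_of_norm_le_const (μ := pearsonLaw f)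
    (ae_of_all _ fun x => g.norm_coe_le_norm x)
  simpa using this

/-- The expectation of `g(K)` is that of the conditional integral, which is bounded by `‖g‖` and
close in probability to its value at `c k`. So the expectations converge exactly when the
deterministic integrals do. -/
lemma IsPearsonVariable.tendstoInDistribution_iff {c : ℕ → ℝ}
    (hc : ∀ k, c k ∈ Set.Icc (0 : ℝ) 1) {c₀ : ℝ} (hc₀ : 0 ≤ c₀) {f : ∀ k, Ω k → ℝ}
    (hf : ∀ k ω, 0 ≤ f k ω) (h : TendstoZeroInProb P fun k ω => 1 / f k ω - c k)
    {K : ∀ k, Ω k → ℝ} (hK : IsPearsonVariable P f K) {Ω' : Type*} [MeasurableSpace Ω']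
    {P' : Measure Ω'} [IsProbabilityMeasure P'] {Y : Ω' → ℝ} (hY : AEMeasurable Y P')
    (hYlaw : P'.map Y = pearsonLaw c₀⁻¹) :
    TendstoInDistribution K atTop Y P P' ↔ Tendsto c atTop (𝓝 c₀) := by
  have hKm : ∀ k, AEMeasurable (K k) (P k) := fun k => (hK k).aemeasurable_snd
  have key : TendstoInDistribution K atTop Y P P' ↔
      ∀ g : BoundedContinuousFunction ℝ ℝ, Tendsto (fun k => ∫ x, g x ∂((P k).map (K k)))
        atTop (𝓝 (∫ x, g x ∂(pearsonLaw c₀⁻¹))) := by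
    refine ⟨fun h g => ?_, fun h => ⟨hKm, hY, ?_⟩⟩
    · have := ProbabilityMeasure.tendsto_iff_forall_integral_tendsto.1 h.tendsto g
      rw [← hYlaw]
      exact this
    · refine ProbabilityMeasure.tendsto_iff_forall_integral_tendsto.2 fun g => ?_
      have := h g
      rw [← hYlaw] at this
      exact this
  rw [key, ← tendsto_integral_pearsonLaw_iff hc hc₀]
  refine forall_congr' fun g => ?_
  have hfm : ∀ k, AEMeasurable (f k) (P k) := fun k => (hK k).aemeasurable_fst
  have hm := aemeasurable_integral_pearsonLaw hfm g
  have h0 := (h.integral_pearsonLaw hc hf g).tendsto_integral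
    (fun k => (hm k).sub aemeasurable_const) (M := ‖g‖ + ‖g‖) fun k ω =>
      (abs_sub _ _).trans (add_le_add (abs_integral_pearsonLaw_le g _)
        (abs_integral_pearsonLaw_le g _))
  have h1 : ∀ k, ∫ ω, (∫ x, g x ∂(pearsonLaw (f k ω)) - ∫ x, g x ∂(pearsonLaw (c k)⁻¹)) ∂(P k) =
      ∫ x, g x ∂((P k).map (K k)) - ∫ x, g x ∂(pearsonLaw (c k)⁻¹) := by
    intro k
    rw [integral_sub (Integrable.of_bound (hm k).aestronglyMeasurable ‖g‖
      (ae_of_all _ fun ω => abs_integral_pearsonLaw_le g _)) (integrable_const _),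
      hK.integral_comp]
    simp
  simp_rw [h1] at h0
  refine ⟨fun h2 => ?_, fun h2 => ?_⟩
  · have := h2.sub h0
    simpa using this
  · have := h2.add h0
    simpa using this

end Pearson

end InProb

/-! ### The limit law of weighted sums of chi-squared variables -/

/-- Telescoping: factors are exchanged one at a time, and the other factors have modulus at most
one. -/
lemma norm_prod_sub_prod_le {ι : Type*} (s : Finset ι) (f g : ι → ℂ) (hf : ∀ i ∈ s, ‖f i‖ ≤ 1)
    (hg : ∀ i ∈ s, ‖g i‖ ≤ 1) : ‖∏ i ∈ s, f i - ∏ i ∈ s, g i‖ ≤ ∑ i ∈ s, ‖f i - g i‖ := by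
  classical
  induction s using Finset.induction_on with
  | empty => simp
  | insert a s ha ih =>
    rw [Finset.prod_insert ha, Finset.prod_insert ha, Finset.sum_insert ha]
    have h1 : f a * ∏ i ∈ s, f i - g a * ∏ i ∈ s, g i =
        (f a - g a) * ∏ i ∈ s, f i + g a * (∏ i ∈ s, f i - ∏ i ∈ s, g i) := by ring
    have hs : ‖∏ i ∈ s, f i‖ ≤ 1 := by
      rw [norm_prod]
      exact Finset.prod_le_one (fun _ _ => norm_nonneg _)
        fun i hi => hf i (Finset.mem_insert_of_mem hi)
    have ih' := ih (fun i hi => hf i (Finset.mem_insert_of_mem hi))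
      fun i hi => hg i (Finset.mem_insert_of_mem hi)
    rw [h1]
    refine (norm_add_le _ _).trans (add_le_add ?_ ?_)
    · rw [norm_mul]
      exact mul_le_of_le_one_right (norm_nonneg _) hs
    · rw [norm_mul]
      exact (mul_le_of_le_one_left (norm_nonneg _) (hg a (Finset.mem_insert_self a s))).trans ih'

lemma norm_exp_neg_sq_le_one (u : ℝ) : ‖Complex.exp (-(u ^ 2 / 2 : ℝ))‖ ≤ 1 := by
  rw [← Complex.ofReal_neg, Complex.norm_exp, Complex.ofReal_re, Real.exp_le_one_iff]
  nlinarith [sq_nonneg u]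

section Weights

variable {β : ℕ → ℕ → ℝ} {D : ℕ → ℕ} {b : ℕ → ℝ}

/-- Padding with zeros lets the first `m` weights be split off without comparing `m` to `D k`. -/
lemma sum_range_add_weights (hD : ∀ k s, D k ≤ s → β k s = 0)
    (hsum : ∀ k, ∑ s ∈ Finset.range (D k), β k s ^ 2 = 1) (k m : ℕ) :
    ∑ s ∈ Finset.range (D k + m), β k s ^ 2 = 1 := by
  rw [Finset.sum_range_add, hsum, Finset.sum_eq_zero, add_zero]
  intro s _
  rw [hD k _ (Nat.le_add_right _ _)]
  simp

/-- Finite partial sums pass to the limit, but mass can escape to infinity; hence only `≤ 1`. The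
escaped mass becomes the variance of the normal component. -/
lemma summable_sq_limit_weights (hD : ∀ k s, D k ≤ s → β k s = 0)
    (hsum : ∀ k, ∑ s ∈ Finset.range (D k), β k s ^ 2 = 1)
    (hb : ∀ s, Tendsto (fun k => β k s) atTop (𝓝 (b s))) :
    Summable (fun s => b s ^ 2) ∧ ∑' s, b s ^ 2 ≤ 1 := by
  have h : ∀ m, ∑ s ∈ Finset.range m, b s ^ 2 ≤ 1 := by
    intro m
    refine le_of_tendsto (tendsto_finsetSum _ fun s _ => (hb s).pow 2)
      (Eventually.of_forall fun k => ?_)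
    rw [← sum_range_add_weights hD hsum k m]
    exact Finset.sum_le_sum_of_subset_of_nonneg
      (Finset.range_mono (Nat.le_add_left _ _)) fun _ _ _ => sq_nonneg _
  have hs := summable_of_sum_range_le (fun s => sq_nonneg (b s)) h
  exact ⟨hs, hs.tsum_le_of_sum_range_le h⟩

/-- Products of characteristic functions that agree with the standard normal one to second order,
along square-summable weights whose largest elements stabilize. -/
lemma tendsto_prod_weights {ψ : ℝ → ℂ} (hψ0 : ψ 0 = 1) (hψ1 : ∀ u, ‖ψ u‖ ≤ 1)
    (hψc : Continuous ψ)
    (hψ : (fun u : ℝ => ψ u - Complex.exp (-(u ^ 2 / 2 : ℝ))) =o[𝓝 0] fun u => u ^ 2)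
    (h0 : ∀ k s, 0 ≤ β k s) (hanti : ∀ k, Antitone (β k))
    (hD : ∀ k s, D k ≤ s → β k s = 0) (hsum : ∀ k, ∑ s ∈ Finset.range (D k), β k s ^ 2 = 1)
    (hb : ∀ s, Tendsto (fun k => β k s) atTop (𝓝 (b s))) {t : ℝ} {L : ℂ}
    (hL : Tendsto (fun m => (∏ s ∈ Finset.range m, ψ (t * b s)) *
      Complex.exp (-(t ^ 2 / 2 * (1 - ∑ s ∈ Finset.range m, b s ^ 2) : ℝ))) atTop (𝓝 L)) :
    Tendsto (fun k => ∏ s ∈ Finset.range (D k), ψ (t * β k s)) atTop (𝓝 L) := by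
  have hbz : Tendsto b atTop (𝓝 0) := by
    have h := (summable_sq_limit_weights hD hsum hb).1.tendsto_atTop_zero
    have h2 := (Real.continuous_sqrt.tendsto 0).comp h
    rw [Real.sqrt_zero] at h2
    refine h2.congr fun s => ?_
    rw [Function.comp_apply, Real.sqrt_sq]
    exact ge_of_tendsto (hb s) (Eventually.of_forall fun k => h0 k s)
  rw [Metric.tendsto_atTop']
  intro ε hε
  have hδ : 0 < ε / 3 / (t ^ 2 + 1) := by positivity
  obtain ⟨r, hr, hψr⟩ := Metric.eventually_nhds_iff.1 (hψ.def hδ)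
  have h1 : ∀ᶠ M in atTop, |t| * b M < r := by
    refine (hbz.const_mul |t|).eventually (gt_mem_nhds ?_)
    simpa using hr
  -- `M` is chosen so that all tail weights fall into the range where `ψ` is nearly Gaussian and so
  -- that the `M`-th approximation is within `ε/3` of `L`. With `M` fixed, the first `M` weights and
  -- the remaining variance converge in `k`.
  obtain ⟨M, hM1, hM2⟩ := (h1.and (Metric.tendsto_nhds.1 hL (ε / 3) (by positivity))).exists
  have h2 : Tendsto (fun k => (∏ s ∈ Finset.range M, ψ (t * β k s)) *
      Complex.exp (-(t ^ 2 / 2 * (1 - ∑ s ∈ Finset.range M, β k s ^ 2) : ℝ))) atTop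
      (𝓝 ((∏ s ∈ Finset.range M, ψ (t * b s)) *
      Complex.exp (-(t ^ 2 / 2 * (1 - ∑ s ∈ Finset.range M, b s ^ 2) : ℝ)))) := by
    refine Tendsto.mul (tendsto_finsetProd _ fun s _ =>
      (hψc.tendsto _).comp ((hb s).const_mul t)) ?_
    refine (Complex.continuous_exp.tendsto _).comp
      (((Complex.continuous_ofReal.tendsto _).comp ?_).neg)
    exact ((tendsto_finsetSum _ fun s _ => (hb s).pow 2).const_sub 1).const_mul _
  have h3 : ∀ᶠ k in atTop, |t| * β k M < r :=
    ((hb M).const_mul |t|).eventually (gt_mem_nhds hM1)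
  obtain ⟨N, hN⟩ := eventually_atTop.1 (h3.and (Metric.tendsto_nhds.1 h2 (ε / 3) (by positivity)))
  refine ⟨N, fun k hk => ?_⟩
  obtain ⟨hk1, hk2⟩ := hN k hk.le
  have e1 : ∏ s ∈ Finset.range (D k), ψ (t * β k s) =
      ∏ s ∈ Finset.range (D k + M), ψ (t * β k s) := by
    rw [Finset.prod_range_add]
    rw [Finset.prod_eq_one (s := Finset.range M), mul_one]
    intro s _
    rw [hD k _ (Nat.le_add_right _ _), mul_zero, hψ0]
  have e2 : ∏ s ∈ Finset.range (D k + M), ψ (t * β k s) =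
      (∏ s ∈ Finset.range M, ψ (t * β k s)) *
        ∏ s ∈ Finset.range (D k), ψ (t * β k (M + s)) := by
    rw [add_comm, Finset.prod_range_add]
  have e3 : ∑ s ∈ Finset.range (D k), β k (M + s) ^ 2 =
      1 - ∑ s ∈ Finset.range M, β k s ^ 2 := by
    rw [← sum_range_add_weights hD hsum k M, add_comm, Finset.sum_range_add]
    ring
  -- The normal factor carrying the tail variance is split over the tail weights again, so that it
  -- can be compared with the tail of the product factor by factor.
  have e4 : Complex.exp (-(t ^ 2 / 2 * (1 - ∑ s ∈ Finset.range M, β k s ^ 2) : ℝ)) =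
      ∏ s ∈ Finset.range (D k), Complex.exp (-((t * β k (M + s)) ^ 2 / 2 : ℝ)) := by
    rw [← Complex.exp_sum, ← e3, Finset.mul_sum]
    congr 1
    push_cast
    rw [← Finset.sum_neg_distrib]
    refine Finset.sum_congr rfl fun s _ => ?_
    ring
  have hM0 : ‖∏ s ∈ Finset.range M, ψ (t * β k s)‖ ≤ 1 := by
    rw [norm_prod]
    exact Finset.prod_le_one (fun _ _ => norm_nonneg _) fun i _ => hψ1 _
  have h4 : dist (∏ s ∈ Finset.range (D k), ψ (t * β k s))
      ((∏ s ∈ Finset.range M, ψ (t * β k s)) *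
        Complex.exp (-(t ^ 2 / 2 * (1 - ∑ s ∈ Finset.range M, β k s ^ 2) : ℝ))) < ε / 3 := by
    rw [e1, e2, e4, dist_eq_norm, ← mul_sub, norm_mul]
    refine (mul_le_of_le_one_left (norm_nonneg _) hM0).trans_lt ?_
    refine (norm_prod_sub_prod_le _ _ _ (fun _ _ => hψ1 _)
      fun _ _ => norm_exp_neg_sq_le_one _).trans_lt ?_
    have h5 : ∀ s ∈ Finset.range (D k),
        ‖ψ (t * β k (M + s)) - Complex.exp (-((t * β k (M + s)) ^ 2 / 2 : ℝ))‖ ≤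
        ε / 3 / (t ^ 2 + 1) * t ^ 2 * β k (M + s) ^ 2 := by
      intro s _
      have := @hψr (t * β k (M + s)) (by
        rw [Real.dist_eq, sub_zero, abs_mul, abs_of_nonneg (h0 k _)]
        exact (mul_le_mul_of_nonneg_left (hanti k (Nat.le_add_right _ _))
          (abs_nonneg t)).trans_lt hk1)
      rw [Real.norm_of_nonneg (sq_nonneg _)] at this
      refine this.trans (le_of_eq (by ring))
    refine (Finset.sum_le_sum h5).trans_lt ?_
    rw [← Finset.mul_sum, e3]
    have h6 : ε / 3 / (t ^ 2 + 1) * t ^ 2 < ε / 3 := by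
      rw [div_mul_eq_mul_div, div_lt_iff₀ (by positivity)]
      nlinarith
    refine (mul_le_of_le_one_right (by positivity) ?_).trans_lt h6
    have := Finset.sum_nonneg fun s (_ : s ∈ Finset.range M) => sq_nonneg (β k s)
    linarith
  calc _ ≤ _ := dist_triangle4 _ _ _ _
    _ < ε / 3 + ε / 3 + ε / 3 := add_lt_add (add_lt_add h4 hk2) hM2
    _ = ε := by ring

end Weights

/-! ### Moments of the standard normal law and the standardized `χ²₁` characteristic function -/

lemma integral_sq_chiSq_one : ∫ x, x ^ 2 ∂(chiSq 1) = 3 := by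
  have hm : Measurable (gammaPDF (1 / 2) (1 / 2)) :=
    (measurable_gammaPDFReal _ _).ennreal_ofReal
  have hG := Real.Gamma_pos_of_pos (show (0 : ℝ) < 1 / 2 by norm_num)
  have h1 : ∀ x : ℝ, (gammaPDF (1 / 2) (1 / 2) x).toReal * x ^ 2 =
      (Set.Ici (0 : ℝ)).indicator (fun x => (1 / 2 : ℝ) ^ (1 / 2 : ℝ) / Real.Gamma (1 / 2) *
        (x ^ ((5 / 2 : ℝ) - 1) * Real.exp (-(1 / 2 * x)))) x := by
    intro x
    by_cases hx : 0 ≤ x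
    · rw [Set.indicator_of_mem (by exact hx), gammaPDF_of_nonneg hx, ENNReal.toReal_ofReal
        (by positivity)]
      have : x ^ ((5 / 2 : ℝ) - 1) = x ^ ((1 / 2 : ℝ) - 1) * x ^ 2 := by
        rcases hx.eq_or_lt with rfl | hx
        · rw [Real.zero_rpow (by norm_num)]
          simp
        · rw [← Real.rpow_natCast, ← Real.rpow_add hx]
          norm_num
      rw [this]
      ring
    · rw [Set.indicator_of_notMem (by exact hx), gammaPDF_of_neg (not_le.1 hx)]
      simp
  rw [chiSq, gammaMeasure, integral_withDensity_eq_integral_toReal_smul hm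
    (ae_of_all _ fun x => ENNReal.ofReal_lt_top)]
  simp_rw [smul_eq_mul, h1]
  rw [integral_indicator measurableSet_Ici, integral_Ici_eq_integral_Ioi, integral_const_mul,
    Real.integral_rpow_mul_exp_neg_mul_Ioi (by norm_num) (by norm_num)]
  have h2 : Real.Gamma (5 / 2) = 3 / 2 * (1 / 2 * Real.Gamma (1 / 2)) := by
    rw [← Real.Gamma_add_one (by norm_num), show (1 / 2 : ℝ) + 1 = 3 / 2 by norm_num,
      ← Real.Gamma_add_one (by norm_num)]
    norm_num
  have h3 : (1 / 2 : ℝ) ^ (1 / 2 : ℝ) * (1 / (1 / 2)) ^ (5 / 2 : ℝ) = 4 := by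
    rw [show (5 / 2 : ℝ) = 1 / 2 + 2 by norm_num, Real.rpow_add (by norm_num),
      ← mul_assoc, ← Real.mul_rpow (by norm_num) (by norm_num)]
    norm_num
  calc _ = (1 / 2 : ℝ) ^ (1 / 2 : ℝ) * (1 / (1 / 2)) ^ (5 / 2 : ℝ) *
        (Real.Gamma (5 / 2) / Real.Gamma (1 / 2)) := by ring
    _ = 3 := by
      rw [h3, h2]
      field_simp
      norm_num

lemma integrable_pow_gaussianReal (n : ℕ) : Integrable (fun x : ℝ => x ^ n) (gaussianReal 0 1) := by
  refine (((memLp_id_gaussianReal (μ := 0) (v := 1) (n : NNReal)).integrable_norm_pow'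
    ).mono' (by fun_prop) (ae_of_all _ fun x => ?_))
  simp

lemma integral_sq_gaussianReal : ∫ x, x ^ 2 ∂(gaussianReal 0 1) = 1 := by
  have h := variance_fun_id_gaussianReal (μ := 0) (v := 1)
  rw [variance_eq_integral (by fun_prop)] at h
  simpa [integral_id_gaussianReal] using h

/-- The square of a standard normal variable is `χ²₁`, so this is the second moment computed from
the gamma density. -/
lemma integral_pow_four_gaussianReal : ∫ x, x ^ 4 ∂(gaussianReal 0 1) = 3 := by
  rw [← integral_sq_chiSq_one, ← gaussianReal_map_sq, integral_map (by fun_prop) (by fun_prop)]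
  refine integral_congr_ae (ae_of_all _ fun x => ?_)
  ring

lemma integral_sq_sub_one_gaussianReal : ∫ x, (x ^ 2 - 1) ∂(gaussianReal 0 1) = 0 := by
  rw [integral_sub (integrable_pow_gaussianReal 2) (integrable_const _), integral_sq_gaussianReal]
  simp

lemma integral_sq_sub_one_sq_gaussianReal :
    ∫ x, (x ^ 2 - 1) ^ 2 ∂(gaussianReal 0 1) = 2 := by
  have h : ∀ x : ℝ, (x ^ 2 - 1) ^ 2 = x ^ 4 - 2 * x ^ 2 + 1 := fun x => by ring
  simp_rw [h]
  have hi : Integrable (fun x : ℝ => 2 * x ^ 2) (gaussianReal 0 1) :=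
    (integrable_pow_gaussianReal 2).const_mul 2
  have hi' : Integrable (fun x : ℝ => x ^ 4 - 2 * x ^ 2) (gaussianReal 0 1) :=
    (integrable_pow_gaussianReal 4).sub hi
  rw [integral_add hi' (integrable_const _), integral_sub (integrable_pow_gaussianReal 4) hi,
    integral_const_mul, integral_sq_gaussianReal,
    integral_pow_four_gaussianReal]
  simp
  norm_num

/-- The characteristic function of a standardized `χ²₁` variable. -/
noncomputable def chiChar (u : ℝ) : ℂ :=
  charFun ((gaussianReal 0 1).map fun x => (x ^ 2 - 1) / √2) u

lemma chiChar_eq (u : ℝ) : chiChar u = charFun ((chiSq 1).map fun x => (x - 1) / √2) u := by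
  rw [chiChar, ← gaussianReal_map_sq, Measure.map_map (by fun_prop) (by fun_prop)]
  rfl

instance : IsProbabilityMeasure ((gaussianReal 0 1).map fun x : ℝ => (x ^ 2 - 1) / √2) :=
  Measure.isProbabilityMeasure_map (by fun_prop)

lemma chiChar_zero : chiChar 0 = 1 := by
  rw [chiChar, charFun_zero]
  simp

lemma norm_chiChar_le (u : ℝ) : ‖chiChar u‖ ≤ 1 := norm_charFun_le_one _

lemma continuous_chiChar : Continuous chiChar := continuous_charFun

/-- Both laws have mean `0` and variance `1`, so their second-order Taylor expansions at `0`
coincide. -/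
lemma chiChar_sub_isLittleO :
    (fun u : ℝ => chiChar u - Complex.exp (-(u ^ 2 / 2 : ℝ))) =o[𝓝 0] fun u => u ^ 2 := by
  have h1 : (fun t : ℝ => chiChar t - (1 - t ^ 2 / 2)) =o[𝓝 0] fun t => t ^ 2 := by
    refine taylor_charFun_two (P := gaussianReal 0 1) (X := fun x => (x ^ 2 - 1) / √2)
      (by fun_prop) ?_ ?_
    · rw [integral_div, integral_sq_sub_one_gaussianReal, zero_div]
    · simp only [Pi.pow_apply, div_pow]
      rw [integral_div, integral_sq_sub_one_sq_gaussianReal]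
      norm_num
  have h2 : (fun t : ℝ => charFun ((gaussianReal 0 1).map id) t - (1 - t ^ 2 / 2)) =o[𝓝 0]
      fun t => t ^ 2 := by
    refine taylor_charFun_two (P := gaussianReal 0 1) (X := id) (by fun_prop) ?_ ?_
    · simp [integral_id_gaussianReal]
    · simpa using integral_sq_gaussianReal
  refine (h1.sub h2).congr_left fun u => ?_
  rw [Measure.map_id, charFun_gaussianReal]
  push_cast
  simp

/-! ### Convergence in distribution to the limit variable -/

section Limit

variable {Ω' : Type*} [MeasurableSpace Ω'] {P' : Measure Ω'} {b : ℕ → ℝ} {Y : Ω' → ℝ}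

lemma IsLimitVariable.aemeasurable (h : IsLimitVariable P' b Y) : AEMeasurable Y P' := by
  obtain ⟨C, Z, S, hC, hZ, -, -, hS, rfl⟩ := h
  have hSm : AEMeasurable S P' := by
    refine aemeasurable_of_tendsto_metrizable_ae' (fun m => ?_) hS
    exact Finset.aemeasurable_fun_sum _ fun s _ =>
      (((hC s).aemeasurable.sub_const 1).div_const _).const_mul _
  exact hSm.add (hZ.aemeasurable.const_mul _)

variable [IsProbabilityMeasure P']

/-- Almost sure convergence of the series gives this with the full sum in the normal exponent.
Replacing it by the partial sum changes the factor by a null sequence and yields the form needed in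
`tendsto_prod_weights`. -/
lemma IsLimitVariable.tendsto_charFun (h : IsLimitVariable P' b Y) (hb : Summable fun s => b s ^ 2)
    (hb1 : ∑' s, b s ^ 2 ≤ 1) (t : ℝ) :
    Tendsto (fun m => (∏ s ∈ Finset.range m, chiChar (t * b s)) *
      Complex.exp (-(t ^ 2 / 2 * (1 - ∑ s ∈ Finset.range m, b s ^ 2) : ℝ))) atTop
      (𝓝 (charFun (P'.map Y) t)) := by
  have hYm := h.aemeasurable
  obtain ⟨C, Z, S, hC, hZ, hCi, hCZ, hS, rfl⟩ := h
  set c := √(1 - ∑' s, b s ^ 2) with hc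
  have hc2 : c ^ 2 = 1 - ∑' s, b s ^ 2 := Real.sq_sqrt (by linarith)
  have hSm : ∀ m, AEMeasurable (fun ω => ∑ s ∈ Finset.range m, b s * ((C s ω - 1) / √2)) P' :=
    fun m => Finset.aemeasurable_fun_sum _ fun s _ =>
      (((hC s).aemeasurable.sub_const 1).div_const _).const_mul _
  have hcZ : AEMeasurable (fun ω => c * Z ω) P' := hZ.aemeasurable.const_mul _
  have h1 : ∀ m, charFun (P'.map fun ω => ∑ s ∈ Finset.range m, b s * ((C s ω - 1) / √2)) t =
      ∏ s ∈ Finset.range m, chiChar (t * b s) := by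
    intro m
    have hi : iIndepFun (fun s ω => b s * ((C s ω - 1) / √2)) P' :=
      hCi.comp (fun s x => b s * ((x - 1) / √2)) fun s => by fun_prop
    rw [(hi.restrict _).charFun_map_fun_finsetSum_eq_prod fun s _ =>
      (((hC s).aemeasurable.sub_const 1).div_const _).const_mul _, Finset.prod_apply]
    refine Finset.prod_congr rfl fun s _ => ?_
    rw [charFun_map_mul_comp (((hC s).aemeasurable.sub_const 1).div_const _), chiChar_eq,
      ← (hC s).map_eq, AEMeasurable.map_map_of_aemeasurable (by fun_prop) (hC s).aemeasurable,
      mul_comm]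
    rfl
  have h2 : charFun (P'.map fun ω => c * Z ω) t =
      Complex.exp (-(t ^ 2 / 2 * (1 - ∑' s, b s ^ 2) : ℝ)) := by
    rw [charFun_map_mul_comp hZ.aemeasurable, hZ.map_eq, charFun_gaussianReal, ← hc2]
    congr 1
    push_cast
    simp
    ring
  have h3 : ∀ m, charFun (P'.map fun ω => ∑ s ∈ Finset.range m, b s * ((C s ω - 1) / √2) +
      c * Z ω) t = (∏ s ∈ Finset.range m, chiChar (t * b s)) *
      Complex.exp (-(t ^ 2 / 2 * (1 - ∑' s, b s ^ 2) : ℝ)) := by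
    intro m
    have hi : IndepFun (fun ω => ∑ s ∈ Finset.range m, b s * ((C s ω - 1) / √2))
        (fun ω => c * Z ω) P' :=
      hCZ.comp (φ := fun x : ℕ → ℝ => ∑ s ∈ Finset.range m, b s * ((x s - 1) / √2))
        (ψ := fun z => c * z) (by fun_prop) (by fun_prop)
    rw [hi.charFun_map_fun_add_eq_mul (hSm m) hcZ, Pi.mul_apply, h1, h2]
  have h4 : Tendsto (fun m => charFun (P'.map fun ω =>
      ∑ s ∈ Finset.range m, b s * ((C s ω - 1) / √2) + c * Z ω) t) atTop
      (𝓝 (charFun (P'.map fun ω => S ω + c * Z ω) t)) := by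
    have := tendstoInDistribution_of_ae_tendsto (μ' := P') (l := atTop)
      (X := fun m ω => ∑ s ∈ Finset.range m, b s * ((C s ω - 1) / √2) + c * Z ω)
      (Z := fun ω => S ω + c * Z ω) (fun m => (hSm m).add hcZ) hYm (by
        filter_upwards [hS] with ω hω
        exact hω.add_const _)
    exact ProbabilityMeasure.tendsto_iff_tendsto_charFun.1 this.tendsto t
  simp_rw [h3] at h4
  have h5 : Tendsto (fun m => Complex.exp (-(t ^ 2 / 2 *
      (1 - ∑ s ∈ Finset.range m, b s ^ 2) : ℝ)) -
      Complex.exp (-(t ^ 2 / 2 * (1 - ∑' s, b s ^ 2) : ℝ))) atTop (𝓝 0) := by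
    rw [tendsto_sub_nhds_zero_iff]
    refine (Complex.continuous_exp.tendsto _).comp
      (((Complex.continuous_ofReal.tendsto _).comp ?_).neg)
    exact (hb.hasSum.tendsto_sum_nat.const_sub 1).const_mul _
  have h6 : Tendsto (fun m => (∏ s ∈ Finset.range m, chiChar (t * b s)) *
      (Complex.exp (-(t ^ 2 / 2 * (1 - ∑ s ∈ Finset.range m, b s ^ 2) : ℝ)) -
      Complex.exp (-(t ^ 2 / 2 * (1 - ∑' s, b s ^ 2) : ℝ)))) atTop (𝓝 0) := by
    have h7 := h5.norm
    rw [norm_zero] at h7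
    refine squeeze_zero_norm (fun m => ?_) h7
    rw [norm_mul, norm_prod]
    have hp : ∏ s ∈ Finset.range m, ‖chiChar (t * b s)‖ ≤ 1 :=
      Finset.prod_le_one (fun _ _ => norm_nonneg _) fun i _ => norm_chiChar_le _
    exact mul_le_of_le_one_left (norm_nonneg _) hp
  have := h4.add h6
  rw [add_zero] at this
  refine this.congr fun m => ?_
  ring

variable {Ω : ℕ → Type*} [∀ k, MeasurableSpace (Ω k)] {P : ∀ k, Measure (Ω k)}
  [∀ k, IsProbabilityMeasure (P k)]

lemma tendstoInDistribution_of_charFun {W : ∀ k, Ω k → ℝ} (hW : ∀ k, AEMeasurable (W k) (P k))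
    (hY : AEMeasurable Y P')
    (h : ∀ t, Tendsto (fun k => charFun ((P k).map (W k)) t) atTop (𝓝 (charFun (P'.map Y) t))) :
    TendstoInDistribution W atTop Y P P' :=
  ⟨hW, hY, ProbabilityMeasure.tendsto_of_tendsto_charFun h⟩

lemma IsLimitVariable.tendstoInDistribution (hY : IsLimitVariable P' b Y)
    {β : ℕ → ℕ → ℝ} {D : ℕ → ℕ} (h0 : ∀ k s, 0 ≤ β k s) (hanti : ∀ k, Antitone (β k))
    (hD : ∀ k s, D k ≤ s → β k s = 0) (hsum : ∀ k, ∑ s ∈ Finset.range (D k), β k s ^ 2 = 1)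
    (hb : ∀ s, Tendsto (fun k => β k s) atTop (𝓝 (b s))) {W : ∀ k, Ω k → ℝ}
    (hW : ∀ k, AEMeasurable (W k) (P k))
    (hWc : ∀ k t, charFun ((P k).map (W k)) t = ∏ s ∈ Finset.range (D k), chiChar (t * β k s)) :
    TendstoInDistribution W atTop Y P P' := by
  obtain ⟨hs1, hs2⟩ := summable_sq_limit_weights hD hsum hb
  refine tendstoInDistribution_of_charFun hW hY.aemeasurable fun t => ?_
  simp_rw [hWc]
  exact tendsto_prod_weights chiChar_zero norm_chiChar_le continuous_chiChar
    chiChar_sub_isLittleO h0 hanti hD hsum hb (hY.tendsto_charFun hs1 hs2 t)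

/-- Slutsky's lemma on varying probability spaces: characteristic functions differ by at most the
mean of `min 2 (|t| |W' - W|)`, which is bounded and small in probability. -/
lemma tendstoInDistribution_of_sub {W W' : ∀ k, Ω k → ℝ}
    (h : TendstoInDistribution W atTop Y P P') (hW' : ∀ k, AEMeasurable (W' k) (P k))
    (hd : TendstoZeroInProb P fun k ω => W' k ω - W k ω) :
    TendstoInDistribution W' atTop Y P P' := by
  refine tendstoInDistribution_of_charFun hW' h.aemeasurable_limit fun t => ?_
  have h1 := ProbabilityMeasure.tendsto_iff_tendsto_charFun.1 h.tendsto t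
  have hW := h.forall_aemeasurable
  have h2 : TendstoZeroInProb P fun k ω => min 2 (|t| * |W' k ω - W k ω|) := by
    refine hd.mono fun ε hε => ⟨ε / (|t| + 1), by positivity, fun k ω hk => ?_⟩
    rw [abs_of_nonneg (by positivity)]
    refine (min_le_right _ _).trans_lt ?_
    rw [lt_div_iff₀ (by positivity)] at hk
    nlinarith [abs_nonneg t, abs_nonneg (W' k ω - W k ω)]
  have hm : ∀ k, AEMeasurable (fun ω => min 2 (|t| * |W' k ω - W k ω|)) (P k) := fun k =>
    aemeasurable_const.min ((((hW' k).sub (hW k)).norm).const_mul _)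
  have hM : ∀ k ω, |min 2 (|t| * |W' k ω - W k ω|)| ≤ 2 := fun k ω => by
    rw [abs_of_nonneg (by positivity)]
    exact min_le_left _ _
  have h3 := h2.tendsto_integral hm hM
  have h4 : Tendsto (fun k => charFun ((P k).map (W' k)) t - charFun ((P k).map (W k)) t) atTop
      (𝓝 0) := by
    refine squeeze_zero_norm (fun k => ?_) h3
    have hi : ∀ V : Ω k → ℝ, AEMeasurable V (P k) →
        Integrable (fun ω => Complex.exp (t * V ω * Complex.I)) (P k) := fun V hV => by
      refine Integrable.of_bound (by fun_prop) 1 (ae_of_all _ fun ω => ?_)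
      rw [← Complex.ofReal_mul, Complex.norm_exp_ofReal_mul_I]
    rw [charFun_apply_real, charFun_apply_real, integral_map (hW' k) (by fun_prop),
      integral_map (hW k) (by fun_prop), ← integral_sub (hi _ (hW' k)) (hi _ (hW k))]
    refine (norm_integral_le_integral_norm _).trans (integral_mono
      ((hi _ (hW' k)).sub (hi _ (hW k))).norm (Integrable.of_bound (hm k).aestronglyMeasurable 2
        (ae_of_all _ fun ω => hM k ω)) fun ω => ?_)
    refine le_min ?_ ?_
    · refine (norm_sub_le _ _).trans (le_of_eq ?_)
      rw [← Complex.ofReal_mul, ← Complex.ofReal_mul, Complex.norm_exp_ofReal_mul_I,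
        Complex.norm_exp_ofReal_mul_I]
      norm_num
    · have e : Complex.exp (t * W' k ω * Complex.I) - Complex.exp (t * W k ω * Complex.I) =
          Complex.exp ((t * W k ω : ℝ) * Complex.I) *
            (Complex.exp (Complex.I * (t * (W' k ω - W k ω) : ℝ)) - 1) := by
        rw [mul_sub, ← Complex.exp_add, mul_one]
        push_cast
        ring_nf
      change ‖_ - _‖ ≤ _
      rw [e, norm_mul, Complex.norm_exp_ofReal_mul_I, one_mul, ← abs_mul, ← Real.norm_eq_abs]
      exact Real.norm_exp_I_mul_ofReal_sub_one_le
  have := h1.add h4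
  rw [add_zero] at this
  refine this.congr fun k => ?_
  simp

end Limit

/-! ### Random variables with moments of all orders -/

/-- All absolute moments of `f` are finite. -/
structure AllMoments {Ω : Type*} [MeasurableSpace Ω] (μ : Measure Ω) (f : Ω → ℝ) : Prop where
  aestronglyMeasurable : AEStronglyMeasurable f μ
  integrable_abs_pow : ∀ n : ℕ, Integrable (fun ω => |f ω| ^ n) μ

namespace AllMoments

variable {Ω : Type*} [MeasurableSpace Ω] {μ : Measure Ω} {f g : Ω → ℝ}

lemma integrable_pow (hf : AllMoments μ f) (n : ℕ) : Integrable (fun ω => f ω ^ n) μ :=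
  (hf.integrable_abs_pow n).mono' (hf.aestronglyMeasurable.pow n)
    (ae_of_all _ fun ω => by rw [norm_pow, Real.norm_eq_abs])

lemma integrable (hf : AllMoments μ f) : Integrable f μ := by
  simpa using hf.integrable_pow 1

lemma const [IsFiniteMeasure μ] (c : ℝ) : AllMoments μ fun _ => c :=
  ⟨aestronglyMeasurable_const, fun _ => integrable_const _⟩

lemma add (hf : AllMoments μ f) (hg : AllMoments μ g) : AllMoments μ fun ω => f ω + g ω := by
  refine ⟨hf.1.add hg.1, fun n => ?_⟩
  refine (((hf.2 n).add (hg.2 n)).const_mul (2 ^ (n - 1))).mono' ?_ (ae_of_all _ fun ω => ?_)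
  · have := ((hf.1.add hg.1).norm.pow n)
    exact this
  · rw [Real.norm_of_nonneg (by positivity)]
    exact (pow_le_pow_left₀ (abs_nonneg _) (abs_add_le _ _) n).trans
      (add_pow_le (abs_nonneg _) (abs_nonneg _) n)

lemma mul (hf : AllMoments μ f) (hg : AllMoments μ g) : AllMoments μ fun ω => f ω * g ω := by
  refine ⟨hf.1.mul hg.1, fun n => ?_⟩
  refine ((hf.2 (2 * n)).add (hg.2 (2 * n))).mono' ?_ (ae_of_all _ fun ω => ?_)
  · have := ((hf.1.mul hg.1).norm.pow n)
    exact this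
  · rw [Real.norm_of_nonneg (by positivity), abs_mul, mul_pow, Pi.add_apply, mul_comm 2 n, pow_mul,
      pow_mul]
    nlinarith [two_mul_le_add_sq (|f ω| ^ n) (|g ω| ^ n), sq_nonneg (|f ω| ^ n),
      sq_nonneg (|g ω| ^ n)]

lemma const_mul [IsFiniteMeasure μ] (hf : AllMoments μ f) (c : ℝ) :
    AllMoments μ fun ω => c * f ω := (const c).mul hf

lemma neg [IsFiniteMeasure μ] (hf : AllMoments μ f) : AllMoments μ fun ω => -f ω := by
  simpa using hf.const_mul (-1)

lemma sub [IsFiniteMeasure μ] (hf : AllMoments μ f) (hg : AllMoments μ g) :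
    AllMoments μ fun ω => f ω - g ω := by
  simpa [sub_eq_add_neg] using hf.add hg.neg

lemma pow [IsFiniteMeasure μ] (hf : AllMoments μ f) (n : ℕ) : AllMoments μ fun ω => f ω ^ n := by
  induction n with
  | zero => simpa using const 1
  | succ n ih => simpa [pow_succ] using ih.mul hf

lemma sum [IsFiniteMeasure μ] {ι : Type*} (s : Finset ι) {f : ι → Ω → ℝ}
    (hf : ∀ i ∈ s, AllMoments μ (f i)) : AllMoments μ fun ω => ∑ i ∈ s, f i ω := by
  classical
  induction s using Finset.induction_on with
  | empty => simpa using const 0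
  | insert a s ha ih =>
    simp only [Finset.sum_insert ha]
    exact (hf a (Finset.mem_insert_self a s)).add
      (ih fun i hi => hf i (Finset.mem_insert_of_mem hi))

lemma comp_hasLaw {Ω' : Type*} [MeasurableSpace Ω'] {ν : Measure Ω'} {X : Ω' → Ω}
    (hX : HasLaw X μ ν) (hf : AllMoments μ f) : AllMoments ν fun ω => f (X ω) := by
  obtain ⟨h1, h2⟩ := hf
  rw [← hX.map_eq] at h1 h2
  exact ⟨h1.comp_aemeasurable hX.aemeasurable, fun n => (h2 n).comp_aemeasurable hX.aemeasurable⟩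

lemma gaussianReal : AllMoments (gaussianReal 0 1) fun x => x := by
  refine ⟨by fun_prop, fun n => ?_⟩
  have := (integrable_pow_gaussianReal n).norm
  simpa using this

end AllMoments

/-! ### Moments of bilinear forms in standard normal vectors -/

section Moments

variable {ι : Type*} [Fintype ι]

/-- The standard normal distribution on `ι → ℝ`. -/
noncomputable abbrev stdPi (ι : Type*) [Fintype ι] : Measure (ι → ℝ) :=
  Measure.pi fun _ => gaussianReal 0 1

lemma hasLaw_eval_stdPi (i : ι) : HasLaw (fun g : ι → ℝ => g i) (gaussianReal 0 1) (stdPi ι) :=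
  (measurePreserving_eval (fun _ : ι => gaussianReal 0 1) i).hasLaw

lemma allMoments_eval_stdPi (i : ι) : AllMoments (stdPi ι) fun g => g i :=
  AllMoments.gaussianReal.comp_hasLaw (hasLaw_eval_stdPi i)

lemma hasLaw_linear_stdPi (c : ι → ℝ) : HasLaw (fun g : ι → ℝ => ∑ i, c i * g i)
    (gaussianReal 0 (∑ i, c i ^ 2).toNNReal) (stdPi ι) := by
  have hm : Measurable fun g : ι → ℝ => ∑ i, c i * g i := by fun_prop
  refine ⟨hm.aemeasurable, ?_⟩
  have : IsProbabilityMeasure ((stdPi ι).map fun g : ι → ℝ => ∑ i, c i * g i) :=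
    Measure.isProbabilityMeasure_map hm.aemeasurable
  refine Measure.ext_of_charFun ?_
  ext t
  rw [charFun_apply_real, integral_map hm.aemeasurable (by fun_prop), charFun_gaussianReal]
  have h1 : ∀ g : ι → ℝ, Complex.exp (t * (∑ i, c i * g i : ℝ) * Complex.I) =
      ∏ i, Complex.exp ((t * c i : ℝ) * g i * Complex.I) := by
    intro g
    rw [← Complex.exp_sum, Complex.ofReal_sum, Finset.mul_sum, Finset.sum_mul]
    congr 1
    refine Finset.sum_congr rfl fun i _ => ?_
    push_cast
    ring
  simp_rw [h1]
  rw [integral_fintype_prod_eq_prod (f := fun i (x : ℝ) =>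
    Complex.exp ((t * c i : ℝ) * x * Complex.I))]
  simp_rw [← charFun_apply_real, charFun_gaussianReal]
  rw [← Complex.exp_sum, Real.coe_toNNReal _ (Finset.sum_nonneg fun i _ => sq_nonneg _)]
  congr 1
  push_cast
  rw [Finset.sum_mul, Finset.sum_div]
  simp
  refine Finset.sum_congr rfl fun i _ => ?_
  ring

lemma integral_linear_pow_stdPi (c : ι → ℝ) (n : ℕ) :
    ∫ g, (∑ i, c i * g i) ^ (2 * n) ∂(stdPi ι) =
      (∑ i, c i ^ 2) ^ n * ∫ x, x ^ (2 * n) ∂(gaussianReal 0 1) := by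
  have h0 : 0 ≤ ∑ i, c i ^ 2 := Finset.sum_nonneg fun i _ => sq_nonneg _
  have h1 := (hasLaw_linear_stdPi c).integral_comp (f := fun x => x ^ (2 * n)) (by fun_prop)
  have h2 : gaussianReal 0 (∑ i, c i ^ 2).toNNReal =
      (gaussianReal 0 1).map (fun x => √(∑ i, c i ^ 2) * x) := by
    rw [gaussianReal_map_const_mul]
    congr 1
    · simp
    · ext
      simp [Real.sq_sqrt h0, h0]
  rw [h2, integral_map (by fun_prop) (by fun_prop)] at h1
  refine h1.trans ?_
  simp_rw [mul_pow]
  rw [integral_const_mul, pow_mul (√_), Real.sq_sqrt h0]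

lemma integral_mul_stdPi [DecidableEq ι] (i j : ι) :
    ∫ g, g i * g j ∂(stdPi ι) = if i = j then 1 else 0 := by
  split_ifs with h
  · subst h
    have := (hasLaw_eval_stdPi i).integral_comp (f := fun x => x ^ 2) (by fun_prop)
    rw [integral_sq_gaussianReal] at this
    rw [← this]
    refine integral_congr_ae (ae_of_all _ fun g => ?_)
    simp [sq]
  · have hi : IndepFun (fun g : ι → ℝ => g i) (fun g => g j) (stdPi ι) :=
      (iIndepFun_pi (X := fun _ x => x) (μ := fun _ : ι => gaussianReal 0 1)
        (fun _ => by fun_prop)).indepFun h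
    have := hi.integral_fun_mul_eq_mul_integral (allMoments_eval_stdPi i).1 (allMoments_eval_stdPi j).1
    rw [this, (hasLaw_eval_stdPi i).integral_eq, integral_id_gaussianReal, zero_mul]

lemma integral_sum_sq_sub_one_sq (w : ι → ℝ) :
    ∫ g, (∑ i, w i * (g i ^ 2 - 1)) ^ 2 ∂(stdPi ι) = 2 * ∑ i, w i ^ 2 := by
  have hA : AllMoments (gaussianReal 0 1) fun x => x ^ 2 - 1 :=
    (AllMoments.gaussianReal.pow 2).sub (AllMoments.const 1)
  have hm : ∀ i, ∫ x, w i * (x ^ 2 - 1) ∂(gaussianReal 0 1) = 0 := fun i => by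
    rw [integral_const_mul, integral_sq_sub_one_gaussianReal, mul_zero]
  have hL : ∀ i, MemLp (fun x => w i * (x ^ 2 - 1)) 2 (gaussianReal 0 1) := fun i =>
    (memLp_two_iff_integrable_sq (hA.const_mul (w i)).1).2 ((hA.const_mul (w i)).integrable_pow 2)
  have h := variance_sum_pi hL
  have hA2 : ∀ i, AllMoments (stdPi ι) fun g => w i * (g i ^ 2 - 1) := fun i =>
    (hA.const_mul (w i)).comp_hasLaw (X := fun g : ι → ℝ => g i) (hasLaw_eval_stdPi i)
  have hm2 : ∫ g, ∑ i, w i * (g i ^ 2 - 1) ∂(stdPi ι) = 0 := by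
    rw [integral_finsetSum _ fun i _ => (hA2 i).integrable]
    refine Finset.sum_eq_zero fun i _ => ?_
    have := (hasLaw_eval_stdPi i).integral_comp (f := fun x => w i * (x ^ 2 - 1)) (by fun_prop)
    exact this.trans (hm i)
  have e : (∑ i, fun g : ι → ℝ => w i * (g i ^ 2 - 1)) = fun g => ∑ i, w i * (g i ^ 2 - 1) := by
    ext g
    simp
  rw [e, variance_of_integral_eq_zero (AllMoments.sum _ fun i _ => hA2 i).1.aemeasurable hm2] at h
  rw [h, Finset.mul_sum]
  refine Finset.sum_congr rfl fun i _ => ?_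
  rw [variance_of_integral_eq_zero (by fun_prop) (hm i)]
  simp_rw [mul_pow]
  rw [integral_const_mul, integral_sq_sub_one_sq_gaussianReal, mul_comm]

/-- Jensen's inequality for the cube with the weights `p i / ∑ p`. The factor `(∑ p)²` restores
homogeneity. -/
lemma sum_mul_pow_three_le {p z : ι → ℝ} (hp : ∀ i, 0 ≤ p i) (hz : ∀ i, 0 ≤ z i) :
    (∑ i, p i * z i) ^ 3 ≤ (∑ i, p i) ^ 2 * ∑ i, p i * z i ^ 3 := by
  set S := ∑ i, p i with hS
  have hS0 : 0 ≤ S := Finset.sum_nonneg fun i _ => hp i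
  rcases hS0.eq_or_lt with h | h
  · have h0 : ∀ i, p i = 0 := fun i =>
      (Finset.sum_eq_zero_iff_of_nonneg fun i _ => hp i).1 h.symm i (Finset.mem_univ i)
    simp [h0]
  · have := Real.pow_arith_mean_le_arith_mean_pow Finset.univ (fun i => p i / S) z
      (fun i _ => div_nonneg (hp i) hS0) (by rw [← Finset.sum_div, ← hS, div_self h.ne'])
      (fun i _ => hz i) 3
    have e1 : ∑ i, p i / S * z i = (∑ i, p i * z i) / S := by
      rw [Finset.sum_div]
      exact Finset.sum_congr rfl fun i _ => by ring
    have e2 : ∑ i, p i / S * z i ^ 3 = (∑ i, p i * z i ^ 3) / S := by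
      rw [Finset.sum_div]
      exact Finset.sum_congr rfl fun i _ => by ring
    rw [e1, e2, div_pow, div_le_div_iff₀ (by positivity) h] at this
    have h2 : (∑ i, p i * z i) ^ 3 * S ≤ (S ^ 2 * ∑ i, p i * z i ^ 3) * S := by
      refine this.trans (le_of_eq (by ring))
    exact le_of_mul_le_mul_right h2 h

/-- The sixth moment of the standard normal distribution. -/
noncomputable def gaussMoment6 : ℝ := ∫ x, x ^ 6 ∂(gaussianReal 0 1)

lemma gaussMoment6_nonneg : 0 ≤ gaussMoment6 := integral_nonneg fun x => by positivity

/-- The constant depends neither on the number of coordinates nor on the weights; this makes the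
later bounds uniform in the dimensions. -/
lemma integral_quad_pow_three_le {p : ι → ℝ} (hp : ∀ i, 0 ≤ p i) :
    ∫ g, (∑ i, p i * g i ^ 2) ^ 3 ∂(stdPi ι) ≤ (∑ i, p i) ^ 3 * gaussMoment6 := by
  have hA : ∀ i, AllMoments (stdPi ι) fun g => p i * (g i ^ 2) ^ 3 := fun i =>
    (((allMoments_eval_stdPi i).pow 2).pow 3).const_mul _
  have hB : AllMoments (stdPi ι) fun g => ∑ i, p i * g i ^ 2 :=
    AllMoments.sum _ fun i _ => ((allMoments_eval_stdPi i).pow 2).const_mul _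
  refine (integral_mono (hB.integrable_pow 3)
    (((AllMoments.sum _ fun i _ => hA i).const_mul ((∑ i, p i) ^ 2)).integrable) fun g =>
      sum_mul_pow_three_le hp fun i => sq_nonneg (g i)).trans (le_of_eq ?_)
  rw [integral_const_mul, integral_finsetSum _ fun i _ => (hA i).integrable]
  have h : ∀ i, ∫ g, p i * (g i ^ 2) ^ 3 ∂(stdPi ι) = p i * gaussMoment6 := by
    intro i
    rw [integral_const_mul]
    have := (hasLaw_eval_stdPi i).integral_comp (f := fun x => x ^ 6) (by fun_prop)
    rw [gaussMoment6, ← this]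
    congr 1
    refine integral_congr_ae (ae_of_all _ fun g => ?_)
    simp [← pow_mul]
  simp_rw [h]
  rw [← Finset.sum_mul]
  ring

/-- A weighted inner product. -/
def wInner (v : ι → ℝ) (x y : ι → ℝ) : ℝ := ∑ i, v i * (x i * y i)

lemma allMoments_wInner {Ω : Type*} [MeasurableSpace Ω] {μ : Measure Ω} [IsFiniteMeasure μ]
    {X Y : Ω → ι → ℝ} (hX : ∀ i, AllMoments μ fun ω => X ω i)
    (hY : ∀ i, AllMoments μ fun ω => Y ω i) (v : ι → ℝ) :
    AllMoments μ fun ω => wInner v (X ω) (Y ω) :=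
  AllMoments.sum _ fun i _ => ((hX i).mul (hY i)).const_mul (v i)

lemma allMoments_fst (i : ι) : AllMoments ((stdPi ι).prod (stdPi ι)) fun g => g.1 i :=
  (allMoments_eval_stdPi i).comp_hasLaw (X := Prod.fst) measurePreserving_fst.hasLaw

lemma allMoments_snd (i : ι) : AllMoments ((stdPi ι).prod (stdPi ι)) fun g => g.2 i :=
  (allMoments_eval_stdPi i).comp_hasLaw (X := Prod.snd) measurePreserving_snd.hasLaw

/-- For a fixed first vector the form is linear in the second, hence centred normal with variance `∑
v i² g i²`. -/
lemma integral_wInner_pow (v : ι → ℝ) (n : ℕ) :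
    ∫ g, wInner v g.1 g.2 ^ (2 * n) ∂((stdPi ι).prod (stdPi ι)) =
      (∫ g, (∑ i, v i ^ 2 * g i ^ 2) ^ n ∂(stdPi ι)) * ∫ x, x ^ (2 * n) ∂(gaussianReal 0 1) := by
  rw [integral_prod _ ((allMoments_wInner allMoments_fst allMoments_snd v).integrable_pow _),
    ← integral_mul_const]
  refine integral_congr_ae (ae_of_all _ fun g => ?_)
  have : ∀ h : ι → ℝ, wInner v g h = ∑ i, (v i * g i) * h i := fun h =>
    Finset.sum_congr rfl fun i _ => by ring
  simp only [this]
  rw [integral_linear_pow_stdPi]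
  simp_rw [mul_pow]

lemma integral_wInner_sq (v : ι → ℝ) :
    ∫ g, wInner v g.1 g.2 ^ 2 ∂((stdPi ι).prod (stdPi ι)) = ∑ i, v i ^ 2 := by
  have h := integral_wInner_pow v 1
  rw [mul_one, integral_sq_gaussianReal, mul_one] at h
  simp only [pow_one] at h
  rw [h, integral_finsetSum _ fun i _ =>
    (((allMoments_eval_stdPi i).pow 2).const_mul (v i ^ 2)).integrable]
  refine Finset.sum_congr rfl fun i _ => ?_
  rw [integral_const_mul]
  have := (hasLaw_eval_stdPi i).integral_comp (f := fun x => x ^ 2) (by fun_prop)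
  rw [integral_sq_gaussianReal] at this
  refine (congrArg _ this).trans (mul_one _)

lemma integral_wInner_pow_six_le (v : ι → ℝ) :
    ∫ g, wInner v g.1 g.2 ^ 6 ∂((stdPi ι).prod (stdPi ι)) ≤
      gaussMoment6 ^ 2 * (∑ i, v i ^ 2) ^ 3 := by
  have h := integral_wInner_pow v 3
  refine (le_of_eq h).trans ?_
  refine (mul_le_mul_of_nonneg_right (integral_quad_pow_three_le fun i => sq_nonneg (v i))
    gaussMoment6_nonneg).trans (le_of_eq ?_)
  change (∑ i, v i ^ 2) ^ 3 * gaussMoment6 * gaussMoment6 = _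
  ring

lemma allMoments_eval_eval {r : ℕ} (a : Fin r) (i : ι) :
    AllMoments (Measure.pi fun _ : Fin r => stdPi ι) fun g => g a i :=
  (allMoments_eval_stdPi i).comp_hasLaw (X := fun g : Fin r → ι → ℝ => g a)
    (measurePreserving_eval (fun _ : Fin r => stdPi ι) a).hasLaw

lemma hasLaw_eval_pair {r : ℕ} {a b : Fin r} (hab : a ≠ b) :
    HasLaw (fun g : Fin r → ι → ℝ => (g a, g b)) ((stdPi ι).prod (stdPi ι))
      (Measure.pi fun _ : Fin r => stdPi ι) :=
  (indepFun_iff_hasLaw_prodMk_prod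
    (measurePreserving_eval (fun _ : Fin r => stdPi ι) a).hasLaw
    (measurePreserving_eval (fun _ : Fin r => stdPi ι) b).hasLaw).1
    ((iIndepFun_pi (X := fun _ x => x) (μ := fun _ : Fin r => stdPi ι)
        (fun _ => by fun_prop)).indepFun hab)

lemma integral_wInner_triple (v : ι → ℝ) :
    ∫ g, wInner v (g 0) (g 1) * wInner v (g 1) (g 2) * wInner v (g 2) (g 0)
      ∂(Measure.pi fun _ : Fin 3 => stdPi ι) = ∑ i, v i ^ 3 := by
  classical
  have hA := allMoments_eval_eval (ι := ι) (r := 3)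
  -- The six coordinates in each summand are grouped by vector, so that the integral factorizes over
  -- the independent vectors. The three Kronecker deltas then force `s = t = u`.
  have e : ∀ g : Fin 3 → ι → ℝ,
      wInner v (g 0) (g 1) * wInner v (g 1) (g 2) * wInner v (g 2) (g 0) =
      ∑ s, ∑ t, ∑ u, v s * v t * v u *
        ∏ a, (![fun x : ι → ℝ => x u * x s, fun x => x s * x t, fun x => x t * x u] a) (g a) := by
    intro g
    simp only [wInner, Finset.sum_mul, Finset.mul_sum]
    rw [Finset.sum_comm]
    refine (Finset.sum_congr rfl fun s _ => Finset.sum_comm).trans ?_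
    rw [Finset.sum_comm]
    refine Finset.sum_congr rfl fun s _ => ?_
    refine Finset.sum_congr rfl fun t _ => Finset.sum_congr rfl fun u _ => ?_
    simp [Fin.prod_univ_three]
    ring
  have hB : ∀ s t u, AllMoments (Measure.pi fun _ : Fin 3 => stdPi ι) fun g => v s * v t * v u *
        ∏ a, (![fun x : ι → ℝ => x u * x s, fun x => x s * x t, fun x => x t * x u] a) (g a) := by
    intro s t u
    simp only [Fin.prod_univ_three]
    exact ((((hA 0 u).mul (hA 0 s)).mul ((hA 1 s).mul (hA 1 t))).mul
      ((hA 2 t).mul (hA 2 u))).const_mul _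
  simp_rw [e]
  rw [integral_finsetSum _ fun s _ => (AllMoments.sum _ fun t _ => AllMoments.sum _ fun u _ =>
    hB s t u).integrable]
  refine Finset.sum_congr rfl fun s _ => ?_
  rw [integral_finsetSum _ fun t _ => (AllMoments.sum _ fun u _ => hB s t u).integrable]
  simp_rw [integral_finsetSum Finset.univ fun u _ => (hB s _ u).integrable, integral_const_mul,
    integral_fintype_prod_eq_prod, Fin.prod_univ_three]
  simp [integral_mul_stdPi]
  ring

end Moments

/-! ### Averages over injective index tuples -/

lemma card_embedding_apply_eq {m n : ℕ} (a : Fin m) (x y : Fin n) :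
    Finset.card {l : Fin m ↪ Fin n | l a = x} = Finset.card {l : Fin m ↪ Fin n | l a = y} := by
  refine Finset.card_bij (fun l _ => l.trans (Equiv.swap x y).toEmbedding) ?_ ?_ ?_
  · intro l hl
    simp only [Finset.mem_filter, Finset.mem_univ, true_and] at hl ⊢
    simp [hl]
  · intro l _ l' _ h
    ext i
    have : l i = l' i := by simpa using DFunLike.congr_fun h i
    rw [this]
  · intro l hl
    simp only [Finset.mem_filter, Finset.mem_univ, true_and] at hl
    refine ⟨l.trans (Equiv.swap x y).toEmbedding, by simp [hl], ?_⟩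
    ext i
    simp

/-- The tuples are partitioned by their entry at `a`; exchanging two values shows that all classes
have the same size. -/
lemma mul_card_embedding_apply_eq {m n : ℕ} (a : Fin m) (x : Fin n) :
    n * Finset.card {l : Fin m ↪ Fin n | l a = x} = Fintype.card (Fin m ↪ Fin n) := by
  have h := Finset.card_eq_sum_card_fiberwise (s := (Finset.univ : Finset (Fin m ↪ Fin n)))
    (t := (Finset.univ : Finset (Fin n))) (f := fun l => l a) (fun _ _ => Finset.mem_coe.2 (Finset.mem_univ _))
  rw [Finset.card_univ] at h
  rw [h, Finset.sum_congr rfl fun y _ => card_embedding_apply_eq a y x]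
  simp

/-- Two injective `m`-tuples from `n` indices rarely meet. -/
lemma sum_pairs_le {m n : ℕ} (hn : 0 < n) {M : ℝ} (hM : 0 ≤ M)
    (c : (Fin m ↪ Fin n) → (Fin m ↪ Fin n) → ℝ) (hc : ∀ l l', c l l' ≤ M)
    (hdisj : ∀ l l' : Fin m ↪ Fin n, (∀ a b, l a ≠ l' b) → c l l' = 0) :
    ∑ l, ∑ l', c l l' ≤ M * ((m : ℝ) ^ 2 / n) * (Fintype.card (Fin m ↪ Fin n) : ℝ) ^ 2 := by
  -- Union bound over the `m²` possible coincidences; each has relative frequency `1/n`.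
  have h1 : ∀ l l', c l l' ≤ ∑ a, ∑ b, if l' b = l a then M else 0 := by
    intro l l'
    by_cases h : ∀ a b, l a ≠ l' b
    · rw [hdisj l l' h]
      exact Finset.sum_nonneg fun a _ => Finset.sum_nonneg fun b _ => by split_ifs <;> simp [hM]
    · push Not at h
      obtain ⟨a, b, hab⟩ := h
      refine (hc l l').trans ?_
      have h2 : M = if l' b = l a then M else 0 := by rw [if_pos hab.symm]
      refine h2.le.trans ((Finset.single_le_sum (f := fun b => if l' b = l a then M else 0)
        (fun b _ => by split_ifs <;> simp [hM]) (Finset.mem_univ b)).trans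
        (Finset.single_le_sum (f := fun a => ∑ b, if l' b = l a then M else 0)
        (fun a _ => Finset.sum_nonneg fun b _ => by split_ifs <;> simp [hM]) (Finset.mem_univ a)))
  have h3 : ∀ l : Fin m ↪ Fin n, ∑ l', c l l' ≤
      M * ((m : ℝ) ^ 2 / n) * (Fintype.card (Fin m ↪ Fin n) : ℝ) := by
    intro l
    refine (Finset.sum_le_sum fun l' _ => h1 l l').trans (le_of_eq ?_)
    rw [Finset.sum_comm]
    have h4 : ∀ a b, (∑ l' : Fin m ↪ Fin n, if l' b = l a then M else 0) =
        M * ((Fintype.card (Fin m ↪ Fin n) : ℝ) / n) := by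
      intro a b
      rw [← Finset.sum_filter, Finset.sum_const, nsmul_eq_mul,
        ← mul_card_embedding_apply_eq b (l a)]
      push_cast
      have : (n : ℝ) ≠ 0 := by exact_mod_cast hn.ne'
      field_simp
    rw [Finset.sum_congr rfl fun a _ => (Finset.sum_comm.trans
      (Finset.sum_congr rfl fun b _ => h4 a b))]
    simp
    ring
  refine (Finset.sum_le_sum fun l _ => h3 l).trans (le_of_eq ?_)
  simp
  ring

/-! ### Mean squares of averages over random permutations and subsamples -/

section Mixing

set_option linter.unusedSectionVars false

variable {Ω : Type*} [MeasurableSpace Ω] {P : Measure Ω} [IsProbabilityMeasure P]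
  {𝒳 : Type*} [MeasurableSpace 𝒳] {X : Ω → 𝒳}

lemma sum_measureReal_fiber {κ : Type*} [Fintype κ] [MeasurableSpace κ]
    [DiscreteMeasurableSpace κ] {R : Ω → κ} (hR : AEMeasurable R P) :
    ∑ r, P.real (R ⁻¹' {r}) = 1 := by
  have : IsProbabilityMeasure (P.map R) := Measure.isProbabilityMeasure_map hR
  have h : ∀ r, P.real (R ⁻¹' {r}) = (P.map R).real {r} := fun r => by
    rw [map_measureReal_apply_of_aemeasurable hR (measurableSet_singleton r)]
  simp_rw [h]
  have := sum_measureReal_singleton (μ := P.map R) Finset.univ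
  rw [this]
  simp

/-- Conditioning on an independent random element with finitely many values reduces to a finite sum
over its values. -/
lemma integral_finite_mixture {κ : Type*} [Fintype κ] [MeasurableSpace κ]
    [DiscreteMeasurableSpace κ] {R : Ω → κ} (hR : AEMeasurable R P)
    (hXR : IndepFun X R P) {F : κ → 𝒳 → ℝ} (hF : ∀ r, Measurable (F r))
    (hi : ∀ r, Integrable (fun ω => F r (X ω)) P) :
    Integrable (fun ω => F (R ω) (X ω)) P ∧
      ∫ ω, F (R ω) (X ω) ∂P = ∑ r, P.real (R ⁻¹' {r}) * ∫ ω, F r (X ω) ∂P := by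
  classical
  have e : ∀ ω, F (R ω) (X ω) = ∑ r, (if R ω = r then 1 else 0) * F r (X ω) := by
    intro ω
    simp
  have hm : ∀ r : κ, Measurable fun x : κ => if x = r then (1 : ℝ) else 0 :=
    fun r => measurable_of_finite _
  have hmi : ∀ r : κ, Integrable (fun ω => if R ω = r then (1 : ℝ) else 0) P := fun r =>
    Integrable.of_bound ((hm r).comp_aemeasurable hR).aestronglyMeasurable 1
      (ae_of_all _ fun ω => by split_ifs <;> simp)
  have hind : ∀ r : κ, IndepFun (fun ω => if R ω = r then (1 : ℝ) else 0)
      (fun ω => F r (X ω)) P := fun r => hXR.symm.comp (hm r) (hF r)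
  have hint : ∀ r : κ, Integrable (fun ω => (if R ω = r then (1 : ℝ) else 0) * F r (X ω)) P :=
    fun r => (hind r).integrable_mul (hmi r) (hi r)
  simp_rw [e]
  refine ⟨integrable_finsetSum _ fun r _ => hint r, ?_⟩
  rw [integral_finsetSum _ fun r _ => hint r]
  refine Finset.sum_congr rfl fun r _ => ?_
  rw [(hind r).integral_fun_mul_eq_mul_integral (hmi r).1 (hi r).1]
  congr 1
  have hS : NullMeasurableSet (R ⁻¹' {r}) P :=
    hR.nullMeasurableSet_preimage (measurableSet_singleton r)
  have e2 : (fun ω => if R ω = r then (1 : ℝ) else 0) = (R ⁻¹' {r}).indicator fun _ => 1 := by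
    ext ω
    simp [Set.indicator_apply]
  rw [e2, integral_indicator₀ hS]
  simp

variable {ρ : Type*} [Fintype ρ] [MeasurableSpace ρ] [DiscreteMeasurableSpace ρ] {m n : ℕ}

/-- Centred kernels indexed by a finite parameter and by injective index tuples, with second
moments bounded by `M`, uncorrelated for disjoint tuples. -/
structure IsUKernel (P : Measure Ω) (X : Ω → 𝒳) (h : ρ → (Fin m ↪ Fin n) → 𝒳 → ℝ) (M : ℝ) :
    Prop where
  measurable : ∀ p l, Measurable (h p l)
  allMoments : ∀ p l, AllMoments P fun ω => h p l (X ω)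
  sq_le : ∀ p l, ∫ ω, h p l (X ω) ^ 2 ∂P ≤ M
  disjoint : ∀ p (l l' : Fin m ↪ Fin n), (∀ a b, l a ≠ l' b) →
    ∫ ω, h p l (X ω) * h p l' (X ω) ∂P = 0

namespace IsUKernel

variable {h : ρ → (Fin m ↪ Fin n) → 𝒳 → ℝ} {M : ℝ}

lemma mul_le (hU : IsUKernel P X h M) (p : ρ) (l l' : Fin m ↪ Fin n) :
    ∫ ω, h p l (X ω) * h p l' (X ω) ∂P ≤ M := by
  have h1 := (hU.allMoments p l).integrable_pow 2
  have h2 := (hU.allMoments p l').integrable_pow 2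
  have h3 : ∫ ω, h p l (X ω) * h p l' (X ω) ∂P ≤
      ∫ ω, (h p l (X ω) ^ 2 / 2 + h p l' (X ω) ^ 2 / 2) ∂P := by
    refine integral_mono ((hU.allMoments p l).mul (hU.allMoments p l')).integrable
      ((h1.div_const 2).add (h2.div_const 2)) fun ω => ?_
    have := two_mul_le_add_sq (h p l (X ω)) (h p l' (X ω))
    change _ * _ ≤ _ / 2 + _ / 2
    linarith
  rw [integral_add (h1.div_const 2) (h2.div_const 2), integral_div, integral_div] at h3
  linarith [hU.sq_le p l, hU.sq_le p l']

lemma sum_pairs (hU : IsUKernel P X h M) (hn : 0 < n) (hM : 0 ≤ M) (p : ρ) :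
    ∑ l, ∑ l', ∫ ω, h p l (X ω) * h p l' (X ω) ∂P ≤
      M * ((m : ℝ) ^ 2 / n) * (Fintype.card (Fin m ↪ Fin n) : ℝ) ^ 2 :=
  sum_pairs_le hn hM _ (hU.mul_le p) (hU.disjoint p)

/-- The average of the kernel over all tuples. -/
noncomputable def avg (h : ρ → (Fin m ↪ Fin n) → 𝒳 → ℝ) (p : ρ) (x : 𝒳) : ℝ :=
  (Fintype.card (Fin m ↪ Fin n) : ℝ)⁻¹ * ∑ l, h p l x

lemma allMoments_avg (hU : IsUKernel P X h M) (p : ρ) : AllMoments P fun ω => avg h p (X ω) :=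
  (AllMoments.sum _ fun l _ => hU.allMoments p l).const_mul _

lemma measurable_avg (hU : IsUKernel P X h M) (p : ρ) : Measurable (avg h p) :=
  (Finset.measurable_sum _ fun l _ => hU.measurable p l).const_mul _

/-- If there are no tuples then `c = 0`, and `0⁻¹ = 0` keeps the bound valid. -/
lemma inv_card_sq_mul_le {c B : ℝ} (hB : 0 ≤ B) : c⁻¹ ^ 2 * (B * c ^ 2) ≤ B := by
  rcases eq_or_ne c 0 with rfl | hc
  · simpa using hB
  · have : c⁻¹ ^ 2 * (B * c ^ 2) = B := by field_simp
    exact this.le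

lemma integral_avg_sq_le (hU : IsUKernel P X h M) (hn : 0 < n) (hM : 0 ≤ M) (p : ρ) :
    ∫ ω, avg h p (X ω) ^ 2 ∂P ≤ M * ((m : ℝ) ^ 2 / n) := by
  have e : ∀ ω, avg h p (X ω) ^ 2 = (Fintype.card (Fin m ↪ Fin n) : ℝ)⁻¹ ^ 2 *
      ∑ l, ∑ l', h p l (X ω) * h p l' (X ω) := fun ω => by
    rw [avg, mul_pow, sq (∑ l, _), Finset.sum_mul_sum]
  simp_rw [e]
  have hi : ∀ l l', AllMoments P fun ω => h p l (X ω) * h p l' (X ω) := fun l l' =>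
    (hU.allMoments p l).mul (hU.allMoments p l')
  rw [integral_const_mul, integral_finsetSum _ fun l _ =>
    (AllMoments.sum _ fun l' _ => hi l l').integrable]
  simp_rw [integral_finsetSum Finset.univ fun l' _ => (hi _ l').integrable]
  exact (mul_le_mul_of_nonneg_left (hU.sum_pairs hn hM p) (by positivity)).trans
    (inv_card_sq_mul_le (by positivity))

/-- The bound for a fixed parameter is uniform, so it survives any random choice of the parameter
that is independent of the data. -/
lemma avg_sq (hU : IsUKernel P X h M) (hn : 0 < n) (hM : 0 ≤ M)
    {τ : Ω → ρ} (hτ : AEMeasurable τ P) (hXτ : IndepFun X τ P) :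
    Integrable (fun ω => avg h (τ ω) (X ω) ^ 2) P ∧
      ∫ ω, avg h (τ ω) (X ω) ^ 2 ∂P ≤ M * ((m : ℝ) ^ 2 / n) := by
  obtain ⟨h1, h2⟩ := integral_finite_mixture hτ hXτ (F := fun p x => avg h p x ^ 2)
    (fun p => (hU.measurable_avg p).pow_const 2) (fun p => (hU.allMoments_avg p).integrable_pow 2)
  refine ⟨h1, h2.le.trans ?_⟩
  refine (Finset.sum_le_sum fun p _ => mul_le_mul_of_nonneg_left
    (hU.integral_avg_sq_le hn hM p) measureReal_nonneg).trans (le_of_eq ?_)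
  rw [← Finset.sum_mul, sum_measureReal_fiber hτ, one_mul]

end IsUKernel

lemma sq_average_le (υ : ℕ) (A : ℕ → ℝ) :
    ((υ : ℝ)⁻¹ * ∑ j ∈ Finset.range υ, A j) ^ 2 ≤ (υ : ℝ)⁻¹ * ∑ j ∈ Finset.range υ, A j ^ 2 := by
  rcases Nat.eq_zero_or_pos υ with rfl | hυ
  · simp
  · have h := sq_sum_le_card_mul_sum_sq (s := Finset.range υ) (f := A)
    rw [Finset.card_range] at h
    have hp : (0 : ℝ) < υ := by exact_mod_cast hυ
    rw [mul_pow]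
    calc _ ≤ (υ : ℝ)⁻¹ ^ 2 * (υ * ∑ j ∈ Finset.range υ, A j ^ 2) :=
          mul_le_mul_of_nonneg_left h (by positivity)
      _ = _ := by field_simp

/-- Convexity of the square: whatever the dependence between the terms, averaging does not exceed
their common bound. This is why the number of permutations is arbitrary. -/
lemma integral_sq_average_le {υ : ℕ} {A : ℕ → Ω → ℝ} {B : ℝ} (hB : 0 ≤ B)
    (hAm : ∀ j, AEStronglyMeasurable (A j) P)
    (hA : ∀ j, Integrable (fun ω => A j ω ^ 2) P) (hAB : ∀ j, ∫ ω, A j ω ^ 2 ∂P ≤ B) :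
    Integrable (fun ω => ((υ : ℝ)⁻¹ * ∑ j ∈ Finset.range υ, A j ω) ^ 2) P ∧
      ∫ ω, ((υ : ℝ)⁻¹ * ∑ j ∈ Finset.range υ, A j ω) ^ 2 ∂P ≤ B := by
  have hi : Integrable (fun ω => (υ : ℝ)⁻¹ * ∑ j ∈ Finset.range υ, A j ω ^ 2) P :=
    (integrable_finsetSum _ fun j _ => hA j).const_mul _
  have hi2 : Integrable (fun ω => ((υ : ℝ)⁻¹ * ∑ j ∈ Finset.range υ, A j ω) ^ 2) P := by
    refine hi.mono' ?_ (ae_of_all _ fun ω => ?_)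
    · exact ((Finset.aestronglyMeasurable_fun_sum _ fun j _ => hAm j).const_mul _).pow 2
    · rw [Real.norm_of_nonneg (sq_nonneg _)]
      exact sq_average_le υ fun j => A j ω
  refine ⟨hi2, (integral_mono hi2 hi fun ω => sq_average_le υ fun j => A j ω).trans ?_⟩
  rw [integral_const_mul, integral_finsetSum _ fun j _ => hA j]
  refine (mul_le_mul_of_nonneg_left (Finset.sum_le_sum fun j _ => hAB j) (by positivity)).trans ?_
  rcases Nat.eq_zero_or_pos υ with rfl | hυ
  · simpa using hB
  · simp only [Finset.sum_const, Finset.card_range, nsmul_eq_mul]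
    rw [inv_mul_cancel_left₀ (by exact_mod_cast hυ.ne')]

lemma measureReal_fiber_uniform {κ : Type*} [Fintype κ] [MeasurableSpace κ]
    [DiscreteMeasurableSpace κ] {R : Ω → κ} (hR : HasLaw R (uniformOn Set.univ) P) (r : κ) :
    P.real (R ⁻¹' {r}) = (Fintype.card κ : ℝ)⁻¹ := by
  have h : P.real (R ⁻¹' {r}) = (P.map R).real {r} := by
    rw [map_measureReal_apply_of_aemeasurable hR.aemeasurable (measurableSet_singleton r)]
  rw [h, hR.map_eq, Measure.real, uniformOn_univ]
  simp

/-- In the expanded square the `υ` diagonal terms contribute at most `M/υ`. Off the diagonal the two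
tuples are independent and uniform, so the expectation is the average over all pairs of tuples,
which rarely meet. -/
lemma IsUKernel.subsample_sq {h : ρ → (Fin m ↪ Fin n) → 𝒳 → ℝ} {M : ℝ}
    (hU : IsUKernel P X h M) (hn : 0 < n) (hM : 0 ≤ M)
    {τ : Ω → ρ} (hτ : AEMeasurable τ P) {σ : ℕ → Ω → (Fin m ↪ Fin n)}
    (hσ : ∀ u, HasLaw (σ u) (uniformOn Set.univ) P)
    (hσi : ∀ u v, u ≠ v → IndepFun (σ u) (σ v) P)
    (hτσ : ∀ u v, IndepFun τ (fun ω => (σ u ω, σ v ω)) P)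
    (hXR : ∀ u v, IndepFun X (fun ω => (τ ω, σ u ω, σ v ω)) P) {υ : ℕ} (hυ : 0 < υ) :
    AEStronglyMeasurable (fun ω => (υ : ℝ)⁻¹ * ∑ u ∈ Finset.range υ, h (τ ω) (σ u ω) (X ω)) P ∧
    Integrable (fun ω => ((υ : ℝ)⁻¹ * ∑ u ∈ Finset.range υ, h (τ ω) (σ u ω) (X ω)) ^ 2) P ∧
      ∫ ω, ((υ : ℝ)⁻¹ * ∑ u ∈ Finset.range υ, h (τ ω) (σ u ω) (X ω)) ^ 2 ∂P ≤
        M * ((υ : ℝ)⁻¹ + (m : ℝ) ^ 2 / n) := by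
  set K := (Fintype.card (Fin m ↪ Fin n) : ℝ) with hK
  have hRm : ∀ u v, AEMeasurable (fun ω => (τ ω, σ u ω, σ v ω)) P := fun u v =>
    hτ.prodMk ((hσ u).aemeasurable.prodMk (hσ v).aemeasurable)
  have hmix := fun u v => integral_finite_mixture (hRm u v) (hXR u v)
    (F := fun r x => h r.1 r.2.1 x * h r.1 r.2.2 x)
    (fun r => (hU.measurable _ _).mul (hU.measurable _ _))
    (fun r => ((hU.allMoments _ _).mul (hU.allMoments _ _)).integrable)
  have hdiag : ∀ u v, ∫ ω, h (τ ω) (σ u ω) (X ω) * h (τ ω) (σ v ω) (X ω) ∂P ≤ M := by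
    intro u v
    refine (hmix u v).2.le.trans ?_
    refine (Finset.sum_le_sum fun r _ => mul_le_mul_of_nonneg_left
      (hU.mul_le r.1 r.2.1 r.2.2) measureReal_nonneg).trans (le_of_eq ?_)
    rw [← Finset.sum_mul, sum_measureReal_fiber (hRm u v), one_mul]
  have hoff : ∀ u v, u ≠ v →
      ∫ ω, h (τ ω) (σ u ω) (X ω) * h (τ ω) (σ v ω) (X ω) ∂P ≤ M * ((m : ℝ) ^ 2 / n) := by
    intro u v huv
    refine (hmix u v).2.le.trans ?_
    -- Independence of the parameter and the two subsamples gives every pair of tuples the same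
    -- weight `K⁻²`, turning the mixture into the double sum of `sum_pairs`.
    have hp : ∀ p l l', P.real ((fun ω => (τ ω, σ u ω, σ v ω)) ⁻¹' {(p, l, l')}) =
        P.real (τ ⁻¹' {p}) * K⁻¹ ^ 2 := by
      intro p l l'
      have e1 : (fun ω => (τ ω, σ u ω, σ v ω)) ⁻¹' {(p, l, l')} =
          τ ⁻¹' {p} ∩ (fun ω => (σ u ω, σ v ω)) ⁻¹' {(l, l')} := by
        ext ω
        simp
      have e2 : (fun ω => (σ u ω, σ v ω)) ⁻¹' {(l, l')} = σ u ⁻¹' {l} ∩ σ v ⁻¹' {l'} := by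
        ext ω
        simp
      rw [e1, Measure.real, (hτσ u v).measure_inter_preimage_eq_mul _ _
        (measurableSet_singleton _) (measurableSet_singleton _), e2,
        (hσi u v huv).measure_inter_preimage_eq_mul _ _
        (measurableSet_singleton _) (measurableSet_singleton _), ENNReal.toReal_mul,
        ENNReal.toReal_mul]
      change P.real _ * (P.real _ * P.real _) = _
      rw [measureReal_fiber_uniform (hσ u), measureReal_fiber_uniform (hσ v), sq]
    rw [Fintype.sum_prod_type]
    simp_rw [Fintype.sum_prod_type, hp, ← Finset.mul_sum]
    have hb : ∀ p, P.real (τ ⁻¹' {p}) * K⁻¹ ^ 2 *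
        ∑ l, ∑ l', ∫ ω, h p l (X ω) * h p l' (X ω) ∂P ≤
        P.real (τ ⁻¹' {p}) * (M * ((m : ℝ) ^ 2 / n)) := by
      intro p
      rw [mul_assoc]
      exact mul_le_mul_of_nonneg_left ((mul_le_mul_of_nonneg_left (hU.sum_pairs hn hM p)
        (by positivity)).trans (inv_card_sq_mul_le (by positivity))) measureReal_nonneg
    refine (Finset.sum_le_sum fun p _ => hb p).trans (le_of_eq ?_)
    rw [← Finset.sum_mul, sum_measureReal_fiber hτ, one_mul]
  have hpos : (0 : ℝ) < υ := by exact_mod_cast hυ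
  have e : ∀ ω, ((υ : ℝ)⁻¹ * ∑ u ∈ Finset.range υ, h (τ ω) (σ u ω) (X ω)) ^ 2 =
      (υ : ℝ)⁻¹ ^ 2 * ∑ u ∈ Finset.range υ, ∑ v ∈ Finset.range υ,
        h (τ ω) (σ u ω) (X ω) * h (τ ω) (σ v ω) (X ω) := fun ω => by
    rw [mul_pow, sq (∑ u ∈ _, _), Finset.sum_mul_sum]
  have hsm : ∀ u, AEStronglyMeasurable (fun ω => h (τ ω) (σ u ω) (X ω)) P := fun u =>
    (integral_finite_mixture (hRm u u) (hXR u u) (F := fun r x => h r.1 r.2.1 x)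
      (fun r => hU.measurable _ _) (fun r => (hU.allMoments _ _).integrable)).1.1
  refine ⟨(Finset.aestronglyMeasurable_fun_sum _ fun u _ => hsm u).const_mul _, ?_, ?_⟩
  · simp_rw [e]
    exact (integrable_finsetSum _ fun u _ => integrable_finsetSum _ fun v _ =>
      (hmix u v).1).const_mul _
  · simp_rw [e]
    rw [integral_const_mul, integral_finsetSum _ fun u _ =>
      integrable_finsetSum _ fun v _ => (hmix u v).1]
    simp_rw [integral_finsetSum (Finset.range υ) fun v _ => (hmix _ v).1]
    have hrow : ∀ u ∈ Finset.range υ, ∑ v ∈ Finset.range υ,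
        ∫ ω, h (τ ω) (σ u ω) (X ω) * h (τ ω) (σ v ω) (X ω) ∂P ≤
        M + υ * (M * ((m : ℝ) ^ 2 / n)) := by
      intro u hu
      have hB : 0 ≤ M * ((m : ℝ) ^ 2 / n) := by positivity
      have h1 : ∀ v ∈ Finset.range υ, ∫ ω, h (τ ω) (σ u ω) (X ω) * h (τ ω) (σ v ω) (X ω) ∂P ≤
          (if v = u then M else 0) + M * ((m : ℝ) ^ 2 / n) := by
        intro v _
        split_ifs with hvu
        · exact (hdiag u v).trans (by linarith)
        · exact (hoff u v (Ne.symm hvu)).trans (by linarith)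
      refine (Finset.sum_le_sum h1).trans (le_of_eq ?_)
      rw [Finset.sum_add_distrib, Finset.sum_ite_eq' _ _ _, if_pos hu]
      simp
    refine (mul_le_mul_of_nonneg_left (Finset.sum_le_sum hrow) (by positivity)).trans
      (le_of_eq ?_)
    simp only [Finset.sum_const, Finset.card_range, nsmul_eq_mul]
    field_simp

end Mixing

/-! ### Diagonalization of the quadratic form -/

namespace Design

variable (E : Design)

lemma N_pos (i : E.Ix) : 0 < E.N :=
  (show 0 < E.n i.1 by linarith [E.six_le_n i.1]).trans_le
    (Finset.single_le_sum (f := E.n) (fun _ _ => Nat.zero_le _) (Finset.mem_univ i.1))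

lemma n_pos (i : Fin E.a) : 0 < E.n i := by linarith [E.six_le_n i]

lemma exists_index : Nonempty E.Ix := by
  by_contra h
  rw [not_nonempty_iff] at h
  exact E.T_ne_zero (Subsingleton.elim _ _)

lemma dotProduct_V_mulVec (x : E.Ix → ℝ) : x ⬝ᵥ E.V *ᵥ x =
    ∑ i, ((E.N : ℝ) / E.n i) * ((fun a => x ⟨i, a⟩) ⬝ᵥ E.S i *ᵥ fun a => x ⟨i, a⟩) := by
  simp only [dotProduct, mulVec, Fintype.sum_sigma, Finset.mul_sum]
  refine Finset.sum_congr rfl fun i _ => Finset.sum_congr rfl fun a _ => ?_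
  rw [Finset.sum_eq_single i]
  · refine Finset.sum_congr rfl fun b _ => ?_
    rw [V, blockDiagonal'_apply_eq, Matrix.smul_apply, smul_eq_mul]
    ring
  · intro j _ hj
    refine Finset.sum_eq_zero fun b _ => ?_
    rw [V, blockDiagonal'_apply_ne _ _ _ hj.symm]
    ring
  · simp

lemma V_isHermitian : E.V.IsHermitian := by
  unfold Matrix.IsHermitian V
  rw [Matrix.blockDiagonal'_conjTranspose]
  congr 1
  funext i
  rw [Matrix.conjTranspose_smul, (E.S_posDef i).isHermitian.eq]
  simp

lemma V_posDef : E.V.PosDef := by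
  refine PosDef.of_dotProduct_mulVec_pos E.V_isHermitian fun x hx => ?_
  rw [star_trivial, dotProduct_V_mulVec]
  obtain ⟨p, hp⟩ := Function.ne_iff.1 hx
  have hN : (0 : ℝ) < E.N := by exact_mod_cast E.N_pos p
  have hn : ∀ i, (0 : ℝ) < E.n i := fun i => by exact_mod_cast E.n_pos i
  have hS : ∀ i, 0 ≤ ((fun a => x ⟨i, a⟩) ⬝ᵥ E.S i *ᵥ fun a => x ⟨i, a⟩) := fun i => by
    simpa using (E.S_posDef i).posSemidef.dotProduct_mulVec_nonneg fun a => x ⟨i, a⟩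
  refine Finset.sum_pos' (fun i _ => mul_nonneg (div_pos hN (hn i)).le (hS i))
    ⟨p.1, Finset.mem_univ _, mul_pos (div_pos hN (hn _)) ?_⟩
  have := (E.S_posDef p.1).dotProduct_mulVec_pos (x := fun a => x ⟨p.1, a⟩)
    (Function.ne_iff.2 ⟨p.2, hp⟩)
  simpa using this

/-- The eigenvalues of `T V T`. -/
noncomputable def lam (i : E.Ix) : ℝ := E.isHermitian_TVT.eigenvalues i

/-- The matrix mapping a vector to the coordinates of its image under `T` with respect to an
orthonormal basis of eigenvectors of `T V T`. -/
noncomputable def coord : Matrix E.Ix E.Ix ℝ :=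
  star (E.isHermitian_TVT.eigenvectorUnitary : Matrix E.Ix E.Ix ℝ) * E.T

lemma coord_transpose_mul : E.coordᵀ * E.coord = E.T := by
  have h : (E.isHermitian_TVT.eigenvectorUnitary : Matrix E.Ix E.Ix ℝ) *
      star (E.isHermitian_TVT.eigenvectorUnitary : Matrix E.Ix E.Ix ℝ) = 1 :=
    Unitary.coe_mul_star_self _
  rw [coord, transpose_mul, E.T_symm.eq, star_eq_conjTranspose,
    conjTranspose_eq_transpose_of_trivial, transpose_transpose, Matrix.mul_assoc,
    ← Matrix.mul_assoc _ _ E.T]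
  rw [star_eq_conjTranspose, conjTranspose_eq_transpose_of_trivial] at h
  rw [h, Matrix.one_mul, E.T_idem]

/-- Since `coord V coordᵀ = Uᵀ (T V T) U`, a vector with covariance `V` has uncorrelated coordinates
with variances `λ`. -/
lemma coord_mul_V_mul : E.coord * E.V * E.coordᵀ = diagonal E.lam := by
  have h := E.isHermitian_TVT.conjStarAlgAut_star_eigenvectorUnitary
  rw [Unitary.conjStarAlgAut_star_apply] at h
  rw [coord, transpose_mul, E.T_symm.eq, star_eq_conjTranspose,
    conjTranspose_eq_transpose_of_trivial, transpose_transpose]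
  rw [star_eq_conjTranspose, conjTranspose_eq_transpose_of_trivial] at h
  rw [← show diagonal (RCLike.ofReal ∘ E.isHermitian_TVT.eigenvalues) = diagonal E.lam from rfl,
    ← h]
  simp only [Matrix.mul_assoc]

lemma dotProduct_T_mulVec (x y : E.Ix → ℝ) :
    x ⬝ᵥ E.T *ᵥ y = ∑ i, (E.coord *ᵥ x) i * (E.coord *ᵥ y) i := by
  rw [← E.coord_transpose_mul, ← mulVec_mulVec, dotProduct_mulVec, vecMul_transpose]
  rfl

lemma coord_mulVec_eq_zero {x : E.Ix → ℝ} (h : E.T *ᵥ x = 0) : E.coord *ᵥ x = 0 := by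
  rw [coord, ← mulVec_mulVec, h, mulVec_zero]

lemma lam_nonneg (i : E.Ix) : 0 ≤ E.lam i := by
  have h := (E.V_posDef.posSemidef.mul_mul_conjTranspose_same E.coord).diag_nonneg (i := i)
  rwa [conjTranspose_eq_transpose_of_trivial, coord_mul_V_mul, diagonal_apply_eq] at h

/-- If all eigenvalues vanished, positive definiteness of `V` would force every row of `coord` to be
zero, hence `T = coordᵀ coord = 0`. -/
lemma sum_lam_sq_pos : 0 < ∑ i, E.lam i ^ 2 := by
  refine (Finset.sum_nonneg fun i _ => sq_nonneg _).lt_of_ne fun h => E.T_ne_zero ?_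
  have h0 : ∀ i, E.lam i = 0 := fun i => by
    have := (Finset.sum_eq_zero_iff_of_nonneg fun i _ => sq_nonneg (E.lam i)).1 h.symm i
      (Finset.mem_univ i)
    exact pow_eq_zero_iff two_ne_zero |>.1 this
  have hrow : ∀ i, E.coord i = 0 := fun i => by
    by_contra hi
    have h1 := E.V_posDef.dotProduct_mulVec_pos hi
    have h2 := congr_fun (congr_fun E.coord_mul_V_mul i) i
    rw [diagonal_apply_eq, h0] at h2
    rw [star_trivial] at h1
    refine h1.ne' ?_
    rw [← h2, Matrix.mul_assoc]
    simp only [Matrix.mul_apply, dotProduct, mulVec, transpose_apply]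
  rw [← E.coord_transpose_mul, show E.coord = 0 from funext hrow, Matrix.mul_zero]

/-- With `T = coordᵀ coord` the factors regroup, and cyclicity of the trace leaves a power of `coord
V coordᵀ`, which is diagonal. -/
lemma trace_pow (r : ℕ) : ((E.T * E.V) ^ (r + 1)).trace = ∑ i, E.lam i ^ (r + 1) := by
  have h1 : ∀ r, (E.T * E.V) ^ (r + 1) = E.coordᵀ * ((E.coord * E.V * E.coordᵀ) ^ r *
      (E.coord * E.V)) := by
    intro r
    induction r with
    | zero => rw [zero_add, pow_one, pow_zero, Matrix.one_mul, ← Matrix.mul_assoc,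
        coord_transpose_mul]
    | succ r ih =>
      rw [pow_succ, ih, pow_succ, ← E.coord_transpose_mul]
      simp only [Matrix.mul_assoc]
  rw [h1, trace_mul_comm, Matrix.mul_assoc, ← pow_succ, coord_mul_V_mul, diagonal_pow,
    trace_diagonal]
  rfl

/-- Links the ordered eigenvalues to those indexed by coordinates. Symmetric expressions may then be
computed over either index set. -/
lemma β_eq (s : Fin (Fintype.card E.Ix)) : E.β s =
    E.lam (Fintype.equivOfCardEq (Fintype.card_fin _) s) / √(∑ i, E.lam i ^ 2) := by
  have h : ∀ t : Fin (Fintype.card E.Ix), E.isHermitian_TVT.eigenvalues₀ t =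
      E.lam (Fintype.equivOfCardEq (Fintype.card_fin _) t) := fun t => by
    simp [lam, Matrix.IsHermitian.eigenvalues]
  simp only [β, s.2, dif_pos, h]
  congr 2
  exact Equiv.sum_comp _ fun i => E.lam i ^ 2

lemma sum_range_β (F : ℝ → ℝ) : ∑ s ∈ Finset.range (Fintype.card E.Ix), F (E.β s) =
    ∑ i, F (E.lam i / √(∑ i, E.lam i ^ 2)) := by
  rw [Finset.sum_range]
  simp_rw [β_eq]
  exact Equiv.sum_comp _ fun i => F (E.lam i / √(∑ i, E.lam i ^ 2))

lemma prod_range_β (F : ℝ → ℂ) : ∏ s ∈ Finset.range (Fintype.card E.Ix), F (E.β s) =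
    ∏ i, F (E.lam i / √(∑ i, E.lam i ^ 2)) := by
  rw [Finset.prod_range]
  simp_rw [β_eq]
  exact Equiv.prod_comp _ fun i => F (E.lam i / √(∑ i, E.lam i ^ 2))

lemma β_of_card_le {s : ℕ} (h : Fintype.card E.Ix ≤ s) : E.β s = 0 := by
  simp only [β, h.not_gt, dif_neg, not_false_eq_true]

lemma β_nonneg (s : ℕ) : 0 ≤ E.β s := by
  rcases lt_or_ge s (Fintype.card E.Ix) with h | h
  · rw [show s = ((⟨s, h⟩ : Fin (Fintype.card E.Ix)) : ℕ) from rfl, β_eq]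
    exact div_nonneg (E.lam_nonneg _) (Real.sqrt_nonneg _)
  · rw [E.β_of_card_le h]

lemma β_antitone : Antitone E.β := by
  intro s t hst
  rcases lt_or_ge t (Fintype.card E.Ix) with h | h
  · simp only [β, h, hst.trans_lt h, dif_pos]
    exact div_le_div_of_nonneg_right
      (E.isHermitian_TVT.eigenvalues₀_antitone (Fin.mk_le_mk.2 hst)) (Real.sqrt_nonneg _)
  · rw [E.β_of_card_le h]
    exact E.β_nonneg s

lemma sum_β_sq : ∑ s ∈ Finset.range (Fintype.card E.Ix), E.β s ^ 2 = 1 := by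
  rw [E.sum_range_β fun x => x ^ 2]
  simp_rw [div_pow, Real.sq_sqrt E.sum_lam_sq_pos.le]
  rw [← Finset.sum_div, div_self E.sum_lam_sq_pos.ne']

lemma sum_β_cube : ∑ s ∈ Finset.range (Fintype.card E.Ix), E.β s ^ 3 =
    (∑ i, E.lam i ^ 3) / √(∑ i, E.lam i ^ 2) ^ 3 := by
  rw [E.sum_range_β fun x => x ^ 3]
  simp_rw [div_pow]
  rw [Finset.sum_div]

lemma one_div_fP : 1 / E.fP = (∑ s ∈ Finset.range (Fintype.card E.Ix), E.β s ^ 3) ^ 2 := by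
  rw [sum_β_cube, fP, E.trace_pow 1, E.trace_pow 2, one_div_div, div_pow, ← pow_mul, mul_comm 3 2,
    pow_mul, Real.sq_sqrt E.sum_lam_sq_pos.le]

lemma β_zero_le_one : E.β 0 ≤ 1 := by
  have h0 : 0 < Fintype.card E.Ix := Fintype.card_pos_iff.2 E.exists_index
  have h := Finset.single_le_sum (f := fun s => E.β s ^ 2) (fun _ _ => sq_nonneg _)
    (Finset.mem_range.2 h0)
  rw [sum_β_sq] at h
  exact (sq_le_one_iff₀ (E.β_nonneg 0)).1 h

lemma β_zero_cube_le : E.β 0 ^ 3 ≤ ∑ s ∈ Finset.range (Fintype.card E.Ix), E.β s ^ 3 := by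
  have h0 : 0 < Fintype.card E.Ix := Fintype.card_pos_iff.2 E.exists_index
  exact Finset.single_le_sum (f := fun s => E.β s ^ 3) (fun s _ => pow_nonneg (E.β_nonneg s) 3)
    (Finset.mem_range.2 h0)

/-- One factor of each cube is bounded by the largest weight; the squares sum to one. -/
lemma sum_β_cube_le : ∑ s ∈ Finset.range (Fintype.card E.Ix), E.β s ^ 3 ≤ E.β 0 := by
  calc _ ≤ ∑ s ∈ Finset.range (Fintype.card E.Ix), E.β 0 * E.β s ^ 2 := by
        refine Finset.sum_le_sum fun s _ => ?_
        rw [pow_succ' _ 2]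
        exact mul_le_mul_of_nonneg_right (E.β_antitone (Nat.zero_le s)) (sq_nonneg _)
    _ = E.β 0 := by rw [← Finset.mul_sum, sum_β_sq, mul_one]

lemma sum_β_cube_nonneg : 0 ≤ ∑ s ∈ Finset.range (Fintype.card E.Ix), E.β s ^ 3 :=
  Finset.sum_nonneg fun s _ => pow_nonneg (E.β_nonneg s) 3

lemma one_div_fP_mem : 1 / E.fP ∈ Set.Icc (0 : ℝ) 1 := by
  rw [one_div_fP]
  exact ⟨sq_nonneg _, pow_le_one₀ E.sum_β_cube_nonneg (E.sum_β_cube_le.trans E.β_zero_le_one)⟩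

end Design

/-! ### The extreme limits of `1/f_P` and of the largest weight -/

variable {E : ℕ → Design}

/-- From `1/f_P = (∑ β_s³)²` and `β 0 ^ 3 ≤ ∑ β_s³ ≤ β 0` one gets `β 0 ^ 6 ≤ 1/f_P ≤ β 0 ^ 2`. -/
lemma tendsto_one_div_fP_zero_iff : Tendsto (fun k => 1 / (E k).fP) atTop (𝓝 0) ↔
    Tendsto (fun k => (E k).β 0) atTop (𝓝 0) := by
  simp_rw [Design.one_div_fP]
  constructor
  · intro h
    have h1 : Tendsto (fun k => (E k).β 0 ^ 6) atTop (𝓝 0) := by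
      refine squeeze_zero (fun k => pow_nonneg ((E k).β_nonneg 0) 6) (fun k => ?_) h
      rw [show 6 = 3 * 2 by norm_num, pow_mul]
      exact pow_le_pow_left₀ (pow_nonneg ((E k).β_nonneg 0) 3) (E k).β_zero_cube_le 2
    have h2 := h1.rpow_const (p := (6 : ℝ)⁻¹) (Or.inr (by norm_num))
    rw [Real.zero_rpow (by norm_num)] at h2
    refine h2.congr fun k => ?_
    exact Real.pow_rpow_inv_natCast ((E k).β_nonneg 0) (by norm_num : 6 ≠ 0)
  · intro h
    have h1 : Tendsto (fun k => (E k).β 0 ^ 2) atTop (𝓝 0) := by simpa using h.pow 2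
    exact squeeze_zero (fun k => sq_nonneg _)
      (fun k => pow_le_pow_left₀ (E k).sum_β_cube_nonneg (E k).sum_β_cube_le 2) h1

/-- The same sandwich, with the upper bound weakened to `β 0 ≤ 1` in one direction and to `1` in the
other. -/
lemma tendsto_one_div_fP_one_iff : Tendsto (fun k => 1 / (E k).fP) atTop (𝓝 1) ↔
    Tendsto (fun k => (E k).β 0) atTop (𝓝 1) := by
  simp_rw [Design.one_div_fP]
  constructor
  · intro h
    refine tendsto_of_tendsto_of_tendsto_of_le_of_le h tendsto_const_nhds (fun k => ?_)
      fun k => (E k).β_zero_le_one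
    have h1 := (E k).sum_β_cube_nonneg
    have h2 := (E k).sum_β_cube_le
    have h3 := (E k).β_zero_le_one
    exact (pow_le_of_le_one h1 (h2.trans h3) two_ne_zero).trans h2
  · intro h
    have h1 : Tendsto (fun k => (E k).β 0 ^ 6) atTop (𝓝 1) := by simpa using h.pow 6
    refine tendsto_of_tendsto_of_tendsto_of_le_of_le h1 tendsto_const_nhds (fun k => ?_)
      fun k => ?_
    · change (E k).β 0 ^ 6 ≤ _
      rw [show 6 = 3 * 2 by norm_num, pow_mul]
      exact pow_le_pow_left₀ (pow_nonneg ((E k).β_nonneg 0) 3) (E k).β_zero_cube_le 2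
    · exact pow_le_one₀ (E k).sum_β_cube_nonneg ((E k).sum_β_cube_le.trans (E k).β_zero_le_one)

/-! ### Linear combinations of independent Gaussian vectors -/

lemma AllMoments.of_identDistrib {Ω Ω' : Type*} [MeasurableSpace Ω] [MeasurableSpace Ω']
    {μ : Measure Ω} {ν : Measure Ω'} {f : Ω → ℝ} {g : Ω' → ℝ} (h : IdentDistrib f g μ ν)
    (hg : AllMoments ν g) : AllMoments μ f :=
  ⟨h.aestronglyMeasurable_iff.2 hg.1, fun n =>
    ((h.comp (u := fun x => |x| ^ n) (by fun_prop)).integrable_iff).2 (hg.2 n)⟩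

lemma gaussianReal_zero_eq_map (v : ℝ) (hv : 0 ≤ v) :
    gaussianReal 0 v.toNNReal = (gaussianReal 0 1).map fun x => √v * x := by
  rw [gaussianReal_map_const_mul]
  congr 1
  · simp
  · ext
    simp [Real.sq_sqrt hv, hv]

section LinearCombination

variable {Ω : Type*} [MeasurableSpace Ω] {P : Measure Ω} [IsProbabilityMeasure P]
  {κ M ι : Type*} [Fintype κ] [Fintype M] [Fintype ι] [DecidableEq M] [DecidableEq ι]
  {η : κ → Ω → ι → ℝ}

/-- All combinations are jointly normal, so vanishing covariances mean independence. This is used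
twice, between the combinations `m` and then between the coordinates `i` of each; means and
variances identify the marginals. -/
lemma identDistrib_linearCombination (hη : ∀ k, HasGaussianLaw (η k) P) (hind : iIndepFun η P)
    (hmean : ∀ k i, ∫ ω, η k ω i ∂P = 0) (W : M → κ → ℝ) {v : ι → ℝ} (hv : ∀ i, 0 ≤ v i)
    (hcov : ∀ m m' i i', ∑ k, W m k * W m' k * cov[fun ω => η k ω i, fun ω => η k ω i'; P] =
      if m = m' ∧ i = i' then v i else 0) :
    IdentDistrib (fun ω m i => ∑ k, W m k * η k ω i) (fun g m i => √(v i) * g m i) P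
      (Measure.pi fun _ : M => stdPi ι) := by
  have hJ : HasGaussianLaw (fun ω k => η k ω) P := hind.hasGaussianLaw hη
  let L : (κ → ι → ℝ) →ₗ[ℝ] (M → ι → ℝ) :=
    { toFun := fun x m i => ∑ k, W m k * x k i
      map_add' := fun x y => by
        ext m i
        simp [mul_add, Finset.sum_add_distrib]
      map_smul' := fun c x => by
        ext m i
        simp only [Pi.smul_apply, smul_eq_mul, RingHom.id_apply, Finset.mul_sum]
        exact Finset.sum_congr rfl fun k _ => by ring }
  have hF : HasGaussianLaw (fun ω m i => ∑ k, W m k * η k ω i) P :=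
    hJ.map_fun (LinearMap.toContinuousLinearMap L)
  have hFm : ∀ m, HasGaussianLaw (fun ω i => ∑ k, W m k * η k ω i) P := fun m => hF.eval m
  have hFmi : ∀ m i, HasGaussianLaw (fun ω => ∑ k, W m k * η k ω i) P := fun m i => (hFm m).eval i
  have hηi : ∀ k i, HasGaussianLaw (fun ω => η k ω i) P := fun k i => (hη k).eval i
  have hc : ∀ m m' i i', cov[fun ω => ∑ k, W m k * η k ω i, fun ω => ∑ k, W m' k * η k ω i'; P] =
      if m = m' ∧ i = i' then v i else 0 := by
    intro m m' i i'
    rw [← hcov, covariance_fun_sum_fun_sum (fun k => (hηi k i).memLp_two.const_mul _)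
      (fun k => (hηi k i').memLp_two.const_mul _)]
    refine Finset.sum_congr rfl fun k _ => ?_
    simp_rw [covariance_const_mul_left, covariance_const_mul_right]
    -- Covariances between different `η k` vanish by independence, so only the diagonal of the
    -- double sum remains.
    rw [Finset.sum_eq_single k]
    · ring
    · intro k' _ hk
      have : IndepFun (fun ω => η k ω i) (fun ω => η k' ω i') P :=
        (hind.indepFun hk.symm).comp (measurable_pi_apply i) (measurable_pi_apply i')
      rw [this.covariance_eq_zero (hηi k i).memLp_two (hηi k' i').memLp_two, mul_zero, mul_zero]
    · simp
  have h1 : iIndepFun (fun m ω i => ∑ k, W m k * η k ω i) P :=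
    hF.iIndepFun_of_covariance_eval (X := fun m i ω => ∑ k, W m k * η k ω i)
      fun m m' hm i i' => by rw [hc, if_neg fun h => hm h.1]
  have h2 : ∀ m, iIndepFun (fun i ω => ∑ k, W m k * η k ω i) P := fun m =>
    (hFm m).iIndepFun_of_covariance_eq_zero fun i i' hi => by rw [hc, if_neg fun h => hi h.2]
  have h3 : ∀ m i, HasLaw (fun ω => ∑ k, W m k * η k ω i) (gaussianReal 0 (v i).toNNReal) P := by
    intro m i
    refine ⟨(hFmi m i).aemeasurable, ?_⟩
    rw [(hFmi m i).map_eq_gaussianReal, integral_finsetSum _ fun k _ =>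
      (hηi k i).integrable.const_mul _, ← covariance_self (hFmi m i).aemeasurable, hc, if_pos ⟨rfl, rfl⟩]
    simp [integral_const_mul, hmean]
  have h4 := h1.hasLaw_pi fun m => (h2 m).hasLaw_pi (h3 m)
  have hm1 : Measurable fun (g : ι → ℝ) i => √(v i) * g i :=
    measurable_pi_lambda _ fun i => (measurable_pi_apply i).const_mul _
  have hm2 : Measurable fun (g : M → ι → ℝ) m i => √(v i) * g m i :=
    measurable_pi_lambda _ fun m => hm1.comp (measurable_pi_apply m)
  refine ⟨h4.aemeasurable, hm2.aemeasurable, ?_⟩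
  rw [h4.map_eq]
  have h5 : Measure.pi (fun i => gaussianReal 0 (v i).toNNReal) =
      (stdPi ι).map fun g i => √(v i) * g i := by
    simp_rw [gaussianReal_zero_eq_map _ (hv _)]
    rw [stdPi, ← Measure.pi_map_pi fun i => by fun_prop]
  simp_rw [h5]
  rw [← Measure.pi_map_pi fun _ => hm1.aemeasurable]

end LinearCombination

namespace Design

variable (E : Design)

/-- The type of the data of one experiment. -/
abbrev Data : Type := ∀ i, Fin (E.n i) → EuclideanSpace ℝ (Fin (E.d i))

/-- A weighted sum of the centred observations of each group. -/
def pooled (w : ∀ i, Fin (E.n i) → ℝ) (x : E.Data) : E.Ix → ℝ :=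
  fun p => ∑ j, w p.1 j * (x p.1 j p.2 - E.μ p.1 p.2)

lemma coord_mul_V_mul_apply (i i' : E.Ix) :
    ∑ g, ((E.N : ℝ) / E.n g) * ∑ a, ∑ b, E.coord i ⟨g, a⟩ * E.coord i' ⟨g, b⟩ * E.S g a b =
      if i = i' then E.lam i else 0 := by
  rw [← diagonal_apply, ← coord_mul_V_mul, Matrix.mul_assoc, Matrix.mul_apply, Fintype.sum_sigma]
  simp only [Matrix.mul_apply, Fintype.sum_sigma, Finset.mul_sum]
  refine Finset.sum_congr rfl fun g _ => Finset.sum_congr rfl fun a _ => ?_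
  rw [Finset.sum_eq_single g]
  · refine Finset.sum_congr rfl fun b _ => ?_
    rw [V, blockDiagonal'_apply_eq, Matrix.smul_apply, smul_eq_mul, transpose_apply]
    ring
  · intro g' _ hg
    refine Finset.sum_eq_zero fun b _ => ?_
    rw [V, blockDiagonal'_apply_ne _ _ _ hg.symm]
    ring
  · simp

end Design

namespace Sample

variable {E : Design} {Ω : Type*} [MeasurableSpace Ω] {P : Measure Ω} [IsProbabilityMeasure P]
  {s : Sample E Ω}

/-- The data as one random element. -/
def data (s : Sample E Ω) (ω : Ω) : E.Data := fun i j => s.X i j ω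

/-- All observations of group `i` have covariance `S i`, so the hypothesis on the weights makes the
pooled vectors uncorrelated for different `m` and gives each the covariance `v V`, which `coord`
diagonalizes. Group means are the case `v = 1`, differences of two observations the case `v = 2`. -/
lemma IsModel.identDistrib_pooled (hs : s.IsModel P) {M : Type*} [Fintype M] [DecidableEq M]
    (W : M → ∀ i, Fin (E.n i) → ℝ) {v : ℝ} (hv : 0 ≤ v)
    (hW : ∀ m m' i, ∑ j, W m i j * W m' i j = if m = m' then v * ((E.N : ℝ) / E.n i) else 0) :
    IdentDistrib (fun ω m => E.coord *ᵥ E.pooled (W m) (s.data ω))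
      (fun g m i => √(v * E.lam i) * g m i) P (Measure.pi fun _ : M => stdPi E.Ix) := by
  let A : ∀ g, EuclideanSpace ℝ (Fin (E.d g)) → E.Ix → ℝ := fun g x i =>
    ∑ a, E.coord i ⟨g, a⟩ * x a
  let η : (Σ i, Fin (E.n i)) → Ω → E.Ix → ℝ := fun k ω => A k.1 (s.X k.1 k.2 ω - E.μ k.1)
  have hAm : ∀ g, Measurable (A g) := fun g => by fun_prop
  have hX : ∀ k : Σ i, Fin (E.n i), HasGaussianLaw (fun ω => s.X k.1 k.2 ω - E.μ k.1) P := by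
    intro k
    refine ⟨?_⟩
    have : P.map (fun ω => s.X k.1 k.2 ω - E.μ k.1) =
        (multivariateGaussian (E.μ k.1) (E.S k.1)).map fun x => x - E.μ k.1 := by
      rw [← (hs.law_X k.1 k.2).map_eq, AEMeasurable.map_map_of_aemeasurable (by fun_prop)
        (hs.law_X k.1 k.2).aemeasurable]
      rfl
    rw [this]
    infer_instance
  have hXa : ∀ (k : Σ i, Fin (E.n i)) a, HasGaussianLaw (fun ω => s.X k.1 k.2 ω a) P := fun k a =>
    (hs.law_X k.1 k.2).hasGaussianLaw.map_fun (EuclideanSpace.proj a)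
  have hXs : ∀ (k : Σ i, Fin (E.n i)) a,
      HasGaussianLaw (fun ω => (s.X k.1 k.2 ω - E.μ k.1) a) P := fun k a =>
    (hX k).map_fun (EuclideanSpace.proj a)
  have hη : ∀ k, HasGaussianLaw (η k) P := by
    intro k
    let L : EuclideanSpace ℝ (Fin (E.d k.1)) →ₗ[ℝ] (E.Ix → ℝ) :=
      { toFun := A k.1
        map_add' := fun x y => by
          ext i
          simp [A, mul_add, Finset.sum_add_distrib]
        map_smul' := fun c x => by
          ext i
          simp only [A, PiLp.smul_apply, Pi.smul_apply, smul_eq_mul, RingHom.id_apply,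
            Finset.mul_sum]
          exact Finset.sum_congr rfl fun k _ => by ring }
    exact (hX k).map_fun (LinearMap.toContinuousLinearMap L)
  have hind : iIndepFun η P := hs.indep_X.comp (fun k x => A k.1 (x - E.μ k.1)) fun k =>
    (hAm k.1).comp (by fun_prop)
  have hmeanX : ∀ (k : Σ i, Fin (E.n i)) a, ∫ ω, s.X k.1 k.2 ω a ∂P = E.μ k.1 a := by
    intro k a
    have h0 := (hs.law_X k.1 k.2).integral_comp (f := fun x => x a) (by fun_prop)
    refine h0.trans ?_
    have h := (EuclideanSpace.proj a : EuclideanSpace ℝ (Fin (E.d k.1)) →L[ℝ] ℝ).integral_comp_id_comm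
      (IsGaussian.integrable_id (μ := multivariateGaussian (E.μ k.1) (E.S k.1)))
    rw [integral_id_multivariateGaussian] at h
    exact h
  have hmean : ∀ k i, ∫ ω, η k ω i ∂P = 0 := by
    intro k i
    simp only [η, A]
    rw [integral_finsetSum _ fun a _ => (hXs k a).integrable.const_mul _]
    refine Finset.sum_eq_zero fun a _ => ?_
    simp only [PiLp.sub_apply]
    rw [integral_const_mul, integral_sub (hXa k a).integrable (integrable_const _), hmeanX]
    simp
  have hcovη : ∀ k i i', cov[fun ω => η k ω i, fun ω => η k ω i'; P] =
      ∑ a, ∑ b, E.coord i ⟨k.1, a⟩ * E.coord i' ⟨k.1, b⟩ * E.S k.1 a b := by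
    intro k i i'
    simp only [η, A]
    rw [covariance_fun_sum_fun_sum (fun a => (hXs k a).memLp_two.const_mul _)
      (fun b => (hXs k b).memLp_two.const_mul _)]
    refine Finset.sum_congr rfl fun a _ => Finset.sum_congr rfl fun b _ => ?_
    simp only [PiLp.sub_apply]
    rw [covariance_const_mul_left, covariance_const_mul_right,
      covariance_sub_const_left (hXa k a).integrable,
      covariance_sub_const_right (hXa k b).integrable,
      (hs.law_X k.1 k.2).covariance_fun_comp (f := fun x => x a) (g := fun x => x b)
        (by fun_prop) (by fun_prop),
      covariance_eval_multivariateGaussian (E.S_posDef k.1).posSemidef]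
    ring
  have key := identDistrib_linearCombination hη hind hmean (fun m k => W m k.1 k.2)
    (v := fun i => v * E.lam i) (fun i => mul_nonneg hv (E.lam_nonneg i)) ?_
  · convert key using 1
    ext ω m i
    simp only [mulVec, dotProduct, Design.pooled, data, η, A, Fintype.sum_sigma, Finset.mul_sum,
      PiLp.sub_apply]
    refine Finset.sum_congr rfl fun g _ => ?_
    calc _ = ∑ a : Fin (E.d g), ∑ j : Fin (E.n g),
          E.coord i ⟨g, a⟩ * (W m g j * (s.X g j ω a - E.μ g a)) := rfl
      _ = ∑ j : Fin (E.n g), ∑ a : Fin (E.d g),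
          E.coord i ⟨g, a⟩ * (W m g j * (s.X g j ω a - E.μ g a)) := Finset.sum_comm
      _ = _ := Finset.sum_congr rfl fun j _ => Finset.sum_congr rfl fun a _ => by ring
  · intro m m' i i'
    simp_rw [hcovη]
    rw [Fintype.sum_sigma]
    have h3 : ∀ g, ∑ j, W m g j * W m' g j *
        ∑ a, ∑ b, E.coord i ⟨g, a⟩ * E.coord i' ⟨g, b⟩ * E.S g a b =
        (if m = m' then v else 0) * (((E.N : ℝ) / E.n g) *
          ∑ a, ∑ b, E.coord i ⟨g, a⟩ * E.coord i' ⟨g, b⟩ * E.S g a b) := by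
      intro g
      refine (Finset.sum_mul _ _ _).symm.trans ?_
      rw [hW]
      split_ifs <;> ring
    refine (Finset.sum_congr rfl fun g _ => h3 g).trans ?_
    rw [← Finset.mul_sum, E.coord_mul_V_mul_apply i i']
    by_cases h1 : m = m' <;> by_cases h2 : i = i' <;> simp [h1, h2]

end Sample

/-! ### The kernels of the trace estimators -/

namespace Design

variable (E : Design)

/-- The weights of the difference of two observations per group, permuted by `p`. -/
noncomputable def contrast (p : ∀ i, Equiv.Perm (Fin (E.n i))) (l₁ l₂ : Fin E.nMin) :
    ∀ i, Fin (E.n i) → ℝ := fun i j => √((E.N : ℝ) / E.n i) *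
  ((if j = p i (Fin.castLE (E.nMin_le i) l₁) then 1 else 0) -
    (if j = p i (Fin.castLE (E.nMin_le i) l₂) then 1 else 0))

/-- Both contrasts use the same permutation, so only coincidences of the original indices count and
the result does not involve `p`. Hence the kernels have the same law for every permutation. -/
lemma sum_contrast_mul (p : ∀ i, Equiv.Perm (Fin (E.n i))) (l₁ l₂ l₃ l₄ : Fin E.nMin)
    (i : Fin E.a) : ∑ j, E.contrast p l₁ l₂ i j * E.contrast p l₃ l₄ i j =
      ((E.N : ℝ) / E.n i) * ((if l₁ = l₃ then 1 else 0) - (if l₁ = l₄ then 1 else 0) -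
        (if l₂ = l₃ then 1 else 0) + (if l₂ = l₄ then 1 else 0)) := by
  have hs : √((E.N : ℝ) / E.n i) * √((E.N : ℝ) / E.n i) = (E.N : ℝ) / E.n i :=
    Real.mul_self_sqrt (by positivity)
  have hinj : ∀ l l' : Fin E.nMin, p i (Fin.castLE (E.nMin_le i) l) =
      p i (Fin.castLE (E.nMin_le i) l') ↔ l = l' := fun l l' => by
    rw [(p i).injective.eq_iff, (Fin.castLE_injective _).eq_iff]
  have e : ∀ j, E.contrast p l₁ l₂ i j * E.contrast p l₃ l₄ i j = ((E.N : ℝ) / E.n i) *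
      (((if j = p i (Fin.castLE (E.nMin_le i) l₁) then 1 else 0) -
        (if j = p i (Fin.castLE (E.nMin_le i) l₂) then 1 else 0)) *
      ((if j = p i (Fin.castLE (E.nMin_le i) l₃) then 1 else 0) -
        (if j = p i (Fin.castLE (E.nMin_le i) l₄) then 1 else 0))) := fun j => by
    unfold contrast
    rw [mul_mul_mul_comm, hs]
  simp_rw [e, ← Finset.mul_sum, sub_mul, Finset.sum_sub_distrib, ite_mul, one_mul, zero_mul]
  simp only [Finset.sum_ite_eq', Finset.mem_univ, if_true, hinj]
  ring

lemma pooled_contrast (p : ∀ i, Equiv.Perm (Fin (E.n i))) (l₁ l₂ : Fin E.nMin) (x : E.Data)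
    (q : E.Ix) : E.pooled (E.contrast p l₁ l₂) x q = √((E.N : ℝ) / E.n q.1) *
      (x q.1 (p q.1 (Fin.castLE (E.nMin_le q.1) l₁)) q.2 -
        x q.1 (p q.1 (Fin.castLE (E.nMin_le q.1) l₂)) q.2) := by
  unfold pooled contrast
  simp_rw [mul_assoc, ← Finset.mul_sum, sub_mul, Finset.sum_sub_distrib, ite_mul, one_mul, zero_mul]
  simp

lemma measurable_pooled (w : ∀ i, Fin (E.n i) → ℝ) : Measurable (E.pooled w) := by
  refine measurable_pi_lambda _ fun p => Finset.measurable_sum _ fun j _ => ?_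
  have h : Measurable fun x : E.Data => x p.1 j :=
    (measurable_pi_apply j).comp (measurable_pi_apply p.1)
  have h2 : Measurable fun x : EuclideanSpace ℝ (Fin (E.d p.1)) => x p.2 := by fun_prop
  exact ((h2.comp h).sub_const _).const_mul _

lemma measurable_coord_pooled (w : ∀ i, Fin (E.n i) → ℝ) :
    Measurable fun x => E.coord *ᵥ E.pooled w x := by
  refine measurable_pi_lambda _ fun i => ?_
  have := E.measurable_pooled w
  exact Finset.measurable_sum _ fun p _ => ((measurable_pi_apply p).comp this).const_mul _

/-- Applying `ψ` to the coordinates of the contrasts of the observations selected by `l`. -/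
noncomputable def contrastKernel {r m : ℕ} (e₀ e₁ : Fin r → Fin m)
    (ψ : (Fin r → E.Ix → ℝ) → ℝ) (p : ∀ i, Equiv.Perm (Fin (E.n i)))
    (l : Fin m ↪ Fin E.nMin) (x : E.Data) : ℝ :=
  ψ fun a => E.coord *ᵥ E.pooled (E.contrast p (l (e₀ a)) (l (e₁ a))) x

end Design

/-- The two halves of the index set carry independent vectors. This yields the vanishing covariance
of centred kernels on disjoint tuples. -/
lemma integral_sum_pi_mul {r : ℕ} {ι : Type*} [Fintype ι] (f : (Fin r → ι → ℝ) → ℝ) :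
    ∫ g, f (fun a => g (Sum.inl a)) * f (fun a => g (Sum.inr a))
      ∂(Measure.pi fun _ : Fin r ⊕ Fin r => stdPi ι) =
    (∫ g, f g ∂(Measure.pi fun _ : Fin r => stdPi ι)) ^ 2 := by
  have h := measurePreserving_sumPiEquivProdPi fun _ : Fin r ⊕ Fin r => stdPi ι
  have h2 := h.integral_comp' (g := fun x : (Fin r → ι → ℝ) × (Fin r → ι → ℝ) => f x.1 * f x.2)
  rw [integral_prod_mul (μ := Measure.pi fun _ : Fin r => stdPi ι)
    (ν := Measure.pi fun _ : Fin r => stdPi ι), ← sq] at h2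
  exact h2

namespace Sample

variable {E : Design} {Ω : Type*} [MeasurableSpace Ω] {P : Measure Ω} [IsProbabilityMeasure P]
  {s : Sample E Ω}

/-- Injectivity of `Sum.elim e₀ e₁` says that the `r` contrasts use distinct positions, so they are
orthogonal with `v = 2`. For disjoint tuples all `2r` contrasts are orthogonal, and the expected
product is the square of the vanishing mean. -/
lemma IsModel.isUKernel (hs : s.IsModel P) {r m : ℕ} {e₀ e₁ : Fin r → Fin m}
    (he : Function.Injective (Sum.elim e₀ e₁)) {ψ : (Fin r → E.Ix → ℝ) → ℝ} (hψ : Measurable ψ)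
    {M : ℝ}
    (hA : AllMoments (Measure.pi fun _ : Fin r => stdPi E.Ix)
      fun g => ψ fun a i => √(2 * E.lam i) * g a i)
    (h0 : ∫ g, ψ (fun a i => √(2 * E.lam i) * g a i)
      ∂(Measure.pi fun _ : Fin r => stdPi E.Ix) = 0)
    (hM : ∫ g, ψ (fun a i => √(2 * E.lam i) * g a i) ^ 2
      ∂(Measure.pi fun _ : Fin r => stdPi E.Ix) ≤ M) :
    IsUKernel P s.data (E.contrastKernel e₀ e₁ ψ) M := by
  have h01 : ∀ a b, e₀ a ≠ e₁ b := fun a b h => by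
    have := @he (Sum.inl a) (Sum.inr b) h
    simp at this
  have h00 : ∀ a b, e₀ a = e₀ b ↔ a = b := fun a b =>
    ⟨fun h => Sum.inl_injective (@he (Sum.inl a) (Sum.inl b) h), fun h => h ▸ rfl⟩
  have h11 : ∀ a b, e₁ a = e₁ b ↔ a = b := fun a b =>
    ⟨fun h => Sum.inr_injective (@he (Sum.inr a) (Sum.inr b) h), fun h => h ▸ rfl⟩
  have hsame : ∀ p (l : Fin m ↪ Fin E.nMin) a b i,
      ∑ j, E.contrast p (l (e₀ a)) (l (e₁ a)) i j * E.contrast p (l (e₀ b)) (l (e₁ b)) i j =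
        if a = b then 2 * ((E.N : ℝ) / E.n i) else 0 := by
    intro p l a b i
    rw [Design.sum_contrast_mul]
    simp only [l.injective.eq_iff, h00, h11, h01, (h01 _ _).symm, if_false]
    split_ifs <;> ring
  have hone : ∀ p (l : Fin m ↪ Fin E.nMin), IdentDistrib
      (fun ω => E.contrastKernel e₀ e₁ ψ p l (s.data ω))
      (fun g => ψ fun a i => √(2 * E.lam i) * g a i) P
      (Measure.pi fun _ : Fin r => stdPi E.Ix) := fun p l =>
    (hs.identDistrib_pooled (fun a => E.contrast p (l (e₀ a)) (l (e₁ a))) (v := 2) (by norm_num)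
      (hsame p l)).comp hψ
  refine ⟨fun p l => ?_, fun p l => AllMoments.of_identDistrib (hone p l) hA, fun p l => ?_,
    fun p l l' hll => ?_⟩
  · exact hψ.comp (measurable_pi_lambda _ fun a => E.measurable_coord_pooled _)
  · exact (((hone p l).comp (measurable_id.pow_const 2)).integral_eq).le.trans hM
  · let W : Fin r ⊕ Fin r → ∀ i, Fin (E.n i) → ℝ := Sum.elim
      (fun a => E.contrast p (l (e₀ a)) (l (e₁ a)))
      (fun a => E.contrast p (l' (e₀ a)) (l' (e₁ a)))
    have hW : ∀ m m' i, ∑ j, W m i j * W m' i j =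
        if m = m' then 2 * ((E.N : ℝ) / E.n i) else 0 := by
      rintro (a | a) (b | b) i
      · simpa [W] using hsame p l a b i
      · simp only [W, Sum.elim_inl, Sum.elim_inr, Design.sum_contrast_mul]
        simp [hll]
      · simp only [W, Sum.elim_inl, Sum.elim_inr, Design.sum_contrast_mul]
        simp [(hll _ _).symm]
      · simpa [W] using hsame p l' a b i
    have h := (hs.identDistrib_pooled W (v := 2) (by norm_num) hW).comp
      (u := fun c => ψ (fun a => c (Sum.inl a)) * ψ (fun a => c (Sum.inr a)))
      ((hψ.comp (measurable_pi_lambda _ fun a => measurable_pi_apply _)).mul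
        (hψ.comp (measurable_pi_lambda _ fun a => measurable_pi_apply _)))
    refine h.integral_eq.trans ?_
    refine (integral_sum_pi_mul fun g => ψ fun a i => √(2 * E.lam i) * g a i).trans ?_
    rw [h0]
    norm_num

end Sample

/-! ### Moments of the kernels -/

section Moments

variable {ι : Type*} [Fintype ι]

lemma wInner_scale {v : ι → ℝ} (hv : ∀ i, 0 ≤ v i) (x y : ι → ℝ) :
    ∑ i, (√(2 * v i) * x i) * (√(2 * v i) * y i) = 2 * wInner v x y := by
  rw [wInner, Finset.mul_sum]
  refine Finset.sum_congr rfl fun i _ => ?_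
  rw [mul_mul_mul_comm, Real.mul_self_sqrt (mul_nonneg zero_le_two (hv i))]
  ring

lemma integral_sub_sq_le {Ω : Type*} [MeasurableSpace Ω] {μ : Measure Ω} [IsProbabilityMeasure μ]
    {Y : Ω → ℝ} (hY : AllMoments μ Y) {t : ℝ} (ht : ∫ ω, Y ω ∂μ = t) :
    ∫ ω, (Y ω - t) ^ 2 ∂μ ≤ ∫ ω, Y ω ^ 2 ∂μ := by
  have e : ∀ ω, (Y ω - t) ^ 2 = Y ω ^ 2 - (2 * t * Y ω - t ^ 2) := fun ω => by ring
  have hi : Integrable (fun ω => 2 * t * Y ω - t ^ 2) μ :=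
    (hY.integrable.const_mul _).sub (integrable_const _)
  simp_rw [e]
  rw [integral_sub (hY.integrable_pow 2) hi,
    integral_sub (hY.integrable.const_mul _) (integrable_const _), integral_const_mul, ht]
  simp
  nlinarith [sq_nonneg t]

lemma integral_wInner_pow_four_le (v : ι → ℝ) (hv : 0 < ∑ i, v i ^ 2) :
    ∫ g, wInner v g.1 g.2 ^ 4 ∂((stdPi ι).prod (stdPi ι)) ≤
      (1 + gaussMoment6 ^ 2) * (∑ i, v i ^ 2) ^ 2 := by
  set t := ∑ i, v i ^ 2 with ht
  have hA : AllMoments ((stdPi ι).prod (stdPi ι)) fun g => wInner v g.1 g.2 :=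
    allMoments_wInner allMoments_fst allMoments_snd v
  -- Interpolation by the arithmetic-geometric mean inequality, weighted so that both terms scale
  -- like `t²`; the fourth moment then needs only the second and the sixth.
  have h : ∀ x : ℝ, x ^ 4 ≤ t * x ^ 2 + t⁻¹ * x ^ 6 := fun x => by
    have h1 : t * x ^ 2 + t⁻¹ * x ^ 6 - 2 * x ^ 4 = t⁻¹ * (x * (t - x ^ 2)) ^ 2 := by
      field_simp
      ring
    have h2 : 0 ≤ t⁻¹ * (x * (t - x ^ 2)) ^ 2 := by positivity
    have h3 : 0 ≤ x ^ 4 := by positivity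
    linarith
  refine (integral_mono (hA.integrable_pow 4)
    (((hA.integrable_pow 2).const_mul t).add ((hA.integrable_pow 6).const_mul t⁻¹))
    fun g => h _).trans ?_
  simp only [Pi.add_apply]
  rw [integral_add ((hA.integrable_pow 2).const_mul t) ((hA.integrable_pow 6).const_mul t⁻¹),
    integral_const_mul, integral_const_mul, integral_wInner_sq, ← ht]
  have h4 := mul_le_mul_of_nonneg_left (integral_wInner_pow_six_le v) (inv_pos.2 hv).le
  rw [← ht] at h4
  have h5 : t⁻¹ * (gaussMoment6 ^ 2 * t ^ 3) = gaussMoment6 ^ 2 * t ^ 2 := by field_simp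
  rw [h5] at h4
  nlinarith

lemma allMoments_wInner_eval {r : ℕ} (a b : Fin r) (v : ι → ℝ) :
    AllMoments (Measure.pi fun _ : Fin r => stdPi ι) fun g => wInner v (g a) (g b) :=
  allMoments_wInner (X := fun g : Fin r → ι → ℝ => g a) (Y := fun g => g b)
    (allMoments_eval_eval a) (allMoments_eval_eval b) v

lemma integral_wInner_eval_pow {r : ℕ} {a b : Fin r} (hab : a ≠ b) (v : ι → ℝ) (n : ℕ) :
    ∫ g, wInner v (g a) (g b) ^ n ∂(Measure.pi fun _ : Fin r => stdPi ι) =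
      ∫ g, wInner v g.1 g.2 ^ n ∂((stdPi ι).prod (stdPi ι)) := by
  have h := (hasLaw_eval_pair (ι := ι) hab).integral_comp
    (f := fun g => wInner v g.1 g.2 ^ n)
    ((allMoments_wInner allMoments_fst allMoments_snd v).pow n).aestronglyMeasurable
  exact h

lemma integral_wInner_triple_sq_le (v : ι → ℝ) :
    ∫ g, (wInner v (g 0) (g 1) * wInner v (g 1) (g 2) * wInner v (g 2) (g 0)) ^ 2
      ∂(Measure.pi fun _ : Fin 3 => stdPi ι) ≤ gaussMoment6 ^ 2 * (∑ i, v i ^ 2) ^ 3 := by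
  have hA := fun a b => allMoments_wInner_eval (ι := ι) (r := 3) a b v
  -- Arithmetic-geometric mean inequality for the squares `X, Y, Z`: twice `X³ + Y³ + Z³ - 3XYZ` is
  -- `X + Y + Z` times the sum of the squared differences. It decouples the three dependent factors.
  have h : ∀ x y z : ℝ, (x * y * z) ^ 2 ≤ (x ^ 6 + y ^ 6 + z ^ 6) / 3 := fun x y z => by
    have := sq_nonneg (x ^ 2 - y ^ 2)
    have h2 := sq_nonneg (y ^ 2 - z ^ 2)
    have h3 := sq_nonneg (z ^ 2 - x ^ 2)
    nlinarith [mul_nonneg (add_nonneg (add_nonneg (sq_nonneg x) (sq_nonneg y)) (sq_nonneg z))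
      (add_nonneg (add_nonneg this h2) h3)]
  have hi := fun a b => (hA a b).integrable_pow 6
  refine (integral_mono ((((hA 0 1).mul (hA 1 2)).mul (hA 2 0)).integrable_pow 2)
    ((((hi 0 1).add (hi 1 2)).add (hi 2 0)).div_const 3) fun g => h _ _ _).trans ?_
  simp only [Pi.add_apply]
  have hi2 : Integrable (fun g : Fin 3 → ι → ℝ => wInner v (g 0) (g 1) ^ 6 +
    wInner v (g 1) (g 2) ^ 6) (Measure.pi fun _ : Fin 3 => stdPi ι) := (hi 0 1).add (hi 1 2)
  rw [integral_div, integral_add hi2 (hi 2 0), integral_add (hi 0 1) (hi 1 2),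
    integral_wInner_eval_pow (by decide), integral_wInner_eval_pow (by decide),
    integral_wInner_eval_pow (by decide)]
  linarith [integral_wInner_pow_six_le v]

end Moments

/-! ### Sums over ordered tuples -/

/-- Swapping the positions `a` and `b` is an involution that exchanges the two possible orders and
preserves `F` and `Q`. -/
lemma sum_filter_lt_eq_half {m n : ℕ} {a b : Fin m} (hab : a ≠ b) {F : (Fin m ↪ Fin n) → ℝ}
    (hF : ∀ l, F ((Equiv.swap a b).toEmbedding.trans l) = F l) (Q : (Fin m ↪ Fin n) → Prop)
    [DecidablePred Q] (hQ : ∀ l, Q ((Equiv.swap a b).toEmbedding.trans l) ↔ Q l) :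
    2 * ∑ l with l a < l b ∧ Q l, F l = ∑ l with Q l, F l := by
  have h1 : ∑ l with l a < l b ∧ Q l, F l = ∑ l with ¬ l a < l b ∧ Q l, F l := by
    refine Finset.sum_nbij' (fun l => (Equiv.swap a b).toEmbedding.trans l)
      (fun l => (Equiv.swap a b).toEmbedding.trans l) ?_ ?_ ?_ ?_ fun l _ => (hF l).symm
    · intro l hl
      simp only [Finset.mem_filter, Finset.mem_univ, true_and, hQ] at hl ⊢
      exact ⟨by simpa using hl.1.le, hl.2⟩
    · intro l hl
      simp only [Finset.mem_filter, Finset.mem_univ, true_and, hQ] at hl ⊢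
      refine ⟨?_, hl.2⟩
      have := lt_of_le_of_ne (not_lt.1 hl.1) (l.injective.ne hab.symm)
      simpa using this
    · intro l _
      ext i
      simp
    · intro l _
      ext i
      simp
  have h2 := Finset.sum_filter_add_sum_filter_not (Finset.univ.filter Q) (fun l => l a < l b) F
  simp only [Finset.filter_filter] at h2
  rw [two_mul]
  nth_rewrite 2 [h1]
  rw [← h2]
  simp only [and_comm]

lemma card_embedding_eq_factorial_mul (m n : ℕ) :
    (Fintype.card (Fin m ↪ Fin n) : ℝ) = m.factorial * n.choose m := by
  rw [Fintype.card_embedding_eq, Fintype.card_fin, Fintype.card_fin,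
    Nat.descFactorial_eq_factorial_mul_choose]
  push_cast
  rfl

namespace Design

variable (E : Design)

/-- The centred kernel of degree one. -/
noncomputable def form₁ (c : Fin 1 → E.Ix → ℝ) : ℝ := c 0 ⬝ᵥ c 0 / 2 - ∑ i, E.lam i

/-- The centred kernel of degree two. -/
noncomputable def form₂ (c : Fin 2 → E.Ix → ℝ) : ℝ := (c 0 ⬝ᵥ c 1) ^ 2 / 4 - ∑ i, E.lam i ^ 2

/-- The centred kernel of degree three. -/
noncomputable def form₃ (c : Fin 3 → E.Ix → ℝ) : ℝ :=
  (c 0 ⬝ᵥ c 1) * (c 1 ⬝ᵥ c 2) * (c 2 ⬝ᵥ c 0) / 8 - ∑ i, E.lam i ^ 3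

lemma measurable_dotProduct_eval {r : ℕ} (a b : Fin r) :
    Measurable fun c : Fin r → E.Ix → ℝ => c a ⬝ᵥ c b := by
  have h : ∀ (a : Fin r) i, Measurable fun c : Fin r → E.Ix → ℝ => c a i := fun a i =>
    (measurable_pi_apply i).comp (measurable_pi_apply a)
  exact Finset.measurable_sum _ fun i _ => (h a i).mul (h b i)

lemma measurable_form₁ : Measurable E.form₁ :=
  ((E.measurable_dotProduct_eval 0 0).div_const 2).sub_const _

lemma measurable_form₂ : Measurable E.form₂ :=
  (((E.measurable_dotProduct_eval 0 1).pow_const 2).div_const 4).sub_const _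

lemma measurable_form₃ : Measurable E.form₃ :=
  ((((E.measurable_dotProduct_eval 0 1).mul (E.measurable_dotProduct_eval 1 2)).mul
    (E.measurable_dotProduct_eval 2 0)).div_const 8).sub_const _

lemma dotProduct_scale (x y : E.Ix → ℝ) :
    (fun i => √(2 * E.lam i) * x i) ⬝ᵥ (fun i => √(2 * E.lam i) * y i) =
      2 * wInner E.lam x y :=
  wInner_scale E.lam_nonneg x y

lemma form₁_scale (g : Fin 1 → E.Ix → ℝ) : E.form₁ (fun a i => √(2 * E.lam i) * g a i) =
    ∑ i, E.lam i * (g 0 i ^ 2 - 1) := by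
  rw [form₁, dotProduct_scale, mul_div_cancel_left₀ _ two_ne_zero, wInner,
    ← Finset.sum_sub_distrib]
  exact Finset.sum_congr rfl fun i _ => by ring

lemma form₂_scale (g : Fin 2 → E.Ix → ℝ) : E.form₂ (fun a i => √(2 * E.lam i) * g a i) =
    wInner E.lam (g 0) (g 1) ^ 2 - ∑ i, E.lam i ^ 2 := by
  rw [form₂, dotProduct_scale]
  ring

lemma form₃_scale (g : Fin 3 → E.Ix → ℝ) : E.form₃ (fun a i => √(2 * E.lam i) * g a i) =
    wInner E.lam (g 0) (g 1) * wInner E.lam (g 1) (g 2) * wInner E.lam (g 2) (g 0) -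
      ∑ i, E.lam i ^ 3 := by
  rw [form₃, dotProduct_scale, dotProduct_scale, dotProduct_scale]
  ring

end Design

lemma hasLaw_eval_pi_stdPi {r : ℕ} {ι : Type*} [Fintype ι] (a : Fin r) :
    HasLaw (fun g : Fin r → ι → ℝ => g a) (stdPi ι) (Measure.pi fun _ : Fin r => stdPi ι) :=
  (measurePreserving_eval (fun _ : Fin r => stdPi ι) a).hasLaw

lemma allMoments_sum_sq_sub_one {ι : Type*} [Fintype ι] (w : ι → ℝ) :
    AllMoments (stdPi ι) fun g => ∑ i, w i * (g i ^ 2 - 1) :=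
  AllMoments.sum _ fun i _ =>
    (((allMoments_eval_stdPi i).pow 2).sub (AllMoments.const 1)).const_mul _

lemma integral_sum_sq_sub_one {ι : Type*} [Fintype ι] (w : ι → ℝ) :
    ∫ g, ∑ i, w i * (g i ^ 2 - 1) ∂(stdPi ι) = 0 := by
  rw [integral_finsetSum _ fun i _ =>
    ((((allMoments_eval_stdPi i).pow 2).sub (AllMoments.const 1)).const_mul (w i)).integrable]
  refine Finset.sum_eq_zero fun i _ => ?_
  rw [integral_const_mul]
  have h := (hasLaw_eval_stdPi i).integral_comp (f := fun x => x ^ 2 - 1) (by fun_prop)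
  rw [integral_sq_sub_one_gaussianReal] at h
  rw [show ∫ g : ι → ℝ, (g i ^ 2 - 1) ∂(stdPi ι) = 0 from h, mul_zero]

namespace Sample

variable {E : Design} {Ω : Type*} {s : Sample E Ω}

/-- The permutations with index `j` as one random element. -/
def perm (s : Sample E Ω) (j : ℕ) (ω : Ω) : ∀ i, Equiv.Perm (Fin (E.n i)) := fun i => s.π j i ω

lemma pooled_contrast_data (j : ℕ) (l₁ l₂ : Fin E.nMin) (ω : Ω) :
    E.pooled (E.contrast (s.perm j ω) l₁ l₂) (s.data ω) = s.Z j l₁ l₂ ω := by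
  ext q
  rw [Design.pooled_contrast]
  rfl

lemma Λ_eq (j : ℕ) (l₁ l₂ l₃ l₄ : Fin E.nMin) (ω : Ω) : s.Λ j l₁ l₂ l₃ l₄ ω =
    (E.coord *ᵥ E.pooled (E.contrast (s.perm j ω) l₁ l₂) (s.data ω)) ⬝ᵥ
      (E.coord *ᵥ E.pooled (E.contrast (s.perm j ω) l₃ l₄) (s.data ω)) := by
  rw [pooled_contrast_data, pooled_contrast_data, Λ, Design.dotProduct_T_mulVec]
  rfl

lemma kernel₁_eq (j : ℕ) (l : Fin 2 ↪ Fin E.nMin) (ω : Ω) : s.kernel₁ j l ω =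
    2 * (E.contrastKernel ![0] ![1] E.form₁ (s.perm j ω) l (s.data ω) + ∑ i, E.lam i) := by
  rw [kernel₁, Λ_eq, Design.contrastKernel, Design.form₁, sub_add_cancel,
    mul_div_cancel₀ _ two_ne_zero]
  rfl

lemma kernel₂_eq (j : ℕ) (l : Fin 4 ↪ Fin E.nMin) (ω : Ω) : s.kernel₂ j l ω =
    4 * (E.contrastKernel ![0, 2] ![1, 3] E.form₂ (s.perm j ω) l (s.data ω) +
      ∑ i, E.lam i ^ 2) := by
  rw [kernel₂, Λ_eq, Design.contrastKernel, Design.form₂, sub_add_cancel,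
    mul_div_cancel₀ _ four_ne_zero]
  rfl

lemma kernel₃_eq (j : ℕ) (l : Fin 6 ↪ Fin E.nMin) (ω : Ω) : s.kernel₃ j l ω =
    8 * (E.contrastKernel ![0, 2, 4] ![1, 3, 5] E.form₃ (s.perm j ω) l (s.data ω) +
      ∑ i, E.lam i ^ 3) := by
  rw [kernel₃, Λ_eq, Λ_eq, Λ_eq, Design.contrastKernel, Design.form₃, sub_add_cancel,
    mul_div_cancel₀ _ (by norm_num)]
  rfl

lemma Z_swap (j : ℕ) (l₁ l₂ : Fin E.nMin) (ω : Ω) : s.Z j l₂ l₁ ω = -s.Z j l₁ l₂ ω := by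
  ext p
  simp only [Z, Pi.neg_apply]
  ring

lemma kernel₁_swap (j : ℕ) (l : Fin 2 ↪ Fin E.nMin) (ω : Ω) :
    s.kernel₁ j ((Equiv.swap 0 1).toEmbedding.trans l) ω = s.kernel₁ j l ω := by
  simp only [kernel₁, Λ, Function.Embedding.trans_apply, Equiv.coe_toEmbedding,
    Equiv.swap_apply_left, Equiv.swap_apply_right]
  rw [Z_swap, mulVec_neg, neg_dotProduct_neg]

lemma kernel₂_swap_left (j : ℕ) (l : Fin 4 ↪ Fin E.nMin) (ω : Ω) :
    s.kernel₂ j ((Equiv.swap 0 1).toEmbedding.trans l) ω = s.kernel₂ j l ω := by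
  have h2 : Equiv.swap (0 : Fin 4) 1 2 = 2 := by decide
  have h3 : Equiv.swap (0 : Fin 4) 1 3 = 3 := by decide
  simp only [kernel₂, Λ, Function.Embedding.trans_apply, Equiv.coe_toEmbedding,
    Equiv.swap_apply_left, Equiv.swap_apply_right, h2, h3]
  rw [Z_swap, neg_dotProduct, neg_sq]

lemma kernel₂_swap_right (j : ℕ) (l : Fin 4 ↪ Fin E.nMin) (ω : Ω) :
    s.kernel₂ j ((Equiv.swap 2 3).toEmbedding.trans l) ω = s.kernel₂ j l ω := by
  have h2 : Equiv.swap (2 : Fin 4) 3 0 = 0 := by decide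
  have h3 : Equiv.swap (2 : Fin 4) 3 1 = 1 := by decide
  simp only [kernel₂, Λ, Function.Embedding.trans_apply, Equiv.coe_toEmbedding,
    Equiv.swap_apply_left, Equiv.swap_apply_right, h2, h3]
  rw [Z_swap _ (l 2), mulVec_neg, dotProduct_neg, neg_sq]

variable [MeasurableSpace Ω] {P : Measure Ω} [IsProbabilityMeasure P]

/-- In each degree `r` the bound is an absolute constant times `(∑ λ²)^r`, exactly the scale by
which the squared errors are later divided. -/
lemma IsModel.isUKernel₁ (hs : s.IsModel P) :
    IsUKernel P s.data (E.contrastKernel ![0] ![1] E.form₁ (m := 2)) (2 * ∑ i, E.lam i ^ 2) := by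
  refine hs.isUKernel (by decide) E.measurable_form₁ ?_ ?_ ?_
  · simp_rw [Design.form₁_scale]
    exact AllMoments.comp_hasLaw (f := fun g => ∑ i, E.lam i * (g i ^ 2 - 1))
      (hasLaw_eval_pi_stdPi (0 : Fin 1)) (allMoments_sum_sq_sub_one E.lam)
  · simp_rw [Design.form₁_scale]
    exact ((hasLaw_eval_pi_stdPi (0 : Fin 1)).integral_comp
      (allMoments_sum_sq_sub_one E.lam).1).trans (integral_sum_sq_sub_one E.lam)
  · simp_rw [Design.form₁_scale]
    exact (((hasLaw_eval_pi_stdPi (0 : Fin 1)).integral_comp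
      ((allMoments_sum_sq_sub_one E.lam).pow 2).1).trans (integral_sum_sq_sub_one_sq E.lam)).le

lemma IsModel.isUKernel₂ (hs : s.IsModel P) :
    IsUKernel P s.data (E.contrastKernel ![0, 2] ![1, 3] E.form₂ (m := 4))
      ((1 + gaussMoment6 ^ 2) * (∑ i, E.lam i ^ 2) ^ 2) := by
  have hA := (allMoments_wInner_eval (0 : Fin 2) 1 E.lam).pow 2
  have h1 := integral_wInner_eval_pow (show (0 : Fin 2) ≠ 1 by decide) E.lam 2
  rw [integral_wInner_sq] at h1
  refine hs.isUKernel (by decide) E.measurable_form₂ ?_ ?_ ?_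
  · simp_rw [Design.form₂_scale]
    exact hA.sub (AllMoments.const _)
  · simp_rw [Design.form₂_scale]
    rw [integral_sub hA.integrable (integrable_const _), h1]
    simp
  · simp_rw [Design.form₂_scale]
    refine (integral_sub_sq_le hA h1).trans ?_
    simp_rw [← pow_mul]
    exact (integral_wInner_eval_pow (by decide) E.lam (2 * 2)).le.trans
      (integral_wInner_pow_four_le E.lam E.sum_lam_sq_pos)

lemma IsModel.isUKernel₃ (hs : s.IsModel P) :
    IsUKernel P s.data (E.contrastKernel ![0, 2, 4] ![1, 3, 5] E.form₃ (m := 6))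
      (gaussMoment6 ^ 2 * (∑ i, E.lam i ^ 2) ^ 3) := by
  have hA := ((allMoments_wInner_eval (0 : Fin 3) 1 E.lam).mul
    (allMoments_wInner_eval (1 : Fin 3) 2 E.lam)).mul (allMoments_wInner_eval (2 : Fin 3) 0 E.lam)
  refine hs.isUKernel (by decide) E.measurable_form₃ ?_ ?_ ?_
  · simp_rw [Design.form₃_scale]
    exact hA.sub (AllMoments.const _)
  · simp_rw [Design.form₃_scale]
    rw [integral_sub hA.integrable (integrable_const _), integral_wInner_triple]
    simp
  · simp_rw [Design.form₃_scale]
    exact (integral_sub_sq_le hA (integral_wInner_triple E.lam)).trans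
      (integral_wInner_triple_sq_le E.lam)

end Sample

/-! ### Mean square errors of the trace estimators -/

lemma Design.six_le_nMin (E : Design) : 6 ≤ E.nMin := by
  obtain ⟨p⟩ := E.exists_index
  have : Nonempty (Fin E.a) := ⟨p.1⟩
  exact le_ciInf E.six_le_n

lemma Design.card_embedding_ne_zero (E : Design) {m : ℕ} (hm : m ≤ 6) :
    (Fintype.card (Fin m ↪ Fin E.nMin) : ℝ) ≠ 0 := by
  rw [card_embedding_eq_factorial_mul]
  have h : 0 < E.nMin.choose m := Nat.choose_pos (hm.trans E.six_le_nMin)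
  have h' := m.factorial_pos
  positivity

namespace Sample

variable {E : Design} {Ω : Type*} {s : Sample E Ω}

lemma avg_contrastKernel {r m : ℕ} (hm : m ≤ 6) {e₀ e₁ : Fin r → Fin m}
    {ψ : (Fin r → E.Ix → ℝ) → ℝ} {K : (Fin m ↪ Fin E.nMin) → ℝ} {c t : ℝ} {p x}
    (h : ∀ l, K l = c * (E.contrastKernel e₀ e₁ ψ p l x + t)) :
    ∑ l, K l / (Fintype.card (Fin m ↪ Fin E.nMin) : ℝ) =
      c * (IsUKernel.avg (E.contrastKernel e₀ e₁ ψ) p x + t) := by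
  have hc := E.card_embedding_ne_zero hm
  rw [← Finset.sum_div]
  simp_rw [h, mul_add, Finset.sum_add_distrib, ← Finset.mul_sum]
  rw [IsUKernel.avg]
  simp only [Finset.sum_const, Finset.card_univ, nsmul_eq_mul]
  field_simp

lemma average_add_const {υ : ℕ} (hυ : 0 < υ) (c : ℝ) (hc : c ≠ 0) (A : ℕ → ℝ) (t : ℝ) :
    1 / (c * υ) * ∑ j ∈ Finset.range υ, c * (A j + t) =
      (υ : ℝ)⁻¹ * ∑ j ∈ Finset.range υ, A j + t := by
  have h : (υ : ℝ) ≠ 0 := by exact_mod_cast hυ.ne'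
  rw [← Finset.mul_sum, Finset.sum_add_distrib]
  simp only [Finset.sum_const, Finset.card_range, nsmul_eq_mul]
  field_simp

/-- Separating the trace leaves an average of centred kernels over all injective tuples; symmetry of
the kernel removes the restriction to ordered pairs. -/
lemma B₁_eq {υ : ℕ} (hυ : 0 < υ) (ω : Ω) : s.B₁ υ ω = (υ : ℝ)⁻¹ * ∑ j ∈ Finset.range υ,
    IsUKernel.avg (E.contrastKernel ![0] ![1] E.form₁ (m := 2)) (s.perm j ω) (s.data ω) +
      ∑ i, E.lam i := by
  rw [B₁, ← average_add_const hυ 2 two_ne_zero]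
  congr 1
  refine Finset.sum_congr rfl fun j _ => ?_
  rw [← avg_contrastKernel (by norm_num) fun l => s.kernel₁_eq j l ω, ← Finset.sum_div,
    ← Finset.sum_div, card_embedding_eq_factorial_mul]
  have h := sum_filter_lt_eq_half (show (0 : Fin 2) ≠ 1 by decide)
    (F := fun l => s.kernel₁ j l ω) (fun l => kernel₁_swap j l ω) (fun _ => True) fun _ => Iff.rfl
  simp only [and_true, Finset.filter_true] at h
  rw [← h]
  exact (mul_div_mul_left _ _ two_ne_zero).symm

lemma B₂_eq {υ : ℕ} (hυ : 0 < υ) (ω : Ω) : s.B₂ υ ω = (υ : ℝ)⁻¹ * ∑ j ∈ Finset.range υ,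
    IsUKernel.avg (E.contrastKernel ![0, 2] ![1, 3] E.form₂ (m := 4)) (s.perm j ω) (s.data ω) +
      ∑ i, E.lam i ^ 2 := by
  rw [B₂, ← average_add_const hυ 4 four_ne_zero]
  congr 1
  refine Finset.sum_congr rfl fun j _ => ?_
  rw [← avg_contrastKernel (by norm_num) fun l => s.kernel₂_eq j l ω, ← Finset.sum_div,
    ← Finset.sum_div, card_embedding_eq_factorial_mul]
  have h1 := sum_filter_lt_eq_half (show (0 : Fin 4) ≠ 1 by decide)
    (F := fun l => s.kernel₂ j l ω) (fun l => kernel₂_swap_left j l ω) (fun l => l 2 < l 3)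
    fun l => by
      have h2 : Equiv.swap (0 : Fin 4) 1 2 = 2 := by decide
      have h3 : Equiv.swap (0 : Fin 4) 1 3 = 3 := by decide
      simp [h2, h3]
  have h2 := sum_filter_lt_eq_half (show (2 : Fin 4) ≠ 3 by decide)
    (F := fun l => s.kernel₂ j l ω) (fun l => kernel₂_swap_right j l ω) (fun _ => True)
    fun _ => Iff.rfl
  simp only [and_true, Finset.filter_true] at h2
  rw [← h2, ← h1, ← mul_assoc]
  -- Of the `4!` arrangements of four indices a quarter satisfies both order conditions, which
  -- accounts for the factor `6`.
  have e : ((4).factorial : ℝ) * (E.nMin.choose 4 : ℝ) = (2 * 2) * (6 * E.nMin.choose 4) := by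
    norm_num [Nat.factorial]
    ring
  rw [e]
  exact (mul_div_mul_left _ _ (by norm_num)).symm

lemma B₃_eq {υ : ℕ} (hυ : 0 < υ) (ω : Ω) : s.B₃ υ ω = (υ : ℝ)⁻¹ * ∑ j ∈ Finset.range υ,
    IsUKernel.avg (E.contrastKernel ![0, 2, 4] ![1, 3, 5] E.form₃ (m := 6)) (s.perm j ω)
      (s.data ω) + ∑ i, E.lam i ^ 3 := by
  rw [B₃, ← average_add_const hυ 8 (by norm_num)]
  congr 1
  refine Finset.sum_congr rfl fun j _ => ?_
  rw [← avg_contrastKernel le_rfl fun l => s.kernel₃_eq j l ω, Fintype.card_embedding_eq,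
    Fintype.card_fin, Fintype.card_fin]

lemma average_average_add_const {υ₁ υ₂ : ℕ} (hυ₁ : 0 < υ₁) (hυ₂ : 0 < υ₂) (c : ℝ) (hc : c ≠ 0)
    (A : ℕ → ℕ → ℝ) (t : ℝ) :
    1 / (c * υ₁ * υ₂) * ∑ j ∈ Finset.range υ₁, ∑ u ∈ Finset.range υ₂, c * (A j u + t) =
      (υ₁ : ℝ)⁻¹ * ∑ j ∈ Finset.range υ₁, ((υ₂ : ℝ)⁻¹ * ∑ u ∈ Finset.range υ₂, A j u) + t := by
  rw [← average_add_const hυ₁ c hc]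
  have h : ∀ j, (υ₂ : ℝ)⁻¹ * ∑ u ∈ Finset.range υ₂, A j u + t =
      1 / (c * υ₂) * ∑ u ∈ Finset.range υ₂, c * (A j u + t) := fun j =>
    (average_add_const hυ₂ c hc (A j) t).symm
  simp_rw [h]
  rw [← Finset.mul_sum, ← Finset.mul_sum, ← mul_assoc, ← mul_assoc]
  congr 1
  field_simp

lemma B₁star_eq {υ₁ υ₂ : ℕ} (hυ₁ : 0 < υ₁) (hυ₂ : 0 < υ₂) (ω : Ω) : s.B₁star υ₁ υ₂ ω =
    (υ₁ : ℝ)⁻¹ * ∑ j ∈ Finset.range υ₁, ((υ₂ : ℝ)⁻¹ * ∑ u ∈ Finset.range υ₂,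
      E.contrastKernel ![0] ![1] E.form₁ (s.perm j ω) (s.σ₂ u ω) (s.data ω)) +
      ∑ i, E.lam i := by
  simp_rw [B₁star, kernel₁_eq]
  exact average_average_add_const hυ₁ hυ₂ 2 two_ne_zero _ _

lemma B₂star_eq {υ₁ υ₂ : ℕ} (hυ₁ : 0 < υ₁) (hυ₂ : 0 < υ₂) (ω : Ω) : s.B₂star υ₁ υ₂ ω =
    (υ₁ : ℝ)⁻¹ * ∑ j ∈ Finset.range υ₁, ((υ₂ : ℝ)⁻¹ * ∑ u ∈ Finset.range υ₂,
      E.contrastKernel ![0, 2] ![1, 3] E.form₂ (s.perm j ω) (s.σ₄ u ω) (s.data ω)) +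
      ∑ i, E.lam i ^ 2 := by
  simp_rw [B₂star, kernel₂_eq]
  exact average_average_add_const hυ₁ hυ₂ 4 four_ne_zero _ _

lemma B₃star_eq {υ₁ υ₂ : ℕ} (hυ₁ : 0 < υ₁) (hυ₂ : 0 < υ₂) (ω : Ω) : s.B₃star υ₁ υ₂ ω =
    (υ₁ : ℝ)⁻¹ * ∑ j ∈ Finset.range υ₁, ((υ₂ : ℝ)⁻¹ * ∑ u ∈ Finset.range υ₂,
      E.contrastKernel ![0, 2, 4] ![1, 3, 5] E.form₃ (s.perm j ω) (s.σ₆ u ω) (s.data ω)) +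
      ∑ i, E.lam i ^ 3 := by
  simp_rw [B₃star, kernel₃_eq]
  exact average_average_add_const hυ₁ hυ₂ 8 (by norm_num) _ _

/-- All subsamples as one random element. -/
def subsamples (s : Sample E Ω) (ω : Ω) :
    (ℕ → (Fin 2 ↪ Fin E.nMin)) × (ℕ → (Fin 4 ↪ Fin E.nMin)) × (ℕ → (Fin 6 ↪ Fin E.nMin)) :=
  ((fun u => s.σ₂ u ω), (fun u => s.σ₄ u ω), (fun u => s.σ₆ u ω))

variable [MeasurableSpace Ω] {P : Measure Ω}

lemma IsModel.aemeasurable_perm (hs : s.IsModel P) (j : ℕ) : AEMeasurable (s.perm j) P :=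
  aemeasurable_pi_lambda _ fun i => (hs.law_π j i).aemeasurable

lemma IsModel.indepFun_data_perm (hs : s.IsModel P) (j : ℕ) : IndepFun s.data (s.perm j) P :=
  hs.indep_X_πσ.comp measurable_id ((measurable_pi_apply j).comp measurable_fst)

variable [IsProbabilityMeasure P]

/-- A mean square bound for averages over permutations and all tuples. -/
lemma IsModel.average_avg_sq (hs : s.IsModel P) {m : ℕ}
    {h : (∀ i, Equiv.Perm (Fin (E.n i))) → (Fin m ↪ Fin E.nMin) → E.Data → ℝ} {M : ℝ}
    (hU : IsUKernel P s.data h M) (hM : 0 ≤ M) (υ : ℕ) :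
    AEStronglyMeasurable (fun ω => (υ : ℝ)⁻¹ * ∑ j ∈ Finset.range υ,
      IsUKernel.avg h (s.perm j ω) (s.data ω)) P ∧
    Integrable (fun ω => ((υ : ℝ)⁻¹ * ∑ j ∈ Finset.range υ,
      IsUKernel.avg h (s.perm j ω) (s.data ω)) ^ 2) P ∧
    ∫ ω, ((υ : ℝ)⁻¹ * ∑ j ∈ Finset.range υ, IsUKernel.avg h (s.perm j ω) (s.data ω)) ^ 2 ∂P ≤
      M * ((m : ℝ) ^ 2 / E.nMin) := by
  have hn : 0 < E.nMin := by linarith [E.six_le_nMin]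
  have hm : ∀ j, AEStronglyMeasurable (fun ω => IsUKernel.avg h (s.perm j ω) (s.data ω)) P :=
    fun j => (integral_finite_mixture (hs.aemeasurable_perm j) (hs.indepFun_data_perm j)
      (F := fun p x => IsUKernel.avg h p x) (fun p => hU.measurable_avg p)
      (fun p => (hU.allMoments_avg p).integrable)).1.1
  have hsq := fun j => hU.avg_sq hn hM (hs.aemeasurable_perm j) (hs.indepFun_data_perm j)
  exact ⟨(Finset.aestronglyMeasurable_fun_sum _ fun j _ => hm j).const_mul _,
    integral_sq_average_le (by positivity) hm (fun j => (hsq j).1) fun j => (hsq j).2⟩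

/-- A mean square bound for averages over permutations and random subsamples. -/
lemma IsModel.average_subsample_sq (hs : s.IsModel P) {m : ℕ}
    {h : (∀ i, Equiv.Perm (Fin (E.n i))) → (Fin m ↪ Fin E.nMin) → E.Data → ℝ} {M : ℝ}
    (hU : IsUKernel P s.data h M) (hM : 0 ≤ M) {σ : ℕ → Ω → (Fin m ↪ Fin E.nMin)}
    (hσ : ∀ u, HasLaw (σ u) (uniformOn Set.univ) P) (hσi : iIndepFun σ P)
    {φ : _ → ℕ → (Fin m ↪ Fin E.nMin)} (hφ : Measurable φ)
    (hφσ : ∀ u ω, σ u ω = φ (s.subsamples ω) u) (υ₁ : ℕ) {υ₂ : ℕ} (hυ₂ : 0 < υ₂) :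
    AEStronglyMeasurable (fun ω => (υ₁ : ℝ)⁻¹ * ∑ j ∈ Finset.range υ₁, ((υ₂ : ℝ)⁻¹ *
      ∑ u ∈ Finset.range υ₂, h (s.perm j ω) (σ u ω) (s.data ω))) P ∧
    Integrable (fun ω => ((υ₁ : ℝ)⁻¹ * ∑ j ∈ Finset.range υ₁, ((υ₂ : ℝ)⁻¹ *
      ∑ u ∈ Finset.range υ₂, h (s.perm j ω) (σ u ω) (s.data ω))) ^ 2) P ∧
    ∫ ω, ((υ₁ : ℝ)⁻¹ * ∑ j ∈ Finset.range υ₁, ((υ₂ : ℝ)⁻¹ *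
      ∑ u ∈ Finset.range υ₂, h (s.perm j ω) (σ u ω) (s.data ω))) ^ 2 ∂P ≤
      M * ((υ₂ : ℝ)⁻¹ + (m : ℝ) ^ 2 / E.nMin) := by
  have hn : 0 < E.nMin := by linarith [E.six_le_nMin]
  have hφu : ∀ u, Measurable fun q => φ q u := fun u => (measurable_pi_apply u).comp hφ
  -- `φ` picks one of the three sequences of subsamples, so the joint independence assumptions pass
  -- to it along measurable maps.
  have h1 : ∀ j u v, IndepFun (s.perm j) (fun ω => (σ u ω, σ v ω)) P := fun j u v => by
    simp_rw [hφσ]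
    exact hs.indep_π_σ.comp (measurable_pi_apply j) ((hφu u).prodMk (hφu v))
  have h2 : ∀ j u v, IndepFun s.data (fun ω => (s.perm j ω, σ u ω, σ v ω)) P := fun j u v => by
    simp_rw [hφσ]
    exact hs.indep_X_πσ.comp measurable_id (((measurable_pi_apply j).comp measurable_fst).prodMk
      (((hφu u).comp measurable_snd).prodMk ((hφu v).comp measurable_snd)))
  have hsq := fun j => hU.subsample_sq hn hM (hs.aemeasurable_perm j) hσ
    (fun u v huv => hσi.indepFun huv) (h1 j) (h2 j) hυ₂
  exact ⟨(Finset.aestronglyMeasurable_fun_sum _ fun j _ => (hsq j).1).const_mul _,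
    integral_sq_average_le (by positivity) (fun j => (hsq j).1) (fun j => (hsq j).2.1)
      fun j => (hsq j).2.2⟩

end Sample

/-! ### The exactly standardized statistic -/

lemma charFun_sum_sq_sub_one {ι : Type*} [Fintype ι] (w : ι → ℝ) (t : ℝ) :
    charFun ((stdPi ι).map fun g => ∑ i, w i / √2 * (g i ^ 2 - 1)) t =
      ∏ i, chiChar (t * w i) := by
  have hi : iIndepFun (fun i (g : ι → ℝ) => w i / √2 * (g i ^ 2 - 1)) (stdPi ι) :=
    iIndepFun_pi (μ := fun _ : ι => gaussianReal 0 1) (X := fun i x => w i / √2 * (x ^ 2 - 1))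
      fun i => by fun_prop
  have hm : ∀ i, Measurable fun g : ι → ℝ => w i / √2 * (g i ^ 2 - 1) := fun i => by fun_prop
  rw [hi.charFun_map_fun_sum_eq_prod fun i => (hm i).aemeasurable, Finset.prod_apply]
  refine Finset.prod_congr rfl fun i _ => ?_
  have e : (fun g : ι → ℝ => w i / √2 * (g i ^ 2 - 1)) =
      (fun x => w i * ((x ^ 2 - 1) / √2)) ∘ fun g => g i := by
    ext g
    simp only [Function.comp]
    ring
  rw [e, ← Measure.map_map (by fun_prop) (by fun_prop), (hasLaw_eval_stdPi i).map_eq,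
    charFun_map_mul_comp (by fun_prop), chiChar, mul_comm]

namespace Sample

variable {E : Design} {Ω : Type*} [MeasurableSpace Ω] {P : Measure Ω} [IsProbabilityMeasure P]
  {s : Sample E Ω}

/-- An exact identity in law for every design; the asymptotics enter only through the weights. -/
lemma IsModel.identDistrib_Wtilde (hs : s.IsModel P) (h0 : E.NullHypothesis) :
    IdentDistrib s.Wtilde (fun g => ∑ i, E.lam i / √(∑ i, E.lam i ^ 2) / √2 * (g i ^ 2 - 1)) P
      (stdPi E.Ix) := by
  -- These weights turn the pooled vector into `√N (Xbar - μ)`; their squares sum to `n i · N / (n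
  -- i)² = N / n i`, so `v = 1`.
  let W : Fin 1 → ∀ i, Fin (E.n i) → ℝ := fun _ i _ => √(E.N : ℝ) / E.n i
  have hW : ∀ m m' i, ∑ j, W m i j * W m' i j =
      if m = m' then 1 * ((E.N : ℝ) / E.n i) else 0 := by
    intro m m' i
    have hn : (E.n i : ℝ) ≠ 0 := by exact_mod_cast (E.n_pos i).ne'
    have hN : √(E.N : ℝ) * √(E.N : ℝ) = E.N := Real.mul_self_sqrt (Nat.cast_nonneg _)
    rw [if_pos (Subsingleton.elim m m')]
    simp only [W, Finset.sum_const, Finset.card_univ, Fintype.card_fin, nsmul_eq_mul]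
    rw [div_mul_div_comm, hN]
    field_simp
  have hu : Measurable fun c : Fin 1 → E.Ix → ℝ =>
      (c 0 ⬝ᵥ c 0 - ∑ i, E.lam i) / √(2 * ∑ i, E.lam i ^ 2) :=
    ((E.measurable_dotProduct_eval 0 0).sub_const _).div_const _
  have h1 := (hs.identDistrib_pooled W zero_le_one hW).comp hu
  have e1 : s.Wtilde = (fun c : Fin 1 → E.Ix → ℝ =>
      (c 0 ⬝ᵥ c 0 - ∑ i, E.lam i) / √(2 * ∑ i, E.lam i ^ 2)) ∘
      fun ω m => E.coord *ᵥ E.pooled (W m) (s.data ω) := by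
    ext ω
    have h2 : E.pooled (W 0) (s.data ω) =
        √(E.N : ℝ) • (s.Xbar ω - fun p => E.μ p.1 p.2) := by
      ext p
      have hn : (E.n p.1 : ℝ) ≠ 0 := by exact_mod_cast (E.n_pos p.1).ne'
      simp only [Design.pooled, W, data, Xbar, Pi.smul_apply, Pi.sub_apply, smul_eq_mul]
      rw [← Finset.mul_sum, Finset.sum_sub_distrib]
      simp only [Finset.sum_const, Finset.card_univ, Fintype.card_fin, nsmul_eq_mul]
      field_simp
    -- Here the null hypothesis enters: `coord` annihilates `μ`, so centring makes no difference.
    have h3 : E.coord *ᵥ E.pooled (W 0) (s.data ω) = √(E.N : ℝ) • E.coord *ᵥ s.Xbar ω := by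
      rw [h2, mulVec_smul, mulVec_sub, E.coord_mulVec_eq_zero h0, sub_zero]
    have h4 := E.trace_pow 0
    rw [zero_add, pow_one] at h4
    simp only [Function.comp, h3, smul_dotProduct, dotProduct_smul, smul_eq_mul]
    rw [← mul_assoc, Real.mul_self_sqrt (Nat.cast_nonneg _), Wtilde, Q, Design.dotProduct_T_mulVec,
      h4, E.trace_pow 1]
    simp only [pow_one]
    rfl
  have e2 : ((fun c : Fin 1 → E.Ix → ℝ =>
      (c 0 ⬝ᵥ c 0 - ∑ i, E.lam i) / √(2 * ∑ i, E.lam i ^ 2)) ∘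
      fun (g : Fin 1 → E.Ix → ℝ) m i => √(1 * E.lam i) * g m i) = fun g =>
        ∑ i, E.lam i / √(∑ i, E.lam i ^ 2) / √2 * (g 0 i ^ 2 - 1) := by
    ext g
    have h2 : ∀ i, E.lam i / √(∑ i, E.lam i ^ 2) / √2 * (g 0 i ^ 2 - 1) =
        (E.lam i * g 0 i ^ 2 - E.lam i) / √(2 * ∑ i, E.lam i ^ 2) := fun i => by
      rw [Real.sqrt_mul zero_le_two]
      field_simp
    have h3 : ∀ i, √(E.lam i) * g 0 i * (√(E.lam i) * g 0 i) = E.lam i * g 0 i ^ 2 := fun i => by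
      rw [mul_mul_mul_comm, Real.mul_self_sqrt (E.lam_nonneg i), sq]
    simp_rw [h2]
    rw [← Finset.sum_div, Finset.sum_sub_distrib]
    simp only [Function.comp, dotProduct, one_mul, h3]
  rw [← e1, e2] at h1
  have hm : Measurable fun g : E.Ix → ℝ =>
      ∑ i, E.lam i / √(∑ i, E.lam i ^ 2) / √2 * (g i ^ 2 - 1) := by fun_prop
  have h2 := Measure.map_map (μ := Measure.pi fun _ : Fin 1 => stdPi E.Ix) hm
    (measurable_pi_apply 0)
  rw [(hasLaw_eval_pi_stdPi (0 : Fin 1)).map_eq] at h2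
  exact ⟨h1.aemeasurable_fst, hm.aemeasurable, h1.map_eq.trans h2.symm⟩

lemma IsModel.charFun_Wtilde (hs : s.IsModel P) (h0 : E.NullHypothesis) (t : ℝ) :
    charFun (P.map s.Wtilde) t =
      ∏ r ∈ Finset.range (Fintype.card E.Ix), chiChar (t * E.β r) := by
  rw [(hs.identDistrib_Wtilde h0).map_eq, E.prod_range_β fun x => chiChar (t * x)]
  exact charFun_sum_sq_sub_one (fun i => E.lam i / √(∑ i, E.lam i ^ 2)) t

lemma IsModel.integral_Wtilde_sq (hs : s.IsModel P) (h0 : E.NullHypothesis) :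
    Integrable (fun ω => s.Wtilde ω ^ 2) P ∧ ∫ ω, s.Wtilde ω ^ 2 ∂P = 1 := by
  have h := hs.identDistrib_Wtilde h0
  have hA := allMoments_sum_sq_sub_one fun i => E.lam i / √(∑ i, E.lam i ^ 2) / √2
  refine ⟨(AllMoments.of_identDistrib h hA).integrable_pow 2, ?_⟩
  refine ((h.comp (u := fun x => x ^ 2) (by fun_prop)).integral_eq).trans ?_
  refine (integral_sum_sq_sub_one_sq _).trans ?_
  simp_rw [div_pow]
  rw [Real.sq_sqrt zero_le_two, Real.sq_sqrt E.sum_lam_sq_pos.le, ← Finset.sum_div,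
    ← Finset.sum_div, div_self E.sum_lam_sq_pos.ne']
  norm_num

end Sample

/-! ### Consistency of the trace estimators -/

section Consistency

variable {E : ℕ → Design} {Ω : ℕ → Type*} [∀ k, MeasurableSpace (Ω k)] {P : ∀ k, Measure (Ω k)}

/-- Ratio-consistency of estimators of the traces of the first three powers of `T V`, relative to
the powers of the Frobenius norm. -/
structure IsConsistent (E : ℕ → Design) (P : ∀ k, Measure (Ω k)) (B₁ B₂ B₃ : ∀ k, Ω k → ℝ) :
    Prop where
  aemeasurable₁ : ∀ k, AEMeasurable (B₁ k) (P k)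
  aemeasurable₂ : ∀ k, AEMeasurable (B₂ k) (P k)
  tendsto₁ : TendstoZeroInProb P fun k ω =>
    (B₁ k ω - ∑ i, (E k).lam i) / √(∑ i, (E k).lam i ^ 2)
  tendsto₂ : TendstoZeroInProb P fun k ω =>
    (B₂ k ω - ∑ i, (E k).lam i ^ 2) / √(∑ i, (E k).lam i ^ 2) ^ 2
  tendsto₃ : TendstoZeroInProb P fun k ω =>
    (B₃ k ω - ∑ i, (E k).lam i ^ 3) / √(∑ i, (E k).lam i ^ 2) ^ 3

/-- The denominator is at least `1/8` and the numerator of the difference at most `3δ + 5δ`. -/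
lemma abs_sq_div_cube_sub_sq_le {c r q δ : ℝ} (hc : c ∈ Set.Icc (0 : ℝ) 1) (hδ : δ ≤ 1 / 2)
    (hr : |r| ≤ δ) (hq : |q| ≤ δ) : |(c + r) ^ 2 / (1 + q) ^ 3 - c ^ 2| ≤ 64 * δ := by
  have hδ0 : 0 ≤ δ := (abs_nonneg _).trans hr
  have hr' := abs_le.1 hr
  have hq' := abs_le.1 hq
  have h1 : 1 / 8 ≤ (1 + q) ^ 3 := by
    have := pow_le_pow_left₀ (by norm_num : (0 : ℝ) ≤ 1 / 2) (by linarith : 1 / 2 ≤ 1 + q) 3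
    norm_num at this ⊢
    exact this
  have h2 : (c + r) ^ 2 / (1 + q) ^ 3 - c ^ 2 =
      (r * (2 * c + r) - c ^ 2 * (q * (3 + 3 * q + q ^ 2))) / (1 + q) ^ 3 := by
    rw [eq_div_iff (by positivity), sub_mul, div_mul_cancel₀ _ (by positivity)]
    ring
  have h3 : |r * (2 * c + r)| ≤ δ * 3 := by
    rw [abs_mul]
    exact mul_le_mul hr (abs_le.2 ⟨by linarith [hc.1], by linarith [hc.2]⟩) (abs_nonneg _) hδ0
  have h4 : |c ^ 2 * (q * (3 + 3 * q + q ^ 2))| ≤ 1 * (δ * 5) := by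
    rw [abs_mul, abs_mul]
    refine mul_le_mul ?_ (mul_le_mul hq ?_ (abs_nonneg _) hδ0) (by positivity) zero_le_one
    · rw [abs_of_nonneg (sq_nonneg c)]
      exact pow_le_one₀ hc.1 hc.2
    · rw [abs_le]
      constructor <;> nlinarith
  rw [h2, abs_div, abs_of_pos (by positivity : (0 : ℝ) < (1 + q) ^ 3), div_le_iff₀ (by positivity)]
  have h5 := (abs_sub _ _).trans (add_le_add h3 h4)
  nlinarith

lemma IsConsistent.tendsto_one_div {B₁ B₂ B₃ : ∀ k, Ω k → ℝ} (h : IsConsistent E P B₁ B₂ B₃) :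
    TendstoZeroInProb P fun k ω => 1 / (B₂ k ω ^ 3 / B₃ k ω ^ 2) - 1 / (E k).fP := by
  refine h.tendsto₂.mono₂ h.tendsto₃ fun ε hε => ⟨min (1 / 2) (ε / 128), by positivity,
    fun k ω h2 h3 => ?_⟩
  set t := ∑ i, (E k).lam i ^ 2 with ht
  have ht0 : 0 < t := (E k).sum_lam_sq_pos
  have hr0 : 0 < √t := Real.sqrt_pos.2 ht0
  have hc := (E k).sum_β_cube
  rw [← ht] at hc
  have hc1 : (∑ i, (E k).lam i ^ 3) / √t ^ 3 ∈ Set.Icc (0 : ℝ) 1 := by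
    rw [← hc]
    exact ⟨(E k).sum_β_cube_nonneg, (E k).sum_β_cube_le.trans (E k).β_zero_le_one⟩
  rw [(E k).one_div_fP, hc, one_div_div]
  -- The ratio is invariant under scaling the spectrum. Normalizing by powers of `√t` turns it into
  -- a perturbation of `(∑ β_s³)²`.
  have e : B₃ k ω ^ 2 / B₂ k ω ^ 3 = ((∑ i, (E k).lam i ^ 3) / √t ^ 3 +
      (B₃ k ω - ∑ i, (E k).lam i ^ 3) / √t ^ 3) ^ 2 /
      (1 + (B₂ k ω - t) / √t ^ 2) ^ 3 := by
    have e1 : 1 + (B₂ k ω - t) / √t ^ 2 = B₂ k ω / √t ^ 2 := by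
      rw [Real.sq_sqrt ht0.le]
      field_simp
      ring
    rw [← add_div, add_sub_cancel, e1, div_pow, div_pow, ← pow_mul, ← pow_mul]
    norm_num
    rw [div_div_div_cancel_right₀ (by positivity)]
  rw [e]
  refine (abs_sq_div_cube_sub_sq_le hc1 (min_le_left _ _) h3.le h2.le).trans_lt ?_
  have := min_le_right (1 / 2) (ε / 128)
  linarith

lemma abs_standardize_sub_le {w r q : ℝ} (hq : |q| ≤ 1 / 2) :
    |(w - r / √2) / √(1 + q) - w| ≤ 2 * |w * q| + 2 * |r| := by
  have hq' := abs_le.1 hq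
  set m := √(1 + q) with hm
  have hm2 : m ^ 2 = 1 + q := Real.sq_sqrt (by linarith)
  have hm1 : 1 / 2 ≤ m := Real.le_sqrt_of_sq_le (by linarith)
  have h2 : 1 ≤ √2 := Real.one_le_sqrt.2 one_le_two
  -- With `q = m² - 1 = (m - 1)(m + 1)` the effect of the estimated scale becomes a multiple of `w *
  -- q`.
  have e : (w - r / √2) / m - w = -(w * q) / (m * (1 + m)) - r / (√2 * m) := by
    have e1 : q = m ^ 2 - 1 := by linarith
    rw [e1]
    field_simp
    ring
  rw [e]
  refine (abs_sub _ _).trans (add_le_add ?_ ?_)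
  · rw [abs_div, abs_neg, abs_of_pos (by positivity : 0 < m * (1 + m)), div_le_iff₀ (by positivity)]
    have : 1 ≤ 2 * (m * (1 + m)) := by nlinarith
    nlinarith [abs_nonneg (w * q)]
  · rw [abs_div, abs_of_pos (by positivity : 0 < √2 * m), div_le_iff₀ (by positivity)]
    have : 1 ≤ 2 * (√2 * m) := by nlinarith
    nlinarith [abs_nonneg r]

/-- `Wtilde` has second moment one, so its product with the relative error of `B₂` still tends to
zero in probability; the error of `B₁` enters additively. -/
lemma IsConsistent.tendsto_standardize [∀ k, IsProbabilityMeasure (P k)]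
    {B₁ B₂ B₃ : ∀ k, Ω k → ℝ} (h : IsConsistent E P B₁ B₂ B₃) {s : ∀ k, Sample (E k) (Ω k)}
    (hs : ∀ k, (s k).IsModel (P k)) (h0 : ∀ k, (E k).NullHypothesis) :
    TendstoZeroInProb P fun k ω =>
      ((s k).Q ω - B₁ k ω) / √(2 * B₂ k ω) - (s k).Wtilde ω := by
  have hW := TendstoZeroInProb.mul_of_integral_sq_le
    (fun k => ((hs k).integral_Wtilde_sq (h0 k)).1)
    (fun k => ((hs k).integral_Wtilde_sq (h0 k)).2.le) h.tendsto₂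
  refine (hW.max h.tendsto₁).mono₂ h.tendsto₂ fun ε hε => ⟨min (1 / 2) (ε / 8), by positivity,
    fun k ω h1 h2 => ?_⟩
  rw [abs_of_nonneg (le_max_of_le_left (abs_nonneg _)), max_lt_iff] at h1
  set t := ∑ i, (E k).lam i ^ 2 with ht
  have ht0 : 0 < t := (E k).sum_lam_sq_pos
  have hr0 : 0 < √t := Real.sqrt_pos.2 ht0
  set q := (B₂ k ω - t) / √t ^ 2 with hq
  set r := (B₁ k ω - ∑ i, (E k).lam i) / √t with hr
  have hB₂ : 2 * B₂ k ω = 2 * t * (1 + q) := by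
    rw [hq, Real.sq_sqrt ht0.le]
    field_simp
    ring
  have hB₁ : B₁ k ω = ∑ i, (E k).lam i + √t * r := by
    rw [hr]
    field_simp
    ring
  have hWt : (s k).Wtilde ω = ((s k).Q ω - ∑ i, (E k).lam i) / √(2 * t) := by
    have h4 := (E k).trace_pow 0
    rw [zero_add, pow_one] at h4
    rw [Sample.Wtilde, h4, (E k).trace_pow 1]
    simp only [pow_one]
    rfl
  have e : ((s k).Q ω - B₁ k ω) / √(2 * B₂ k ω) =
      ((s k).Wtilde ω - r / √2) / √(1 + q) := by
    rw [hB₂, hB₁, hWt, Real.sqrt_mul (by positivity), ← div_div, Real.sqrt_mul zero_le_two]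
    congr 1
    field_simp
    ring
  rw [e]
  have hm1 := min_le_left (1 / 2) (ε / 8)
  have hm2 := min_le_right (1 / 2) (ε / 8)
  refine (abs_standardize_sub_le (by linarith)).trans_lt ?_
  linarith

end Consistency

/-! ### The estimators of the design -/

section Estimators

variable {E : ℕ → Design} {Ω : ℕ → Type*} [∀ k, MeasurableSpace (Ω k)] {P : ∀ k, Measure (Ω k)}
  [∀ k, IsProbabilityMeasure (P k)]

/-- The bounds are required only eventually because the number of subsamples may vanish for small
`k`. -/
lemma tendstoZeroInProb_div_sqrt_pow {A : ∀ k, Ω k → ℝ} {t : ℕ → ℝ} (ht : ∀ k, 0 < t k) (r : ℕ)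
    {C : ℝ} {x : ℕ → ℝ} (hx : Tendsto x atTop (𝓝 0))
    (h : ∀ᶠ k in atTop, Integrable (fun ω => A k ω ^ 2) (P k) ∧
      ∫ ω, A k ω ^ 2 ∂(P k) ≤ C * t k ^ r * x k) :
    TendstoZeroInProb P fun k ω => A k ω / √(t k) ^ r := by
  have e : ∀ k ω, (A k ω / √(t k) ^ r) ^ 2 = A k ω ^ 2 / t k ^ r := fun k ω => by
    rw [div_pow, ← pow_mul, mul_comm r, pow_mul, Real.sq_sqrt (ht k).le]
  refine tendstoZeroInProb_of_tendsto_integral_sq (h.mono fun k hk => ?_) ?_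
  · simp_rw [e]
    exact hk.1.div_const _
  · simp_rw [e, integral_div]
    have h0 : Tendsto (fun k => C * x k) atTop (𝓝 0) := by simpa using hx.const_mul C
    refine squeeze_zero' (Eventually.of_forall fun k => ?_) (h.mono fun k hk => ?_) h0
    · exact div_nonneg (integral_nonneg fun ω => sq_nonneg _) (pow_nonneg (ht k).le r)
    · rw [div_le_iff₀ (pow_pos (ht k) r)]
      exact hk.2.trans (le_of_eq (by ring))

lemma tendsto_const_div_nMin (hn : Tendsto (fun k => (E k).nMin) atTop atTop) (c : ℝ) :
    Tendsto (fun k => c / ((E k).nMin : ℝ)) atTop (𝓝 0) :=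
  (tendsto_natCast_atTop_atTop.comp hn).const_div_atTop c

lemma tendsto_inv_add_const_div_nMin (hn : Tendsto (fun k => (E k).nMin) atTop atTop) {υ : ℕ → ℕ}
    (hυ : Tendsto υ atTop atTop) (c : ℝ) :
    Tendsto (fun k => (υ k : ℝ)⁻¹ + c / ((E k).nMin : ℝ)) atTop (𝓝 0) := by
  simpa using ((tendsto_natCast_atTop_atTop (R := ℝ)).comp hυ).inv_tendsto_atTop.add
    (tendsto_const_div_nMin hn c)

variable {s : ∀ k, Sample (E k) (Ω k)}

lemma isConsistent_B (hs : ∀ k, (s k).IsModel (P k))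
    (hn : Tendsto (fun k => (E k).nMin) atTop atTop) {υ : ℕ → Fin 3 → ℕ}
    (hυ : ∀ k r, 0 < υ k r) :
    IsConsistent E P (fun k ω => (s k).B₁ (υ k 0) ω) (fun k ω => (s k).B₂ (υ k 1) ω)
      (fun k ω => (s k).B₃ (υ k 2) ω) := by
  have ht := fun k => (E k).sum_lam_sq_pos
  have hG : 0 ≤ gaussMoment6 ^ 2 := sq_nonneg _
  have h1 := fun k => (hs k).average_avg_sq (hs k).isUKernel₁
    (mul_nonneg zero_le_two (ht k).le) (υ k 0)
  have h2 := fun k => (hs k).average_avg_sq (hs k).isUKernel₂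
    (mul_nonneg (by linarith) (sq_nonneg _)) (υ k 1)
  have h3 := fun k => (hs k).average_avg_sq (hs k).isUKernel₃
    (mul_nonneg hG (pow_nonneg (ht k).le 3)) (υ k 2)
  simp_rw [Sample.B₁_eq (hυ _ 0), Sample.B₂_eq (hυ _ 1), Sample.B₃_eq (hυ _ 2)]
  refine ⟨fun k => (h1 k).1.aemeasurable.add_const _, fun k => (h2 k).1.aemeasurable.add_const _,
    ?_, ?_, ?_⟩
  · simp_rw [add_sub_cancel_right]
    have := tendstoZeroInProb_div_sqrt_pow (P := P) ht 1 (C := 2)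
      (tendsto_const_div_nMin hn ((2 : ℕ) ^ 2)) (Eventually.of_forall fun k =>
        ⟨(h1 k).2.1, (h1 k).2.2.trans (le_of_eq (by rw [pow_one]))⟩)
    simpa only [pow_one] using this
  · simp_rw [add_sub_cancel_right]
    exact tendstoZeroInProb_div_sqrt_pow ht 2 (tendsto_const_div_nMin hn ((4 : ℕ) ^ 2))
      (Eventually.of_forall fun k => (h2 k).2)
  · simp_rw [add_sub_cancel_right]
    exact tendstoZeroInProb_div_sqrt_pow ht 3 (tendsto_const_div_nMin hn ((6 : ℕ) ^ 2))
      (Eventually.of_forall fun k => (h3 k).2)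

lemma isConsistent_Bstar (hs : ∀ k, (s k).IsModel (P k))
    (hn : Tendsto (fun k => (E k).nMin) atTop atTop) {υ₁ υ₂ : ℕ → Fin 3 → ℕ}
    (hυ₁ : ∀ k r, 0 < υ₁ k r) (hυ₂ : ∀ r, Tendsto (fun k => υ₂ k r) atTop atTop) :
    IsConsistent E P (fun k ω => (s k).B₁star (υ₁ k 0) (υ₂ k 0) ω)
      (fun k ω => (s k).B₂star (υ₁ k 1) (υ₂ k 1) ω)
      (fun k ω => (s k).B₃star (υ₁ k 2) (υ₂ k 2) ω) := by
  have ht := fun k => (E k).sum_lam_sq_pos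
  have hG : 0 ≤ gaussMoment6 ^ 2 := sq_nonneg _
  have h1 := fun k (h : 0 < υ₂ k 0) => (hs k).average_subsample_sq (hs k).isUKernel₁
    (mul_nonneg zero_le_two (ht k).le) (hs k).law_σ₂ (hs k).indep_σ₂ (φ := fun q => q.1)
    measurable_fst (fun _ _ => rfl) (υ₁ k 0) h
  have h2 := fun k (h : 0 < υ₂ k 1) => (hs k).average_subsample_sq (hs k).isUKernel₂
    (mul_nonneg (by linarith) (sq_nonneg _)) (hs k).law_σ₄ (hs k).indep_σ₄ (φ := fun q => q.2.1)
    (measurable_fst.comp measurable_snd) (fun _ _ => rfl) (υ₁ k 1) h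
  have h3 := fun k (h : 0 < υ₂ k 2) => (hs k).average_subsample_sq (hs k).isUKernel₃
    (mul_nonneg hG (pow_nonneg (ht k).le 3)) (hs k).law_σ₆ (hs k).indep_σ₆ (φ := fun q => q.2.2)
    (measurable_snd.comp measurable_snd) (fun _ _ => rfl) (υ₁ k 2) h
  refine ⟨fun k => ?_, fun k => ?_, ?_, ?_, ?_⟩
  · rcases Nat.eq_zero_or_pos (υ₂ k 0) with h | h
    · simp [Sample.B₁star, h]
    · simp_rw [Sample.B₁star_eq (hυ₁ k 0) h]
      exact (h1 k h).1.aemeasurable.add_const _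
  · rcases Nat.eq_zero_or_pos (υ₂ k 1) with h | h
    · simp [Sample.B₂star, h]
    · simp_rw [Sample.B₂star_eq (hυ₁ k 1) h]
      exact (h2 k h).1.aemeasurable.add_const _
  · have := tendstoZeroInProb_div_sqrt_pow (P := P) ht 1 (C := 2)
      (A := fun k ω => (s k).B₁star (υ₁ k 0) (υ₂ k 0) ω - ∑ i, (E k).lam i)
      (tendsto_inv_add_const_div_nMin hn (hυ₂ 0) ((2 : ℕ) ^ 2)) ?_
    · simpa only [pow_one] using this
    · filter_upwards [(hυ₂ 0).eventually_gt_atTop 0] with k hk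
      simp_rw [Sample.B₁star_eq (hυ₁ k 0) hk, add_sub_cancel_right]
      exact ⟨(h1 k hk).2.1, (h1 k hk).2.2.trans (le_of_eq (by rw [pow_one]))⟩
  · refine tendstoZeroInProb_div_sqrt_pow ht 2
      (tendsto_inv_add_const_div_nMin hn (hυ₂ 1) ((4 : ℕ) ^ 2)) ?_
      (C := 1 + gaussMoment6 ^ 2)
    filter_upwards [(hυ₂ 1).eventually_gt_atTop 0] with k hk
    simp_rw [Sample.B₂star_eq (hυ₁ k 1) hk, add_sub_cancel_right]
    exact (h2 k hk).2
  · refine tendstoZeroInProb_div_sqrt_pow ht 3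
      (tendsto_inv_add_const_div_nMin hn (hυ₂ 2) ((6 : ℕ) ^ 2)) ?_
      (C := gaussMoment6 ^ 2)
    filter_upwards [(hυ₂ 2).eventually_gt_atTop 0] with k hk
    simp_rw [Sample.B₃star_eq (hυ₁ k 2) hk, add_sub_cancel_right]
    exact (h3 k hk).2

end Estimators

/-! ### Assembly of the theorem -/

lemma IsFramework.tendsto_nMin {E : ℕ → Design} (hE : IsFramework E) :
    Tendsto (fun k => (E k).nMin) atTop atTop := by
  rcases hE with ⟨-, h⟩ | ⟨-, h⟩ | h
  · exact tendsto_atTop_mono (fun k => min_le_right _ _) h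
  · exact tendsto_atTop_mono (fun k => min_le_right _ _) h
  · exact tendsto_atTop_mono (fun k => (min_le_right _ _).trans (min_le_right _ _)) h

namespace Sample

variable {E : Design} {Ω : Type*} {s : Sample E Ω}

lemma B₂_nonneg (υ : ℕ) (ω : Ω) : 0 ≤ s.B₂ υ ω :=
  mul_nonneg (by positivity) (Finset.sum_nonneg fun j _ => Finset.sum_nonneg fun l _ =>
    div_nonneg (sq_nonneg _) (by positivity))

lemma B₂star_nonneg (υ₁ υ₂ : ℕ) (ω : Ω) : 0 ≤ s.B₂star υ₁ υ₂ ω :=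
  mul_nonneg (by positivity) (Finset.sum_nonneg fun j _ => Finset.sum_nonneg fun u _ =>
    sq_nonneg _)

lemma IsModel.aemeasurable_Q [MeasurableSpace Ω] {P : Measure Ω} (hs : s.IsModel P) :
    AEMeasurable s.Q P := by
  have hX : ∀ p : E.Ix, AEMeasurable (fun ω => s.Xbar ω p) P := fun p => by
    refine (Finset.aemeasurable_fun_sum _ fun j _ => ?_).const_mul _
    have h : Measurable fun x : EuclideanSpace ℝ (Fin (E.d p.1)) => x p.2 := by fun_prop
    exact h.comp_aemeasurable (hs.law_X p.1 j).aemeasurable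
  refine (Finset.aemeasurable_fun_sum _ fun p _ => (hX p).mul ?_).const_mul _
  exact Finset.aemeasurable_fun_sum _ fun q _ => (hX q).const_mul _

end Sample

lemma chiSq_one_map_eq_pearsonLaw :
    (chiSq 1).map (fun x => (x - 1) / √2) = pearsonLaw (1 : ℝ)⁻¹ := by
  simp [pearsonLaw]

end SplitPlot

theorem mainTheorem6 (E : ℕ → SplitPlot.Design) (hE : SplitPlot.IsFramework E)
    {Ω : ℕ → Type*} [∀ k, MeasurableSpace (Ω k)]
    (P : ∀ k, Measure (Ω k)) [∀ k, IsProbabilityMeasure (P k)]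
    (s : ∀ k, SplitPlot.Sample (E k) (Ω k)) (hs : ∀ k, (s k).IsModel (P k))
    (υ υ₁ υ₂ : ℕ → Fin 3 → ℕ) (hυ : ∀ k r, 0 < υ k r) (hυ₁ : ∀ k r, 0 < υ₁ k r)
    (hυ₂ : ∀ r, Tendsto (fun k => υ₂ k r) atTop atTop) :
    -- same limit laws as the exactly standardized statistic, under the null hypothesis
    ((∀ k, (E k).NullHypothesis) →
      ∀ b : ℕ → ℝ, Antitone b → (∀ r, b r ∈ Set.Icc (0 : ℝ) 1) →
        (∀ r, Tendsto (fun k => (E k).β r) atTop (𝓝 (b r))) →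
        ∀ {Ω' : Type*} [MeasurableSpace Ω'] (P' : Measure Ω') [IsProbabilityMeasure P']
          (Y : Ω' → ℝ), SplitPlot.IsLimitVariable P' b Y →
          TendstoInDistribution (fun k => (s k).Wtilde) atTop Y P P' ∧
          TendstoInDistribution (fun k => (s k).WB (υ k)) atTop Y P P' ∧
          TendstoInDistribution (fun k => (s k).WBstar (υ₁ k) (υ₂ k)) atTop Y P P') ∧
    -- the estimated degrees of freedom
    ∀ fhat : ∀ k, Ω k → ℝ,
      (fhat = (fun k => (s k).fB (υ k)) ∨ fhat = fun k => (s k).fBstar (υ₁ k) (υ₂ k)) →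
      SplitPlot.TendstoZeroInProb P (fun k ω => 1 / fhat k ω - 1 / (E k).fP) ∧
      -- random variables with estimated degrees of freedom
      (∀ K : ∀ k, Ω k → ℝ, SplitPlot.IsPearsonVariable P fhat K →
        (TendstoInDistribution K atTop id P (gaussianReal 0 1) ↔
          Tendsto (fun k => (E k).β 0) atTop (𝓝 0)) ∧
        (TendstoInDistribution K atTop (fun x => (x - 1) / √2) P (SplitPlot.chiSq 1) ↔
          Tendsto (fun k => (E k).β 0) atTop (𝓝 1))) ∧
      -- the same for the laws given the data
      (SplitPlot.PearsonLawTendsto P fhat (gaussianReal 0 1) ↔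
        Tendsto (fun k => (E k).β 0) atTop (𝓝 0)) ∧
      (SplitPlot.PearsonLawTendsto P fhat
          ((SplitPlot.chiSq 1).map fun x => (x - 1) / √2) ↔
        Tendsto (fun k => (E k).β 0) atTop (𝓝 1)) := by
  -- The three frameworks share `nMin → ∞`, and the relative error bounds depend on the design only
  -- through `nMin`.
  have hn := hE.tendsto_nMin
  have hcB := SplitPlot.isConsistent_B hs hn hυ
  have hcS := SplitPlot.isConsistent_Bstar hs hn hυ₁ hυ₂
  refine ⟨fun h0 b _ _ hb Ω' _ P' _ Y hY => ?_, fun fhat hfhat => ?_⟩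
  · have hQ := fun k => (hs k).aemeasurable_Q
    have hWm : ∀ k, AEMeasurable (s k).Wtilde (P k) := fun k => ((hQ k).sub_const _).div_const _
    have hW : TendstoInDistribution (fun k => (s k).Wtilde) atTop Y P P' :=
      hY.tendstoInDistribution (fun k r => (E k).β_nonneg r) (fun k => (E k).β_antitone)
        (fun k r hr => (E k).β_of_card_le hr) (fun k => (E k).sum_β_sq) hb hWm
        fun k t => (hs k).charFun_Wtilde (h0 k) t
    have hdiv : ∀ {B₁ B₂ B₃ : ∀ k, Ω k → ℝ}, SplitPlot.IsConsistent E P B₁ B₂ B₃ →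
        TendstoInDistribution (fun k ω => ((s k).Q ω - B₁ k ω) / √(2 * B₂ k ω)) atTop Y P P' :=
      fun h => SplitPlot.tendstoInDistribution_of_sub hW
        (fun k => ((hQ k).sub (h.aemeasurable₁ k)).div ((h.aemeasurable₂ k).const_mul 2).sqrt)
        (h.tendsto_standardize hs h0)
    exact ⟨hW, hdiv hcB, hdiv hcS⟩
  · have hf : (∀ k ω, 0 ≤ fhat k ω) ∧
        SplitPlot.TendstoZeroInProb P fun k ω => 1 / fhat k ω - 1 / (E k).fP := by
      rcases hfhat with rfl | rfl
      · exact ⟨fun k ω => div_nonneg (pow_nonneg (SplitPlot.Sample.B₂_nonneg _ _) 3) (sq_nonneg _),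
          hcB.tendsto_one_div⟩
      · exact ⟨fun k ω => div_nonneg (pow_nonneg (SplitPlot.Sample.B₂star_nonneg _ _ _) 3)
          (sq_nonneg _), hcS.tendsto_one_div⟩
    -- With `c = 1/f_P` in `[0, 1]`, the normal law corresponds to the limit `c₀ = 0` and the
    -- standardized `χ²₁` law to `c₀ = 1`.
    have hc := fun k => (E k).one_div_fP_mem
    refine ⟨hf.2, fun K hK => ⟨?_, ?_⟩, ?_, ?_⟩
    · rw [hK.tendstoInDistribution_iff hc le_rfl hf.1 hf.2 aemeasurable_id
        (by rw [Measure.map_id, SplitPlot.pearsonLaw_inv_zero]),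
        SplitPlot.tendsto_one_div_fP_zero_iff]
    · rw [hK.tendstoInDistribution_iff hc zero_le_one hf.1 hf.2 (by fun_prop)
        SplitPlot.chiSq_one_map_eq_pearsonLaw, SplitPlot.tendsto_one_div_fP_one_iff]
    · rw [← SplitPlot.pearsonLaw_inv_zero, SplitPlot.pearsonLawTendsto_iff hc le_rfl hf.1 hf.2,
        SplitPlot.tendsto_one_div_fP_zero_iff]
    · rw [SplitPlot.chiSq_one_map_eq_pearsonLaw,
        SplitPlot.pearsonLawTendsto_iff hc zero_le_one hf.1 hf.2,
        SplitPlot.tendsto_one_div_fP_one_iff]
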